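/- Let $k=k_p$ be positive-integer-valued for large $p$ with $k\to\infty$ and $k=o(p)$ as $p\to\infty$, let $\sigma=\sigma_p>0$ satisfy $\sigma^2=\Theta(1)$, and fix constants $c_\beta>0$ and $\alpha^*\in(0,1)$ not depending on $p$. In the 1-bit model with $n=n_p$ measurements, the support $S$ is uniform over the $k$-element subsets of $\{1,\dots,p\}$; given $S$, the entries of $\beta\in\mathbb{R}^p$ indexed by $S$ are i.i.d. $N(0,c_\beta/k)$ and the others are $0$; the measurement matrix $\mathbf{X}\in\mathbb{R}^{n\times p}$ has i.i.d. $N(0,1)$ entries; and the observations are $Y^{(i)}=\mathrm{sign}(\langle X^{(i)},\beta\rangle+Z^{(i)})$, $i=1,\dots,n$, where $X^{(i)}$ is the $i$-th row of $\mathbf{X}$, the $Z^{(i)}$ are i.i.d. $N(0,\sigma^2)$, $\mathbf{X}$, $\mathbf{Z}$ and $(S,\beta)$ are independent, and $\mathrm{sign}(t)=1$ if $t\ge 0$ and $-1$ otherwise. A (deterministic, measurable) decoder, which may depend on all the parameters of the model, maps $(\mathbf{X},\mathbf{Y})$ to an estimate $\hat S\subseteq\{1,\dots,p\}$. With $d_{\max}=\lfloor\alpha^*k\rfloor$,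 its error probability is $$P_e(d_{\max})=\mathbb{P}\big[|S\setminus\hat S|>d_{\max}\ \text{or}\ |\hat S\setminus S|>d_{\max}\big].$$ Let $W\sim N(0,1)$, $Q(x)=\mathbb{P}[W\ge x]$, $H_2(\rho)=-\rho\log\rho-(1-\rho)\log(1-\rho)$ (natural logarithm), let $F_{\chi^2}$ be the cumulative distribution function of $W^2$, and put $g(\alpha)=\int_0^\infty\max\{0,\alpha-F_{\chi^2}(u)\}\,du$ and $$\Psi(\alpha,c_\beta,\sigma)=\mathbb{E}\bigg[H_2\bigg(Q\bigg(W\sqrt{\tfrac{c_\beta(1-g(\alpha))}{\sigma^2+c_\beta g(\alpha)}}\bigg)\bigg)-H_2\bigg(Q\bigg(W\sqrt{\tfrac{c_\beta}{\sigma^2}}\bigg)\bigg)\bigg].$$ Then $\Psi(\alpha,c_\beta,\sigma)>0$ for all $\alpha\in[\alpha^*,1]$, the two maxima below are attained, and the following hold. (i) If for some fixed $\eta>0$, for all sufficiently large $p$, $$n\ \ge\ \max_{\alpha\in[\alpha^*,1]}\frac{\alpha k\log\frac pk}{\Psi(\alpha,c_\beta,\sigma)}\,(1+\eta),$$ then there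 is a sequence of decoders with $P_e(d_{\max})\to0$ as $p\to\infty$. (ii) If for some fixed $\eta>0$, for all sufficiently large $p$, $$n\ \le\ \max_{\alpha\in[\alpha^*,1]}\frac{(\alpha-\alpha^*)k\log\frac pk}{\Psi(\alpha,c_\beta,\sigma)}\,(1-\eta),$$ then $P_e(d_{\max})\to1$ as $p\to\infty$ for every sequence of decoders. -/

import Mathlib

open MeasureTheory ProbabilityTheory Filter Asymptotics Set
open scoped Topology

noncomputable section

namespace OneBit

/-- The Gaussian tail function `Q(x) = P[W ≥ x]`, `W ∼ N(0,1)`. -/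
def Q (x : ℝ) : ℝ := (gaussianReal 0 1).real (Ici x)

/-- The cumulative distribution function of a chi-squared random variable with one degree of
freedom, that is, of `W ^ 2` with `W ∼ N(0,1)`. -/
def chiSqCDF (u : ℝ) : ℝ := cdf ((gaussianReal 0 1).map (fun w : ℝ => w ^ 2)) u

/-- `g(α) = ∫₀^∞ [α - F(u)]⁺ du`, with `F` the chi-squared distribution function. -/
def g (α : ℝ) : ℝ := ∫ u in Ioi (0 : ℝ), max 0 (α - chiSqCDF u)

/-- `Ψ(α, c, σ)`; `Real.binEntropy` is the binary entropy with natural logarithm. -/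
def Psi (α c σ : ℝ) : ℝ :=
  ∫ w, (Real.binEntropy (Q (w * Real.sqrt (c * (1 - g α) / (σ ^ 2 + c * g α))))
      - Real.binEntropy (Q (w * Real.sqrt (c / σ ^ 2)))) ∂(gaussianReal 0 1)

/-- The quantizer: `1` on non-negative reals and `-1` on negative reals. -/
def sgn (t : ℝ) : ℝ := if 0 ≤ t then 1 else -1

/-- A point of the sample space: the support, a full vector of coefficients (only those indexed by
the support enter the model), the `n × p` measurement matrix, and the noise. -/
abbrev Sample (p n : ℕ) : Type :=
  Finset (Fin p) × (Fin p → ℝ) × (Fin n → Fin p → ℝ) × (Fin n → ℝ)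

/-- The joint law: the support is uniform on the `k`-subsets of the `p` indices, the coefficients
are i.i.d. `N(0, c / k)`, the matrix entries are i.i.d. `N(0, 1)`, the noise variables are
i.i.d. `N(0, σ ^ 2)`, and these four are independent. -/
def law (p n k : ℕ) (c σ : ℝ) : Measure (Sample p n) :=
  (uniformOn {S : Finset (Fin p) | S.card = k}).prod
    ((Measure.pi fun _ : Fin p => gaussianReal 0 (c / k).toNNReal).prod
      ((Measure.pi fun _ : Fin n => Measure.pi fun _ : Fin p => gaussianReal 0 1).prod
        (Measure.pi fun _ : Fin n => gaussianReal 0 (σ ^ 2).toNNReal)))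

/-- The support `S`. -/
def supp {p n : ℕ} (ω : Sample p n) : Finset (Fin p) := ω.1

/-- The sparse vector `β`: zero off the support. -/
def beta {p n : ℕ} (ω : Sample p n) (j : Fin p) : ℝ := if j ∈ supp ω then ω.2.1 j else 0

/-- The measurement matrix. -/
def mat {p n : ℕ} (ω : Sample p n) : Fin n → Fin p → ℝ := ω.2.2.1

/-- The additive noise. -/
def noise {p n : ℕ} (ω : Sample p n) : Fin n → ℝ := ω.2.2.2

/-- The 1-bit observations `Y i = sgn (⟨X i, β⟩ + Z i)`. -/
def obs {p n : ℕ} (ω : Sample p n) (i : Fin n) : ℝ :=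
  sgn (∑ j, mat ω i j * beta ω j + noise ω i)

/-- Deterministic decoders, which map the matrix and the observations to an estimate of the
support. -/
abbrev Decoder (p n : ℕ) : Type := (Fin n → Fin p → ℝ) × (Fin n → ℝ) → Finset (Fin p)

/-- The probability that the decoder misses more than `d` indices of the support or includes more
than `d` indices outside of it. -/
def errProb (p n k : ℕ) (c σ : ℝ) (d : ℕ) (D : Decoder p n) : ℝ :=
  (law p n k c σ).real
    {ω | d < (supp ω \ D (mat ω, obs ω)).card ∨ d < (D (mat ω, obs ω) \ supp ω).card}

/-- `α k log (p / k) / Ψ(α, c, σ)`. -/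
def achObjective (c σ : ℝ) (k p : ℕ) (α : ℝ) : ℝ :=
  α * k * Real.log ((p : ℝ) / k) / Psi α c σ

/-- `(α - α*) k log (p / k) / Ψ(α, c, σ)`. -/
def convObjective (αs c σ : ℝ) (k p : ℕ) (α : ℝ) : ℝ :=
  (α - αs) * k * Real.log ((p : ℝ) / k) / Psi α c σ

/-- The maximum of `achObjective` over `[α*, 1]`. -/
def achThreshold (αs c σ : ℝ) (k p : ℕ) : ℝ := sSup (achObjective c σ k p '' Icc αs 1)

/-- The maximum of `convObjective` over `[α*, 1]`. -/
def convThreshold (αs c σ : ℝ) (k p : ℕ) : ℝ := sSup (convObjective αs c σ k p '' Icc αs 1)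

end OneBit

end

open MeasureTheory ProbabilityTheory Filter Asymptotics Set
open scoped Topology

noncomputable section

namespace OneBit

/-! Split the support into a known part of energy `a` and an unknown part of energy `d`. The rows
are Gaussian, so in one response the unknown part acts as additional independent Gaussian noise of
variance `d` (`integral_Phi_add`). The response then has mean entropy `J (a / (σ ^ 2 + d))`, against
`J ((a + d) / σ ^ 2)` once everything is known, and the difference is the information of one
measurement about the unknown part. The total energy concentrates at `c`, and the least energy that
a fraction `α` of the coefficients can carry is about `c * g α`. So `Psi α c σ` is the information
about the fraction `α` of the support that is hardest to detect.

Achievability (`exists_decoder`): a support `s` is accepted if some quantized signal on it beats, in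
smoothed log-likelihood, each restriction dropping `l > d` indices by `l * log (p / k) + O(k)`. The
true support is accepted by Hoeffding's inequality over its `2 ^ k` subsets, because the mean score
is at least about `n * Psi (l / k) c σ`, for every subset simultaneously
(`exists_typical_coefficients`). For a wrong `s`, the coordinates in `s \ S` are independent of the
responses, so the likelihood ratio of `s` to `s ∩ S` has mean one (`integral_exp_ell_ratio`).
Markov's inequality then gives a factor `(k / p) ^ l`, which pays for the choice of `s` up to a
factor `C ^ k` (`sum_pow_card_sdiff_le`, `decoder_error_bound`).

Converse (`exists_errProb_lower_bound`): coefficients are drawn for all `p` indices independently of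
`S`. Let `U` be the set of indices whose coefficient falls among the smallest values of total
probability `α`. The coefficients, the matrix and `S \ U` may be revealed; about `α * k` indices
remain hidden among about `α * p`. On a typical event the true likelihood is at most `exp (n * Psi +
small)` times a reference likelihood that sees `S` only through `S \ U` (`noise_prob_ratio_le`).
Under that reference, an output with at most `α* k` errors succeeds on a fraction of at most `C ^ k
* exp (-(α - α*) * k * log (p / k))`, up to small terms in the exponent, of the supports
(`sum_success_le`).

Two devices keep this elementary. The response probability is mixed with a constant `ε`, so that its
logarithm `ell` is bounded and Lipschitz at the price of `log (1 - 2 * ε)` per row. All factors `C ^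
k` are negligible because `log (p / k)` tends to infinity. -/

/-- The standard Gaussian distribution function, as a reflected tail. -/
def Phi (x : ℝ) : ℝ := Q (-x)

/-! ### Gaussian tails and the quantizer under Gaussian noise -/

lemma gaussianReal_std_le_volume (s : Set ℝ) : gaussianReal 0 1 s ≤ volume s := by
  rw [gaussianReal_apply 0 one_ne_zero s, ← setLIntegral_one]
  refine lintegral_mono fun x => ?_
  rw [gaussianPDF, gaussianPDFReal_def, ENNReal.ofReal_le_one]
  have h1 : (1 : ℝ) ≤ Real.sqrt (2 * Real.pi * ((1 : NNReal) : ℝ)) := by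
    rw [Real.one_le_sqrt]
    have := Real.pi_gt_three
    norm_num; linarith
  have h2 : Real.exp (-(x - 0) ^ 2 / (2 * ((1 : NNReal) : ℝ))) ≤ 1 := by
    rw [Real.exp_le_one_iff]
    have := sq_nonneg (x - 0)
    norm_num at this ⊢
    linarith
  calc _ ≤ (1 : ℝ) * 1 := mul_le_mul (inv_le_one_of_one_le₀ h1) h2 (by positivity) (by norm_num)
    _ = 1 := by norm_num

lemma noAtoms_std : NullSingletonClass (gaussianReal 0 1) :=
  nullSingletonClass_gaussianReal one_ne_zero

lemma Q_sub_Q {x y : ℝ} (h : x ≤ y) : Q x - Q y = (gaussianReal 0 1).real (Ico x y) := by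
  have : Ici x = Ico x y ∪ Ici y := (Ico_union_Ici_eq_Ici h).symm
  unfold Q
  rw [this, measureReal_union _ measurableSet_Ici]
  · ring
  · rw [Set.disjoint_left]; intro a ha hb; exact absurd hb (not_le.2 ha.2)

lemma Q_strictAnti : StrictAnti Q := by
  intro x y h
  have h1 := Q_sub_Q h.le
  have h2 : 0 < (gaussianReal 0 1).real (Ico x y) := by
    rw [measureReal_def, ENNReal.toReal_pos_iff]
    refine ⟨pos_iff_ne_zero.2 fun h0 => ?_, measure_lt_top _ _⟩
    have := gaussianReal_absolutelyContinuous' 0 (one_ne_zero) h0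
    rw [Real.volume_Ico] at this
    simp only [ENNReal.ofReal_eq_zero] at this
    linarith
  linarith

lemma Q_anti : Antitone Q := Q_strictAnti.antitone

lemma Q_neg (x : ℝ) : Q (-x) = 1 - Q x := by
  have := noAtoms_std
  have h1 : (gaussianReal 0 1).real (Ici (-x)) = (gaussianReal 0 1).real (Iic x) := by
    have h := gaussianReal_map_neg (μ := 0) (v := 1)
    rw [neg_zero] at h
    conv_lhs => rw [← h]
    rw [map_measureReal_apply measurable_neg measurableSet_Ici]
    congr 1
    ext y; simp
  unfold Q
  rw [h1, ← compl_Ioi, probReal_compl_eq_one_sub measurableSet_Ioi]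
  congr 1
  exact measureReal_congr Ioi_ae_eq_Ici

lemma Q_zero : Q 0 = 2⁻¹ := by
  have := Q_neg 0
  rw [neg_zero] at this
  linarith

lemma Q_pos (x : ℝ) : 0 < Q x :=
  lt_of_le_of_lt measureReal_nonneg (Q_strictAnti (lt_add_one x))

lemma Q_lt_one (x : ℝ) : Q x < 1 := by
  have := Q_pos (-x)
  rw [Q_neg] at this
  linarith

/-- The standard Gaussian density is at most `1`, so an interval has no more mass than length. -/
lemma abs_Q_sub_Q_le (x y : ℝ) : |Q x - Q y| ≤ |x - y| := by
  wlog h : x ≤ y generalizing x y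
  · rw [abs_sub_comm, abs_sub_comm x]
    exact this y x (le_of_not_ge h)
  rw [Q_sub_Q h, abs_of_nonneg measureReal_nonneg, abs_sub_comm, abs_of_nonneg (by linarith),
    measureReal_def]
  refine ENNReal.toReal_le_of_le_ofReal (by linarith) ?_
  rw [← Real.volume_Ico]
  exact gaussianReal_std_le_volume _

lemma Q_continuous : Continuous Q := by
  refine Metric.continuous_iff.2 fun b ε hε => ⟨ε, hε, fun a ha => ?_⟩
  rw [Real.dist_eq] at *
  exact (abs_Q_sub_Q_le a b).trans_lt ha

lemma Phi_pos (x : ℝ) : 0 < Phi x := Q_pos _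

lemma Phi_lt_one (x : ℝ) : Phi x < 1 := Q_lt_one _

lemma Phi_neg (x : ℝ) : Phi (-x) = 1 - Phi x := Q_neg _

lemma abs_Phi_sub_le (x y : ℝ) : |Phi x - Phi y| ≤ |x - y| := by
  refine (abs_Q_sub_Q_le _ _).trans_eq ?_
  rw [abs_sub_comm]; congr 1; ring

lemma Phi_continuous : Continuous Phi := Q_continuous.comp continuous_neg

@[fun_prop]
lemma Phi_measurable : Measurable Phi := Phi_continuous.measurable

lemma gaussianReal_Ici {v : NNReal} (hv : v ≠ 0) (t : ℝ) :
    (gaussianReal 0 v).real (Ici t) = Q (t / Real.sqrt v) := by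
  have hs : 0 < Real.sqrt v := Real.sqrt_pos.2 (by positivity)
  have h := gaussianReal_map_const_mul (μ := 0) (v := 1) (Real.sqrt v)
  have h2 : NNReal.mk (Real.sqrt v ^ 2) (sq_nonneg _) * 1 = v := by
    ext; simp
  rw [h2, mul_zero] at h
  rw [← h, map_measureReal_apply (by fun_prop) measurableSet_Ici]
  unfold Q
  congr 1
  ext y
  simp [div_le_iff₀ hs, mul_comm]

lemma sgn_measurable : Measurable sgn :=
  Measurable.ite measurableSet_Ici measurable_const measurable_const

lemma sgn_eq (t : ℝ) : sgn t = 1 ∨ sgn t = -1 := by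
  unfold sgn; split_ifs <;> simp

lemma measure_sgn_eq_one {v : NNReal} (hv : v ≠ 0) (t : ℝ) :
    (gaussianReal 0 v).real {z | sgn (t + z) = 1} = Phi (t / Real.sqrt v) := by
  have : {z | sgn (t + z) = 1} = Ici (-t) := by
    ext z
    simp only [sgn, mem_ofPred_eq, mem_Ici]
    constructor
    · intro h
      by_contra h2
      rw [if_neg (by linarith)] at h
      norm_num at h
    · intro h
      rw [if_pos (by linarith)]
  rw [this, gaussianReal_Ici hv, Phi, neg_div]

lemma measure_sgn_eq_neg_one {v : NNReal} (hv : v ≠ 0) (t : ℝ) :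
    (gaussianReal 0 v).real {z | sgn (t + z) = -1} = Phi (-1 * t / Real.sqrt v) := by
  have h : {z | sgn (t + z) = -1} = {z | sgn (t + z) = 1}ᶜ := by
    ext z
    simp only [mem_ofPred_eq, mem_compl_iff]
    rcases sgn_eq (t + z) with h | h <;> rw [h] <;> norm_num
  rw [h, probReal_compl_eq_one_sub, measure_sgn_eq_one hv, neg_one_mul, neg_div, Phi_neg]
  exact (sgn_measurable.comp (measurable_const_add t)) (measurableSet_singleton 1)

/-- The sign takes two values, so integrating out the noise leaves a two-point average with weights
`Phi` and `1 - Phi`. -/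
lemma integral_sgn {v : NNReal} (hv : v ≠ 0) (t : ℝ) (h : ℝ → ℝ) :
    ∫ z, h (sgn (t + z)) ∂(gaussianReal 0 v)
      = Phi (t / Real.sqrt v) * h 1 + (1 - Phi (t / Real.sqrt v)) * h (-1) := by
  have hm : MeasurableSet {z : ℝ | sgn (t + z) = 1} :=
    (sgn_measurable.comp (measurable_const_add t)) (measurableSet_singleton 1)
  have h1 : ∀ z, h (sgn (t + z)) = {z | sgn (t + z) = 1}.indicator (fun _ => h 1 - h (-1)) z
      + h (-1) := by
    intro z
    rcases sgn_eq (t + z) with h' | h'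
    · rw [indicator_of_mem (by exact h'), h']; ring
    · rw [indicator_of_notMem (by simp only [mem_ofPred_eq, h']; norm_num), h']; ring
  simp_rw [h1]
  rw [integral_add ((integrable_const _).indicator hm) (integrable_const _),
    integral_indicator_const _ hm, measure_sgn_eq_one hv]
  simp only [smul_eq_mul, integral_const, probReal_univ]
  ring

/-! ### Mean entropy of a response as a function of the signal-to-noise ratio -/

/-- The mean of the binary entropy of a Gaussian threshold at signal-to-noise ratio `r`. -/
def J (r : ℝ) : ℝ := ∫ w, Real.binEntropy (Q (w * Real.sqrt r)) ∂(gaussianReal 0 1)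

lemma binEntropy_Q_nonneg (x : ℝ) : 0 ≤ Real.binEntropy (Q x) :=
  Real.binEntropy_nonneg (Q_pos x).le (Q_lt_one x).le

lemma norm_binEntropy_Q_le (x : ℝ) : ‖Real.binEntropy (Q x)‖ ≤ Real.log 2 := by
  rw [Real.norm_of_nonneg (binEntropy_Q_nonneg x)]
  exact Real.binEntropy_le_log_two

lemma binEntropy_Q_continuous : Continuous fun x => Real.binEntropy (Q x) :=
  Real.binEntropy_continuous.comp Q_continuous

lemma integrable_binEntropy_Q (a : ℝ) :
    Integrable (fun w => Real.binEntropy (Q (w * a))) (gaussianReal 0 1) :=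
  Integrable.of_bound (binEntropy_Q_continuous.comp (continuous_mul_const a)).aestronglyMeasurable
    (Real.log 2) (ae_of_all _ fun _ => norm_binEntropy_Q_le _)

lemma J_continuous : Continuous J := by
  refine continuous_of_dominated (bound := fun _ => Real.log 2) ?_ ?_ (integrable_const _) ?_
  · intro r
    exact (binEntropy_Q_continuous.comp (continuous_mul_const _)).aestronglyMeasurable
  · exact fun r => ae_of_all _ fun _ => norm_binEntropy_Q_le _
  · refine ae_of_all _ fun w => binEntropy_Q_continuous.comp ?_
    exact continuous_const.mul Real.continuous_sqrt

lemma J_nonneg (r : ℝ) : 0 ≤ J r := integral_nonneg fun _ => binEntropy_Q_nonneg _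

lemma J_le (r : ℝ) : J r ≤ Real.log 2 := by
  calc J r ≤ ∫ _, Real.log 2 ∂(gaussianReal 0 1) :=
        integral_mono (integrable_binEntropy_Q _) (integrable_const _)
          fun _ => Real.binEntropy_le_log_two
    _ = Real.log 2 := by simp

lemma binEntropy_Q_abs (x : ℝ) : Real.binEntropy (Q |x|) = Real.binEntropy (Q x) := by
  rcases abs_choice x with h | h <;> rw [h]
  rw [Q_neg, Real.binEntropy_one_sub]

lemma binEntropy_Q_strict {x y : ℝ} (hx : 0 ≤ x) (h : x < y) :
    Real.binEntropy (Q y) < Real.binEntropy (Q x) := by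
  have h1 : Q y < Q x := Q_strictAnti h
  have h2 : Q x ≤ 2⁻¹ := by rw [← Q_zero]; exact Q_anti hx
  exact Real.binEntropy_strictMonoOn ⟨(Q_pos y).le, h1.le.trans h2⟩ ⟨(Q_pos x).le, h2⟩ h1

/-- The integrand is even in `w` and strictly decreasing in `|w| * √r`. The two integrands agree
only at `w = 0`, which is a null set, so the strict inequality survives integration. -/
lemma J_strictAntiOn : StrictAntiOn J (Ici 0) := by
  intro r hr s _ hrs
  have hr' : Real.sqrt r < Real.sqrt s := Real.sqrt_lt_sqrt hr hrs
  have := noAtoms_std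
  rw [← sub_pos]
  unfold J
  rw [← integral_sub (integrable_binEntropy_Q _) (integrable_binEntropy_Q _)]
  have key : ∀ w : ℝ, w ≠ 0 →
      Real.binEntropy (Q (w * Real.sqrt s)) < Real.binEntropy (Q (w * Real.sqrt r)) := by
    intro w hw
    rw [← binEntropy_Q_abs, ← binEntropy_Q_abs (w * Real.sqrt r), abs_mul, abs_mul,
      abs_of_nonneg (Real.sqrt_nonneg r), abs_of_nonneg (Real.sqrt_nonneg s)]
    refine binEntropy_Q_strict (by positivity) ?_
    exact mul_lt_mul_of_pos_left hr' (abs_pos.2 hw)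
  rw [integral_pos_iff_support_of_nonneg]
  · have : ({0}ᶜ : Set ℝ) ⊆ Function.support fun w =>
        Real.binEntropy (Q (w * Real.sqrt r)) - Real.binEntropy (Q (w * Real.sqrt s)) := by
      intro w hw
      exact (sub_pos.2 (key w hw)).ne'
    refine lt_of_lt_of_le ?_ (measure_mono this)
    rw [prob_compl_eq_one_sub (measurableSet_singleton 0)]
    simp
  · intro w
    by_cases hw : w = 0
    · simp [hw]
    · exact (sub_pos.2 (key w hw)).le
  · exact (integrable_binEntropy_Q _).sub (integrable_binEntropy_Q _)

lemma J_antitoneOn : AntitoneOn J (Ici 0) := J_strictAntiOn.antitoneOn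

lemma Psi_eq (α c σ : ℝ) :
    Psi α c σ = J (c * (1 - g α) / (σ ^ 2 + c * g α)) - J (c / σ ^ 2) :=
  integral_sub (integrable_binEntropy_Q _) (integrable_binEntropy_Q _)

/-! ### The chi-squared distribution and the truncated energy `g` -/

lemma chiSqCDF_eq_measure (u : ℝ) : chiSqCDF u = (gaussianReal 0 1).real {w | w ^ 2 ≤ u} := by
  have hm : Measurable fun w : ℝ => w ^ 2 := by fun_prop
  have := Measure.isProbabilityMeasure_map (μ := gaussianReal 0 1) hm.aemeasurable
  unfold chiSqCDF
  rw [cdf_eq_real, map_measureReal_apply hm measurableSet_Iic]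
  rfl

lemma chiSqCDF_eq (u : ℝ) : chiSqCDF u = 1 - 2 * Q (Real.sqrt u) := by
  have := noAtoms_std
  rw [chiSqCDF_eq_measure]
  rcases lt_or_ge u 0 with hu | hu
  · have : {w : ℝ | w ^ 2 ≤ u} = ∅ := by
      ext w
      simp only [mem_ofPred_eq, mem_empty_iff_false, iff_false, not_le]
      exact hu.trans_le (sq_nonneg w)
    rw [this, Real.sqrt_eq_zero_of_nonpos hu.le, Q_zero]
    norm_num
  · have h1 : {w : ℝ | w ^ 2 ≤ u} = Icc (-Real.sqrt u) (Real.sqrt u) := by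
      ext w
      rw [mem_ofPred_eq, mem_Icc, ← abs_le]
      rw [Real.le_sqrt (abs_nonneg w) hu, sq_abs]
    rw [h1, measureReal_congr Ico_ae_eq_Icc.symm,
      ← Q_sub_Q (by linarith [Real.sqrt_nonneg u]), Q_neg]
    ring

lemma chiSqCDF_continuous : Continuous chiSqCDF := by
  simp_rw [funext chiSqCDF_eq]
  exact continuous_const.sub (continuous_const.mul (Q_continuous.comp Real.continuous_sqrt))

lemma chiSqCDF_mono : Monotone chiSqCDF := monotone_cdf _

lemma chiSqCDF_zero : chiSqCDF 0 = 0 := by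
  rw [chiSqCDF_eq, Real.sqrt_zero, Q_zero]; norm_num

lemma chiSqCDF_lt_one (u : ℝ) : chiSqCDF u < 1 := by
  rw [chiSqCDF_eq]; linarith [Q_pos (Real.sqrt u)]

lemma exists_quantile {α : ℝ} (h0 : 0 ≤ α) (h1 : α < 1) : ∃ q, 0 ≤ q ∧ chiSqCDF q = α := by
  have ht : Tendsto chiSqCDF atTop (𝓝 1) := tendsto_cdf_atTop _
  obtain ⟨M, hM, hM0⟩ := ((ht.eventually (lt_mem_nhds h1)).and (eventually_ge_atTop 0)).exists
  obtain ⟨q, hq, hqα⟩ := intermediate_value_Icc hM0 chiSqCDF_continuous.continuousOn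
    ⟨chiSqCDF_zero.le.trans h0, hM.le⟩
  exact ⟨q, hq.1, hqα⟩

lemma integrable_pow_std (n : ℕ) : Integrable (fun w : ℝ => w ^ n) (gaussianReal 0 1) := by
  have h := (memLp_id_gaussianReal' (μ := 0) (v := 1) (n : ENNReal) (by simp))
  exact (h.integrable_norm_pow' (p := n)).mono' (by fun_prop) (ae_of_all _ fun w => by simp)

lemma integral_sq_std : ∫ w, w ^ 2 ∂(gaussianReal 0 1) = 1 := by
  have h := variance_fun_id_gaussianReal (μ := 0) (v := 1)
  rw [variance_eq_integral (by fun_prop), integral_id_gaussianReal] at h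
  simpa using h

lemma measure_gt_eq (u : ℝ) :
    (gaussianReal 0 1).real {w | u < w ^ 2} = 1 - chiSqCDF u := by
  have : {w : ℝ | u < w ^ 2} = {w | w ^ 2 ≤ u}ᶜ := by
    ext w; simp
  rw [this, probReal_compl_eq_one_sub (measurableSet_le (by fun_prop) measurable_const),
    chiSqCDF_eq_measure]

/-- By the layer-cake formula the integral is `E[W ^ 2]`, which is finite. This function dominates
all integrands defining `g α` with `α ≤ 1`. -/
lemma integrableOn_one_sub_chiSqCDF :
    IntegrableOn (fun u => 1 - chiSqCDF u) (Ioi 0) := by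
  refine ⟨(continuous_const.sub chiSqCDF_continuous).aestronglyMeasurable, ?_⟩
  have h := lintegral_eq_lintegral_meas_lt (gaussianReal 0 1) (f := fun w : ℝ => w ^ 2)
    (ae_of_all _ fun w => sq_nonneg w) (by fun_prop)
  have h2 := (integrable_pow_std 2).lintegral_lt_top
  rw [h] at h2
  refine lt_of_eq_of_lt ?_ h2
  refine lintegral_congr fun u => ?_
  rw [show (fun u => 1 - chiSqCDF u) u = (gaussianReal 0 1).real {w | u < w ^ 2} from
    (measure_gt_eq u).symm, Real.enorm_of_nonneg measureReal_nonneg, measureReal_def,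
    ENNReal.ofReal_toReal (measure_ne_top _ _)]

lemma integrableOn_g {α : ℝ} (h1 : α ≤ 1) :
    IntegrableOn (fun u => max 0 (α - chiSqCDF u)) (Ioi 0) := by
  refine Integrable.mono' integrableOn_one_sub_chiSqCDF
    (continuous_const.max (continuous_const.sub chiSqCDF_continuous)).aestronglyMeasurable
    (ae_of_all _ fun u => ?_)
  rw [Real.norm_of_nonneg (le_max_left _ _)]
  exact max_le (by linarith [chiSqCDF_lt_one u]) (by linarith)

lemma g_nonneg (α : ℝ) : 0 ≤ g α := integral_nonneg fun _ => le_max_left _ _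

lemma g_mono {α α' : ℝ} (h : α ≤ α') (h1 : α' ≤ 1) : g α ≤ g α' :=
  integral_mono (integrableOn_g (h.trans h1)) (integrableOn_g h1) fun u =>
    max_le_max le_rfl (by linarith)

lemma g_continuousOn : ContinuousOn g (Iic 1) := by
  refine continuousOn_of_dominated (bound := fun u => 1 - chiSqCDF u) ?_ ?_
    integrableOn_one_sub_chiSqCDF ?_
  · intro α _
    exact (continuous_const.max (continuous_const.sub chiSqCDF_continuous)).aestronglyMeasurable
  · intro α hα
    refine ae_of_all _ fun u => ?_
    rw [Real.norm_of_nonneg (le_max_left _ _)]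
    exact max_le (by linarith [chiSqCDF_lt_one u]) (by linarith [mem_Iic.1 hα])
  · exact ae_of_all _ fun u =>
      (continuous_const.max (continuous_id.sub continuous_const)).continuousOn

/-- Layer-cake formula for `w ^ 2` restricted to `w ^ 2 ≤ q`: its level set above `u > 0` is `{u < w
^ 2 ≤ q}`, of mass `max 0 (F q - F u)`. This identifies `g` with the energy carried by the smallest
values. -/
lemma g_chiSqCDF (q : ℝ) :
    g (chiSqCDF q) = ∫ w in {w : ℝ | w ^ 2 ≤ q}, w ^ 2 ∂(gaussianReal 0 1) := by
  have hA : MeasurableSet {w : ℝ | w ^ 2 ≤ q} := measurableSet_le (by fun_prop) measurable_const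
  rw [← integral_indicator hA]
  rw [Integrable.integral_eq_integral_meas_lt ((integrable_pow_std 2).indicator hA)
    (ae_of_all _ fun w => indicator_nonneg (fun _ _ => sq_nonneg _) w)]
  refine setIntegral_congr_fun measurableSet_Ioi fun u hu => ?_
  have hu0 : 0 < u := hu
  have h1 : {w : ℝ | u < ({w : ℝ | w ^ 2 ≤ q}).indicator (fun w => w ^ 2) w}
      = {w | w ^ 2 ≤ q} \ {w | w ^ 2 ≤ u} := by
    ext w
    by_cases hw : w ^ 2 ≤ q
    · rw [mem_ofPred_eq, indicator_of_mem (by exact hw)]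
      simp [hw]
    · rw [mem_ofPred_eq, indicator_of_notMem (by exact hw)]
      simp [hw, hu0.le]
  simp only [h1]
  rcases le_total u q with h | h
  · rw [measureReal_sdiff (show {w : ℝ | w ^ 2 ≤ u} ⊆ {w | w ^ 2 ≤ q} from fun w hw => le_trans hw h)
      (measurableSet_le (by fun_prop) measurable_const), ← chiSqCDF_eq_measure,
      ← chiSqCDF_eq_measure, max_eq_right (sub_nonneg.2 (chiSqCDF_mono h))]
  · rw [sdiff_eq_empty.2 (show {w : ℝ | w ^ 2 ≤ q} ⊆ {w | w ^ 2 ≤ u} from fun w hw => le_trans hw h),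
      max_eq_left (sub_nonpos.2 (chiSqCDF_mono h))]
    simp

lemma g_one : g 1 = 1 := by
  refine Eq.trans ?_ ((Integrable.integral_eq_integral_meas_lt (integrable_pow_std 2)
    (ae_of_all _ fun w => sq_nonneg w)).symm.trans integral_sq_std)
  refine setIntegral_congr_fun measurableSet_Ioi fun u _ => ?_
  simp only [measure_gt_eq]
  exact max_eq_right (sub_nonneg.2 (chiSqCDF_lt_one u).le)

lemma g_le_one {α : ℝ} (h : α ≤ 1) : g α ≤ 1 := (g_mono h le_rfl).trans_eq g_one

/-- The set of the smallest values of a Gaussian variable having a given probability; its second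
moment is `g`. -/
lemma exists_small_set {α : ℝ} (h0 : 0 ≤ α) (h1 : α ≤ 1) :
    ∃ A : Set ℝ, MeasurableSet A ∧ (gaussianReal 0 1).real A = α ∧
      ∫ w in A, w ^ 2 ∂(gaussianReal 0 1) = g α := by
  rcases h1.lt_or_eq with h | rfl
  · obtain ⟨q, hq, rfl⟩ := exists_quantile h0 h
    exact ⟨{w | w ^ 2 ≤ q}, measurableSet_le (by fun_prop) measurable_const,
      (chiSqCDF_eq_measure q).symm, (g_chiSqCDF q).symm⟩
  · exact ⟨univ, MeasurableSet.univ, by simp, by rw [setIntegral_univ, integral_sq_std, g_one]⟩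

lemma g_pos {α : ℝ} (h0 : 0 < α) (h1 : α ≤ 1) : 0 < g α := by
  obtain ⟨A, hA, hα, hg⟩ := exists_small_set h0.le h1
  rw [← hg]
  have := noAtoms_std
  refine (setIntegral_pos_iff_support_of_nonneg_ae (ae_of_all _ fun w => sq_nonneg w)
    (integrable_pow_std 2).integrableOn).2 ?_
  have hsub : A \ {0} ⊆ (Function.support fun w : ℝ => w ^ 2) ∩ A := by
    rintro w ⟨hw, hw0⟩
    exact ⟨pow_ne_zero 2 hw0, hw⟩
  refine lt_of_lt_of_le ?_ (measure_mono hsub)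
  rw [measure_sdiff_null (measure_singleton 0)]
  rw [measureReal_def] at hα
  exact (ENNReal.toReal_pos_iff.1 (hα ▸ h0)).1

/-- Lagrangian form of the least energy, with the `α`-quantile of `W ^ 2` as multiplier. It
expresses `g α` through the mean of a single function of `W`, so a law of large numbers for that
function bounds the energy of all subsets at once (see `mul_card_sub_hinge_le`). At `α = 1` no
finite quantile exists. -/
lemma exists_dual {α : ℝ} (h0 : 0 ≤ α) (h1 : α < 1) :
    ∃ q, 0 ≤ q ∧ q * α - ∫ w, max (q - w ^ 2) 0 ∂(gaussianReal 0 1) = g α := by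
  obtain ⟨q, hq, rfl⟩ := exists_quantile h0 h1
  refine ⟨q, hq, ?_⟩
  have hA : MeasurableSet {w : ℝ | w ^ 2 ≤ q} := measurableSet_le (by fun_prop) measurable_const
  have h : ∀ w : ℝ, max (q - w ^ 2) 0 = {w : ℝ | w ^ 2 ≤ q}.indicator (fun w => q - w ^ 2) w := by
    intro w
    by_cases hw : w ^ 2 ≤ q
    · rw [indicator_of_mem (by exact hw), max_eq_left (by linarith)]
    · rw [indicator_of_notMem (by exact hw), max_eq_right (by linarith)]
  simp_rw [h]
  rw [integral_indicator hA, integral_sub (integrable_const _) (integrable_pow_std 2).integrableOn,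
    g_chiSqCDF q, chiSqCDF_eq_measure]
  simp
  ring

/-! ### Sign, monotonicity and continuity of `Psi`; the maxima -/

lemma snr_nonneg {c v α : ℝ} (hc : 0 < c) (hv : 0 < v) (h1 : α ≤ 1) :
    0 ≤ c * (1 - g α) / (v + c * g α) := by
  have := g_nonneg α
  have := g_le_one h1
  exact div_nonneg (mul_nonneg hc.le (by linarith)) (by positivity)

/-- Moving the positive energy `c * g α` from the signal to the noise strictly lowers the
signal-to-noise ratio, and `J` is strictly decreasing. -/
lemma Psi_pos {α c σ : ℝ} (hc : 0 < c) (hσ : 0 < σ) (h0 : 0 < α) (h1 : α ≤ 1) :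
    0 < Psi α c σ := by
  rw [Psi_eq, sub_pos]
  have hg := g_pos h0 h1
  refine J_strictAntiOn (snr_nonneg hc (by positivity) h1) (mem_Ici.2 (by positivity)) ?_
  rw [div_lt_div_iff₀ (by positivity) (by positivity)]
  have h2 : 0 < c * g α := by positivity
  have h3 : 0 < σ ^ 2 := by positivity
  nlinarith [mul_pos h2 h3, mul_pos h2 hc]

lemma Psi_le {α c σ : ℝ} : Psi α c σ ≤ Real.log 2 := by
  rw [Psi_eq]
  linarith [J_le (c * (1 - g α) / (σ ^ 2 + c * g α)), J_nonneg (c / σ ^ 2)]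

lemma Psi_mono {α α' c σ : ℝ} (hc : 0 < c) (hσ : 0 < σ) (h : α ≤ α') (h1 : α' ≤ 1) :
    Psi α c σ ≤ Psi α' c σ := by
  rw [Psi_eq, Psi_eq]
  refine sub_le_sub_right (J_antitoneOn (snr_nonneg hc (by positivity) h1)
    (snr_nonneg hc (by positivity) (h.trans h1)) ?_) _
  have h0 := g_nonneg α
  have h2 := g_mono h h1
  have h3 := g_le_one h1
  refine div_le_div₀ (mul_nonneg hc.le (by linarith)) ?_ (by positivity) ?_
  · exact mul_le_mul_of_nonneg_left (by linarith) hc.le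
  · nlinarith

lemma Psi_continuousOn {c σ : ℝ} (hc : 0 < c) (hσ : 0 < σ) :
    ContinuousOn (fun α => Psi α c σ) (Iic 1) := by
  simp_rw [Psi_eq]
  refine (J_continuous.comp_continuousOn (ContinuousOn.div ?_ ?_ fun α _ => ?_)).sub
    continuousOn_const
  · exact continuousOn_const.mul (continuousOn_const.sub g_continuousOn)
  · exact continuousOn_const.add (continuousOn_const.mul g_continuousOn)
  · have := g_nonneg α
    positivity

lemma isGreatest_image_of_continuousOn {f : ℝ → ℝ} {a b : ℝ} (h : a ≤ b)
    (hf : ContinuousOn f (Icc a b)) : IsGreatest (f '' Icc a b) (sSup (f '' Icc a b)) :=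
  (isCompact_Icc.image_of_continuousOn hf).isGreatest_sSup ((nonempty_Icc.2 h).image f)

lemma Psi_continuousOn_Icc {c σ a : ℝ} (hc : 0 < c) (hσ : 0 < σ) :
    ContinuousOn (fun α => Psi α c σ) (Icc a 1) :=
  (Psi_continuousOn hc hσ).mono fun _ h => h.2

lemma isGreatest_achThreshold {c σ αs : ℝ} (hc : 0 < c) (hσ : 0 < σ) (hαs : αs ∈ Ioo (0 : ℝ) 1)
    (k p : ℕ) : IsGreatest (achObjective c σ k p '' Icc αs 1) (achThreshold αs c σ k p) := by
  refine isGreatest_image_of_continuousOn hαs.2.le (ContinuousOn.div (by fun_prop)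
    (Psi_continuousOn_Icc hc hσ) fun α hα => (Psi_pos hc hσ (hαs.1.trans_le hα.1) hα.2).ne')

lemma isGreatest_convThreshold {c σ αs : ℝ} (hc : 0 < c) (hσ : 0 < σ) (hαs : αs ∈ Ioo (0 : ℝ) 1)
    (k p : ℕ) : IsGreatest (convObjective αs c σ k p '' Icc αs 1) (convThreshold αs c σ k p) := by
  refine isGreatest_image_of_continuousOn hαs.2.le (ContinuousOn.div (by fun_prop)
    (Psi_continuousOn_Icc hc hσ) fun α hα => (Psi_pos hc hσ (hαs.1.trans_le hα.1) hα.2).ne')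

/-! ### Bounds uniform in the noise level; stability of the information -/

/-- `Psi` is bounded below when the noise level ranges over a compact set. -/
lemma exists_Psi_lower_bound {c α s₁ s₂ : ℝ} (hc : 0 < c) (h0 : 0 < α) (h1 : α ≤ 1) (hs₁ : 0 < s₁) :
    ∃ ψ > 0, ∀ σ, 0 < σ → s₁ ≤ σ ^ 2 → σ ^ 2 ≤ s₂ → ψ ≤ Psi α c σ := by
  rcases lt_or_ge s₂ s₁ with hs | hs
  · exact ⟨1, one_pos, fun σ _ h h' => absurd (h.trans h') (not_le.2 hs)⟩
  have hcont : ContinuousOn (fun v : ℝ => Psi α c (Real.sqrt v)) (Icc s₁ s₂) := by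
    have hg := g_nonneg α
    simp_rw [Psi_eq]
    refine ContinuousOn.sub (J_continuous.comp_continuousOn (ContinuousOn.div (by fun_prop)
      (by fun_prop) fun v hv => ?_)) (J_continuous.comp_continuousOn (ContinuousOn.div (by fun_prop)
      (by fun_prop) fun v hv => ?_))
    all_goals
      have : 0 < Real.sqrt v := Real.sqrt_pos.2 (hs₁.trans_le hv.1)
      positivity
  obtain ⟨v, hv, hmin⟩ := isCompact_Icc.exists_isMinOn (nonempty_Icc.2 hs) hcont
  refine ⟨_, Psi_pos hc (Real.sqrt_pos.2 (hs₁.trans_le hv.1)) h0 h1, fun σ hσ h h' => ?_⟩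
  have := hmin (show σ ^ 2 ∈ Icc s₁ s₂ from ⟨h, h'⟩)
  simpa [Real.sqrt_sq hσ.le] using this

lemma exists_J_modulus {R δ : ℝ} (hδ : 0 < δ) :
    ∃ κ > 0, ∀ x y, 0 ≤ x → 0 ≤ y → x ≤ R → y ≤ R → |x - y| ≤ κ → |J x - J y| ≤ δ := by
  have h := isCompact_Icc.uniformContinuousOn_of_continuous (J_continuous.continuousOn
    (s := Icc 0 R))
  obtain ⟨κ, hκ, H⟩ := Metric.uniformContinuousOn_iff.1 h δ hδ
  refine ⟨κ / 2, by positivity, fun x y hx hy hxR hyR hxy => ?_⟩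
  exact (H x ⟨hx, hxR⟩ y ⟨hy, hyR⟩ (by rw [Real.dist_eq]; linarith)).le

lemma snr_le {c v κ t d t' d' s : ℝ} (hc : 0 < c) (hs : 0 < s) (hsv : s ≤ v) (hκ : 0 ≤ κ)
    (hd : 0 ≤ d) (hd' : 0 ≤ d') (ht' : 0 ≤ t') (htc : t' ≤ c)
    (ht : t - t' ≤ κ) (hdd : d' - d ≤ κ) :
    (t - d) / (v + d) - (t' - d') / (v + d') ≤ κ / s * (2 + c / s) := by
  have hv : 0 < v := hs.trans_le hsv
  have hD : 0 < v + d := by linarith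
  have hN : 0 < v + d' := by linarith
  have e : (t - d) / (v + d) - (t' - d') / (v + d')
      = (t - t') / (v + d) + (d' - d) / (v + d) * ((t' + v) / (v + d')) := by
    field_simp
    ring
  have h1 : (t - t') / (v + d) ≤ κ / s :=
    div_le_div₀ hκ ht hs (by linarith)
  have h2 : (d' - d) / (v + d) ≤ κ / s :=
    div_le_div₀ hκ hdd hs (by linarith)
  have h3 : (t' + v) / (v + d') ≤ 1 + c / s := by
    calc (t' + v) / (v + d') ≤ (c + v) / v :=
          div_le_div₀ (by linarith) (by linarith) hv (by linarith)
      _ = 1 + c / v := by field_simp; ring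
      _ ≤ 1 + c / s := by gcongr
  have h0 : 0 ≤ κ / s := by positivity
  have h4 : (d' - d) / (v + d) * ((t' + v) / (v + d')) ≤ κ / s * (1 + c / s) :=
    mul_le_mul h2 h3 (div_nonneg (by linarith) hN.le) h0
  rw [e]
  linarith

lemma snr_le_bound {v t d C s : ℝ} (hs : 0 < s) (hsv : s ≤ v) (hd : 0 ≤ d) (htC : t ≤ C)
    (hdt : d ≤ t) : (t - d) / (v + d) ≤ C / s :=
  div_le_div₀ (by linarith) (by linarith) hs (by linarith)

/-- Since `J` is decreasing, only an increase of the signal-to-noise ratio can lower it, and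
`snr_le` bounds that increase. Closeness of the energies is therefore needed on one side only; in
particular a lower bound on the unknown energy is enough for achievability. -/
lemma exists_snr_modulus {c s δ : ℝ} (hc : 0 < c) (hs : 0 < s) (hδ : 0 < δ) :
    ∃ κ > 0, κ ≤ 1 ∧ ∀ t d t' d' v : ℝ, s ≤ v → 0 ≤ d → d ≤ t → 0 ≤ d' → d' ≤ t' → t ≤ c + 1 →
      t' ≤ c + 1 → t - t' ≤ κ → d' - d ≤ κ →
      J ((t' - d') / (v + d')) - δ ≤ J ((t - d) / (v + d)) := by
  obtain ⟨κ₀, hκ₀, H⟩ := exists_J_modulus (R := (c + 1) / s) hδ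
  have hK : 0 < 2 + (c + 1) / s := by positivity
  refine ⟨min 1 (κ₀ * s / (2 + (c + 1) / s)), by positivity, min_le_left _ _, ?_⟩
  intro t d t' d' v hsv hd hdt hd' hdt' htc htc' htt hdd
  have hv : 0 < v := hs.trans_le hsv
  have hx : 0 ≤ (t - d) / (v + d) := div_nonneg (by linarith) (by linarith)
  have hy : 0 ≤ (t' - d') / (v + d') := div_nonneg (by linarith) (by linarith)
  rcases le_total ((t - d) / (v + d)) ((t' - d') / (v + d')) with h | h
  · have := J_antitoneOn hx hy h
    linarith
  · have h1 := snr_le (t := t) (d := d) (t' := t') (d' := d') (by linarith : 0 < c + 1) hs hsv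
      (le_min zero_le_one (by positivity)) hd hd' (hd'.trans hdt') htc' htt hdd
    have h2 : min 1 (κ₀ * s / (2 + (c + 1) / s)) / s * (2 + (c + 1) / s) ≤ κ₀ := by
      calc _ ≤ (κ₀ * s / (2 + (c + 1) / s)) / s * (2 + (c + 1) / s) := by
            gcongr; exact min_le_right _ _
        _ = κ₀ := by field_simp
    have := H _ _ hx hy (snr_le_bound hs hsv hd htc hdt) (snr_le_bound hs hsv hd' htc' hdt')
      (by rw [abs_of_nonneg (by linarith)]; linarith)
    linarith [(abs_le.1 this).1]

/-- The information of a split of the energy `t` close to `c` into a revealed part and a part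
`d` close to `c * g α` is close to `Psi α c σ`. -/
lemma exists_information_modulus {c s δ : ℝ} (hc : 0 < c) (hs : 0 < s) (hδ : 0 < δ) :
    ∃ κ > 0, ∀ σ α t d : ℝ, s ≤ σ ^ 2 → α ≤ 1 → 0 ≤ d → d ≤ t → |t - c| ≤ κ →
      (c * g α - κ ≤ d → Psi α c σ - δ ≤ J ((t - d) / (σ ^ 2 + d)) - J (t / σ ^ 2)) ∧
      (d ≤ c * g α + κ → J ((t - d) / (σ ^ 2 + d)) - J (t / σ ^ 2) ≤ Psi α c σ + δ) := by
  obtain ⟨κ, hκ, hκ1, H⟩ := exists_snr_modulus hc hs (half_pos hδ)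
  refine ⟨κ, hκ, fun σ α t d hσ h1 hd hdt htc => ?_⟩
  obtain ⟨ht1, ht2⟩ := abs_le.1 htc
  have hg := g_nonneg α
  have hg1 := g_le_one h1
  have hcg : 0 ≤ c * g α := by positivity
  have hcg1 : c * g α ≤ c := mul_le_of_le_one_right hc.le hg1
  have e : c * (1 - g α) = c - c * g α := by ring
  -- With no unknown part these two compare `J (t / σ ^ 2)` and `J (c / σ ^ 2)` in both directions.
  -- The other half of `δ` is spent below on the term with an unknown part.
  have a1 := H t 0 c 0 (σ ^ 2) hσ le_rfl (hd.trans hdt) le_rfl hc.le (by linarith) (by linarith)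
    (by linarith) (by linarith)
  have a2 := H c 0 t 0 (σ ^ 2) hσ le_rfl hc.le le_rfl (hd.trans hdt) (by linarith) (by linarith)
    (by linarith) (by linarith)
  simp only [sub_zero, add_zero] at a1 a2
  rw [Psi_eq, e]
  constructor
  · intro h
    have := H t d c (c * g α) (σ ^ 2) hσ hd hdt hcg hcg1 (by linarith) (by linarith)
      (by linarith) (by linarith)
    linarith
  · intro h
    have := H c (c * g α) t d (σ ^ 2) hσ hcg hcg1 hd hdt (by linarith) (by linarith)
      (by linarith) (by linarith)
    linarith

/-! ### Projections of a Gaussian row -/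

/-- The inner product of a row with a vector. -/
def ip {p : ℕ} (x θ : Fin p → ℝ) : ℝ := ∑ j, x j * θ j

/-- The law of a row of the measurement matrix. -/
abbrev stdRow (p : ℕ) : Measure (Fin p → ℝ) := Measure.pi fun _ : Fin p => gaussianReal 0 1

/-- The vector supported on `A` with entries `b j / s`. -/
def dir {p : ℕ} (A : Finset (Fin p)) (b : Fin p → ℝ) (s : ℝ) (j : Fin p) : ℝ :=
  if j ∈ A then b j / s else 0

/-- The energy of `b` on `A`. -/
def en {p : ℕ} (A : Finset (Fin p)) (b : Fin p → ℝ) : ℝ := ∑ j ∈ A, b j ^ 2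

lemma en_nonneg {p : ℕ} (A : Finset (Fin p)) (b : Fin p → ℝ) : 0 ≤ en A b :=
  Finset.sum_nonneg fun _ _ => sq_nonneg _

lemma en_add_en_sdiff {p : ℕ} {A S : Finset (Fin p)} (h : A ⊆ S) (b : Fin p → ℝ) :
    en A b + en (S \ A) b = en S b := by
  unfold en
  rw [add_comm, Finset.sum_sdiff h]

@[fun_prop]
lemma measurable_ip {p : ℕ} (θ : Fin p → ℝ) : Measurable fun x : Fin p → ℝ => ip x θ := by
  unfold ip
  fun_prop

lemma ip_dir {p : ℕ} (A : Finset (Fin p)) (b x : Fin p → ℝ) (s : ℝ) :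
    ip x (dir A b s) = ip x (dir A b 1) / s := by
  unfold ip dir
  rw [Finset.sum_div]
  refine Finset.sum_congr rfl fun j _ => ?_
  split_ifs <;> simp [mul_div_assoc]

lemma ip_dir_eq_sum {p : ℕ} (A : Finset (Fin p)) (b x : Fin p → ℝ) (s : ℝ) :
    ip x (dir A b s) = ∑ j ∈ A, x j * (b j / s) := by
  unfold ip dir
  simp [Finset.sum_ite_mem]

lemma ip_dir_add {p : ℕ} {A S : Finset (Fin p)} (h : A ⊆ S) (b x : Fin p → ℝ) :
    ip x (dir S b 1) = ip x (dir A b 1) + ip x (dir (S \ A) b 1) := by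
  rw [ip_dir_eq_sum, ip_dir_eq_sum, ip_dir_eq_sum, add_comm, Finset.sum_sdiff h]

lemma map_ip {p : ℕ} (θ : Fin p → ℝ) :
    (stdRow p).map (fun x => ip x θ) = gaussianReal 0 (∑ j, θ j ^ 2).toNNReal := by
  have hm : ∀ j, Measurable fun y : ℝ => y * θ j := fun j => by fun_prop
  have hind : iIndepFun (fun j (x : Fin p → ℝ) => x j * θ j) (stdRow p) :=
    iIndepFun_pi fun j => (hm j).aemeasurable
  have hmap : ∀ j, (stdRow p).map (fun x => x j * θ j)
      = gaussianReal (θ j * 0) (NNReal.mk (θ j ^ 2) (sq_nonneg _) * 1) := by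
    intro j
    have h1 := (measurePreserving_eval (fun _ : Fin p => gaussianReal 0 1) j).map_eq
    have h2 := gaussianReal_map_mul_const (μ := 0) (v := 1) (θ j)
    rw [← h2, ← h1, Measure.map_map (hm j) (by fun_prop)]
    rfl
  have hL : ∀ j, HasGaussianLaw (fun x : Fin p → ℝ => x j * θ j) (stdRow p) := fun j => by
    refine ⟨?_⟩
    rw [hmap j]
    infer_instance
  have hG : HasGaussianLaw (fun x : Fin p → ℝ => ip x θ) (stdRow p) :=
    hind.hasGaussianLaw_fun_sum hL
  have hint : ∀ j, ∫ x, x j * θ j ∂(stdRow p) = 0 := by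
    intro j
    have := integral_map (μ := stdRow p) (φ := fun x : Fin p → ℝ => x j * θ j) (f := fun y => y)
      ((measurable_pi_apply j).mul_const _).aemeasurable measurable_id.aestronglyMeasurable
    rw [← this, hmap j, integral_id_gaussianReal, mul_zero]
  have hvar : Var[fun x : Fin p → ℝ => ip x θ; stdRow p] = ∑ j, θ j ^ 2 := by
    have h := variance_sum_pi (μ := fun _ : Fin p => gaussianReal 0 1)
      (X := fun j y => y * θ j) (fun j =>
        (memLp_id_gaussianReal' (μ := 0) (v := 1) 2 (by simp)).mul_const (θ j))
    have e : (∑ j, fun x : Fin p → ℝ => x j * θ j) = fun x => ip x θ := by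
      ext x; simp [ip]
    rw [e] at h
    rw [h]
    refine Finset.sum_congr rfl fun j _ => ?_
    rw [variance_mul_const, variance_fun_id_gaussianReal]
    simp
  rw [hG.map_eq_gaussianReal, hvar]
  congr 1
  unfold ip
  rw [integral_finsetSum _ fun j _ => (hL j).integrable]
  simp [hint]

lemma sum_dir_sq {p : ℕ} (A : Finset (Fin p)) (b : Fin p → ℝ) (s : ℝ) :
    ∑ j, dir A b s j ^ 2 = en A b / s ^ 2 := by
  unfold dir en
  rw [Finset.sum_div]
  simp [ite_pow, div_pow, Finset.sum_ite_mem]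

/-- The projection of a row to some coordinates is independent of every quantity that depends
on the other coordinates only. -/
lemma map_ip_prod {p : ℕ} {E : Type*} [MeasurableSpace E] (A B : Finset (Fin p))
    (hAB : Disjoint A B) (b : Fin p → ℝ) (F : (B → ℝ) → E) (hF : Measurable F) :
    (stdRow p).map (fun x => (ip x (dir A b 1), F fun j => x j))
      = (gaussianReal 0 (en A b).toNNReal).prod ((stdRow p).map fun x => F fun j => x j) := by
  have hind : iIndepFun (fun j (x : Fin p → ℝ) => x j) (stdRow p) :=
    iIndepFun_pi (X := fun _ y => y) fun j => aemeasurable_id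
  have h := hind.indepFun_finset A B hAB fun j => measurable_pi_apply j
  have h2 := h.comp (φ := fun y : A → ℝ => ∑ j, y j * b j) (ψ := F) (by fun_prop) hF
  have e : (fun y : A → ℝ => ∑ j, y j * b j) ∘ (fun (x : Fin p → ℝ) (j : A) => x j)
      = fun x => ip x (dir A b 1) := by
    ext x
    rw [ip_dir_eq_sum]
    simp only [Function.comp, div_one]
    exact Finset.sum_coe_sort A fun j => x j * b j
  rw [e] at h2
  have h3 := (indepFun_iff_map_prod_eq_prod_map_map (by fun_prop)
    (hF.comp (by fun_prop)).aemeasurable).1 h2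
  rw [map_ip, sum_dir_sq] at h3
  simpa [Function.comp_def] using h3

lemma sqrt_add_pos {σ d : ℝ} (hσ : 0 < σ) (hd : 0 ≤ d) : 0 < Real.sqrt (σ ^ 2 + d) :=
  Real.sqrt_pos.2 (by positivity)

/-- The noise law. -/
abbrev noiseLaw (σ : ℝ) : Measure ℝ := gaussianReal 0 (σ ^ 2).toNNReal

lemma toNNReal_sq_ne_zero {σ : ℝ} (hσ : 0 < σ) : (σ ^ 2).toNNReal ≠ 0 := by
  simpa using hσ.ne'

lemma sqrt_toNNReal_sq {σ : ℝ} (hσ : 0 < σ) : Real.sqrt ((σ ^ 2).toNNReal : ℝ) = σ := by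
  rw [Real.coe_toNNReal _ (sq_nonneg _), Real.sqrt_sq hσ.le]

lemma integrable_Phi_comp {Ω : Type*} [MeasurableSpace Ω] {μ : Measure Ω} [IsFiniteMeasure μ]
    {f : Ω → ℝ} (hf : Measurable f) : Integrable (fun x => Phi (f x)) μ :=
  Integrable.of_bound (Phi_measurable.comp hf).aestronglyMeasurable 1
    (ae_of_all _ fun x => by
      rw [Real.norm_of_nonneg (Phi_pos _).le]; exact (Phi_lt_one _).le)

/-- Averaging the response probability over an unknown Gaussian contribution. -/
lemma integral_Phi_add {σ d : ℝ} (hσ : 0 < σ) (hd : 0 ≤ d) (u : ℝ) :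
    ∫ v, Phi ((u + v) / σ) ∂(gaussianReal 0 d.toNNReal) = Phi (u / Real.sqrt (σ ^ 2 + d)) := by
  set h : ℝ → ℝ := fun y => if y = 1 then 1 else 0 with hh
  have hm : Measurable h := Measurable.ite (measurableSet_singleton 1) measurable_const
    measurable_const
  have h1 : h 1 = 1 := if_pos rfl
  have h2 : h (-1) = 0 := if_neg (by norm_num)
  have hv : (d.toNNReal + (σ ^ 2).toNNReal) ≠ 0 := by
    have := toNNReal_sq_ne_zero hσ
    positivity
  have e := integral_sgn hv u h
  have es : Real.sqrt ((d.toNNReal + (σ ^ 2).toNNReal : NNReal) : ℝ) = Real.sqrt (σ ^ 2 + d) := by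
    rw [NNReal.coe_add, Real.coe_toNNReal _ hd, Real.coe_toNNReal _ (sq_nonneg _), add_comm]
  rw [es, h1, h2, mul_one, mul_zero, add_zero] at e
  -- Both sides are the probability of a positive response to `u` under noise of variance `σ ^ 2 +
  -- d`; the left side conditions on the summand of variance `d`.
  rw [← e, show gaussianReal 0 (d.toNNReal + (σ ^ 2).toNNReal)
    = gaussianReal 0 d.toNNReal ∗ gaussianReal 0 (σ ^ 2).toNNReal by
      rw [gaussianReal_conv_gaussianReal, add_zero], integral_conv]
  · refine integral_congr_ae (ae_of_all _ fun v => ?_)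
    have := integral_sgn (toNNReal_sq_ne_zero hσ) (u + v) h
    rw [sqrt_toNNReal_sq hσ, h1, h2, mul_one, mul_zero, add_zero] at this
    simp only [← this, add_assoc]
  · refine Integrable.of_bound
      (hm.comp (sgn_measurable.comp (measurable_const_add u))).aestronglyMeasurable 1
      (ae_of_all _ fun y => ?_)
    simp only [hh]
    split_ifs <;> simp

/-! ### The smoothed log-likelihood and its mean over one row -/

/-- The logarithm of the response probability, smoothed so as to be bounded. -/
def ell (ε x : ℝ) : ℝ := Real.log ((1 - 2 * ε) * Phi x + ε)

lemma smooth_bounds {ε : ℝ} (h0 : 0 < ε) (h1 : ε < 1 / 2) (x : ℝ) :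
    ε ≤ (1 - 2 * ε) * Phi x + ε ∧ (1 - 2 * ε) * Phi x + ε ≤ 1 := by
  have := Phi_pos x
  have := Phi_lt_one x
  have h2 : 0 < 1 - 2 * ε := by linarith
  constructor <;> nlinarith

lemma exp_ell {ε : ℝ} (h0 : 0 < ε) (h1 : ε < 1 / 2) (x : ℝ) :
    Real.exp (ell ε x) = (1 - 2 * ε) * Phi x + ε :=
  Real.exp_log (h0.trans_le (smooth_bounds h0 h1 x).1)

lemma ell_nonpos {ε : ℝ} (h0 : 0 < ε) (h1 : ε < 1 / 2) (x : ℝ) : ell ε x ≤ 0 :=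
  Real.log_nonpos (h0.le.trans (smooth_bounds h0 h1 x).1) (smooth_bounds h0 h1 x).2

lemma log_le_ell {ε : ℝ} (h0 : 0 < ε) (h1 : ε < 1 / 2) (x : ℝ) : Real.log ε ≤ ell ε x :=
  Real.log_le_log h0 (smooth_bounds h0 h1 x).1

lemma abs_ell_le {ε : ℝ} (h0 : 0 < ε) (h1 : ε < 1 / 2) (x : ℝ) : |ell ε x| ≤ -Real.log ε := by
  rw [abs_of_nonpos (ell_nonpos h0 h1 x)]
  linarith [log_le_ell h0 h1 x]

@[fun_prop]
lemma ell_measurable (ε : ℝ) : Measurable (ell ε) := by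
  unfold ell
  fun_prop

lemma log_sub_log_le {a b ε : ℝ} (hε : 0 < ε) (ha : ε ≤ a) (hb : ε ≤ b) :
    Real.log a - Real.log b ≤ |a - b| / ε := by
  have ha' : 0 < a := hε.trans_le ha
  have hb' : 0 < b := hε.trans_le hb
  rw [← Real.log_div ha'.ne' hb'.ne']
  calc Real.log (a / b) ≤ a / b - 1 := Real.log_le_sub_one_of_pos (by positivity)
    _ = (a - b) / b := by field_simp
    _ ≤ |a - b| / ε := div_le_div₀ (abs_nonneg _) (le_abs_self _) hε hb

lemma ell_sub_le {ε : ℝ} (h0 : 0 < ε) (h1 : ε < 1 / 2) (x y : ℝ) :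
    ell ε x - ell ε y ≤ |x - y| / ε := by
  refine (log_sub_log_le h0 (smooth_bounds h0 h1 x).1 (smooth_bounds h0 h1 y).1).trans ?_
  refine div_le_div_of_nonneg_right ?_ h0.le
  have e : (1 - 2 * ε) * Phi x + ε - ((1 - 2 * ε) * Phi y + ε) = (1 - 2 * ε) * (Phi x - Phi y) := by
    ring
  rw [e, abs_mul, abs_of_pos (by linarith : 0 < 1 - 2 * ε)]
  calc (1 - 2 * ε) * |Phi x - Phi y| ≤ 1 * |Phi x - Phi y| := by gcongr; linarith
    _ ≤ |x - y| := by rw [one_mul]; exact abs_Phi_sub_le x y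

lemma abs_ell_sub_le {ε : ℝ} (h0 : 0 < ε) (h1 : ε < 1 / 2) (x y : ℝ) :
    |ell ε x - ell ε y| ≤ |x - y| / ε := by
  rw [abs_le]
  have h := ell_sub_le h0 h1 y x
  rw [abs_sub_comm] at h
  exact ⟨by linarith, ell_sub_le h0 h1 x y⟩

/-- The expected smoothed log-likelihood of a binary response is close to minus its entropy. -/
lemma expected_ell_bounds {ε : ℝ} (h0 : 0 < ε) (h1 : ε < 1 / 2) (x : ℝ) :
    -Real.binEntropy (Q x) + Real.log (1 - 2 * ε) ≤ Phi x * ell ε x + (1 - Phi x) * ell ε (-x) ∧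
      Phi x * ell ε x + (1 - Phi x) * ell ε (-x) ≤ -Real.binEntropy (Q x) := by
  have hQ : Q x = 1 - Phi x := by rw [← Phi_neg, Phi, neg_neg]
  rw [hQ, Real.binEntropy_one_sub]
  unfold ell
  rw [Phi_neg]
  have hp := Phi_pos x
  have hp1 := Phi_lt_one x
  set q := Phi x
  have hq' : 0 < 1 - q := by linarith
  have h2 : 0 < 1 - 2 * ε := by linarith
  have hH : -Real.binEntropy q = q * Real.log q + (1 - q) * Real.log (1 - q) := by
    unfold Real.binEntropy
    rw [Real.log_inv, Real.log_inv]; ring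
  have a1 : 0 < (1 - 2 * ε) * q + ε := by positivity
  have a2 : 0 < (1 - 2 * ε) * (1 - q) + ε := by positivity
  rw [hH]
  constructor
  · have b1 : Real.log (1 - 2 * ε) + Real.log q ≤ Real.log ((1 - 2 * ε) * q + ε) := by
      rw [← Real.log_mul h2.ne' hp.ne']
      exact Real.log_le_log (by positivity) (by linarith)
    have b2 : Real.log (1 - 2 * ε) + Real.log (1 - q) ≤ Real.log ((1 - 2 * ε) * (1 - q) + ε) := by
      rw [← Real.log_mul h2.ne' hq'.ne']
      exact Real.log_le_log (by positivity) (by linarith)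
    nlinarith
  · have b1 : Real.log ((1 - 2 * ε) * q + ε) - Real.log q ≤ ((1 - 2 * ε) * q + ε) / q - 1 := by
      rw [← Real.log_div a1.ne' hp.ne']
      exact Real.log_le_sub_one_of_pos (by positivity)
    have b2 : Real.log ((1 - 2 * ε) * (1 - q) + ε) - Real.log (1 - q)
        ≤ ((1 - 2 * ε) * (1 - q) + ε) / (1 - q) - 1 := by
      rw [← Real.log_div a2.ne' hq'.ne']
      exact Real.log_le_sub_one_of_pos (by positivity)
    have c1 := mul_le_mul_of_nonneg_left b1 hp.le
    have c2 := mul_le_mul_of_nonneg_left b2 hq'.le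
    have e1 : q * (((1 - 2 * ε) * q + ε) / q - 1) = (1 - 2 * ε) * q + ε - q := by field_simp
    have e2 : (1 - q) * (((1 - 2 * ε) * (1 - q) + ε) / (1 - q) - 1)
        = (1 - 2 * ε) * (1 - q) + ε - (1 - q) := by field_simp
    rw [e1] at c1
    rw [e2] at c2
    linarith

/-- The joint law of a row and its noise. -/
abbrev rowLaw (p : ℕ) (σ : ℝ) : Measure ((Fin p → ℝ) × ℝ) := (stdRow p).prod (noiseLaw σ)

/-- The response to the signal `β`. -/
def resp {p : ℕ} (β : Fin p → ℝ) (ω : (Fin p → ℝ) × ℝ) : ℝ := sgn (ip ω.1 β + ω.2)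

@[fun_prop]
lemma resp_measurable {p : ℕ} (β : Fin p → ℝ) : Measurable (resp β) :=
  sgn_measurable.comp (((measurable_ip β).comp measurable_fst).add measurable_snd)

lemma integrable_ell_comp {Ω : Type*} [MeasurableSpace Ω] {μ : Measure Ω} [IsFiniteMeasure μ]
    {ε : ℝ} (h0 : 0 < ε) (h1 : ε < 1 / 2) {f : Ω → ℝ} (hf : Measurable f) :
    Integrable (fun x => ell ε (f x)) μ :=
  Integrable.of_bound ((ell_measurable ε).comp hf).aestronglyMeasurable (-Real.log ε)
    (ae_of_all _ fun _ => abs_ell_le h0 h1 _)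

/-- The noise is integrated out first, then the projection on `S \ A`, which is independent of the
one on `A`. The scale `√(σ ^ 2 + en (S \ A) b)` makes the argument of `ell` equal to that of the
resulting response probability, so the mean is a negative entropy up to smoothing. -/
lemma expected_ell_row {p : ℕ} {σ ε : ℝ} (hσ : 0 < σ) (h0 : 0 < ε) (h1 : ε < 1 / 2)
    {A S : Finset (Fin p)} (hAS : A ⊆ S) (b : Fin p → ℝ) :
    ∫ ω, ell ε (resp (dir S b 1) ω * ip ω.1 (dir A b (Real.sqrt (σ ^ 2 + en (S \ A) b))))
        ∂(rowLaw p σ)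
      = ∫ w, (Phi (w * Real.sqrt (en A b / (σ ^ 2 + en (S \ A) b)))
            * ell ε (w * Real.sqrt (en A b / (σ ^ 2 + en (S \ A) b)))
          + (1 - Phi (w * Real.sqrt (en A b / (σ ^ 2 + en (S \ A) b))))
            * ell ε (-(w * Real.sqrt (en A b / (σ ^ 2 + en (S \ A) b))))) ∂(gaussianReal 0 1) := by
  have hd := en_nonneg (S \ A) b
  have ha := en_nonneg A b
  set d := en (S \ A) b with hdd
  set a := en A b with haa
  set s := Real.sqrt (σ ^ 2 + d) with hs
  have hs0 : 0 < s := sqrt_add_pos hσ hd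
  set f : ℝ × ℝ → ℝ := fun y => Phi ((y.2 + y.1) / σ) * ell ε (y.2 / s)
    + (1 - Phi ((y.2 + y.1) / σ)) * ell ε (-(y.2 / s)) with hf
  have hfm : Measurable f := by fun_prop
  have hfb : ∀ y, |f y| ≤ -Real.log ε := by
    intro y
    have e1 := abs_ell_le h0 h1 (y.2 / s)
    have e2 := abs_ell_le h0 h1 (-(y.2 / s))
    have e3 := Phi_pos ((y.2 + y.1) / σ)
    have e4 := Phi_lt_one ((y.2 + y.1) / σ)
    rw [abs_le] at *
    constructor <;> simp only [hf] <;> nlinarith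
  have hfi : ∀ μ : Measure (ℝ × ℝ), IsFiniteMeasure μ → Integrable f μ := fun μ _ =>
    Integrable.of_bound hfm.aestronglyMeasurable _ (ae_of_all _ hfb)
  have step1 : ∫ ω, ell ε (resp (dir S b 1) ω * ip ω.1 (dir A b s)) ∂(rowLaw p σ)
      = ∫ x, f (ip x (dir (S \ A) b 1), ip x (dir A b 1)) ∂(stdRow p) := by
    rw [integral_prod _ (integrable_ell_comp h0 h1 (by fun_prop))]
    refine integral_congr_ae (ae_of_all _ fun x => ?_)
    have := integral_sgn (toNNReal_sq_ne_zero hσ) (ip x (dir S b 1))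
      (fun y => ell ε (y * ip x (dir A b s)))
    rw [sqrt_toNNReal_sq hσ] at this
    simp only [resp, this, hf]
    rw [ip_dir_add hAS, ip_dir A b x s]
    simp
  have step2 : (stdRow p).map (fun x => (ip x (dir (S \ A) b 1), ip x (dir A b 1)))
      = (gaussianReal 0 d.toNNReal).prod (gaussianReal 0 a.toNNReal) := by
    have := map_ip_prod (S \ A) A Finset.sdiff_disjoint b (fun y : A → ℝ => ∑ j, y j * b j)
      (by fun_prop)
    have e : ∀ x : Fin p → ℝ, ∑ j : A, x j * b j = ip x (dir A b 1) := by
      intro x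
      rw [ip_dir_eq_sum]
      simp only [div_one]
      exact Finset.sum_coe_sort A fun j => x j * b j
    simp_rw [e] at this
    rw [this, map_ip, sum_dir_sq, one_pow, div_one]
  have step3 : ∀ u, ∫ v, f (v, u) ∂(gaussianReal 0 d.toNNReal)
      = Phi (u / s) * ell ε (u / s) + (1 - Phi (u / s)) * ell ε (-(u / s)) := by
    intro u
    have hi : Integrable (fun v => Phi ((u + v) / σ)) (gaussianReal 0 d.toNNReal) :=
      integrable_Phi_comp (by fun_prop)
    have hi2 : Integrable (fun v => 1 - Phi ((u + v) / σ)) (gaussianReal 0 d.toNNReal) :=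
      (integrable_const _).sub hi
    simp only [hf]
    rw [integral_add (hi.mul_const _) (hi2.mul_const _),
      integral_mul_const, integral_mul_const, integral_sub (integrable_const _) hi,
      integral_Phi_add hσ hd]
    simp [hs]
  have hmap : gaussianReal 0 a.toNNReal = (gaussianReal 0 1).map fun w => w * Real.sqrt a := by
    rw [gaussianReal_map_mul_const, mul_zero]
    congr 1
    ext
    simp [Real.coe_toNNReal _ ha, Real.sq_sqrt ha]
  rw [step1]
  have := integral_map (μ := stdRow p)
    (φ := fun x => (ip x (dir (S \ A) b 1), ip x (dir A b 1))) (f := f) (by fun_prop)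
    hfm.aestronglyMeasurable
  rw [← this, step2, integral_prod_symm _ (hfi _ inferInstance)]
  simp_rw [step3]
  rw [hmap, integral_map (by fun_prop) (by fun_prop : Measurable _).aestronglyMeasurable]
  have e : ∀ w, w * Real.sqrt a / s = w * Real.sqrt (a / (σ ^ 2 + d)) := by
    intro w
    rw [Real.sqrt_div' _ (by positivity), mul_div_assoc]
  simp_rw [e]

/-- The expected smoothed log-likelihood given part of the signal. -/
lemma expected_ell_bounds_row {p : ℕ} {σ ε : ℝ} (hσ : 0 < σ) (h0 : 0 < ε) (h1 : ε < 1 / 2)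
    {A S : Finset (Fin p)} (hAS : A ⊆ S) (b : Fin p → ℝ) :
    -J (en A b / (σ ^ 2 + en (S \ A) b)) + Real.log (1 - 2 * ε) ≤
      ∫ ω, ell ε (resp (dir S b 1) ω * ip ω.1 (dir A b (Real.sqrt (σ ^ 2 + en (S \ A) b))))
        ∂(rowLaw p σ) ∧
    ∫ ω, ell ε (resp (dir S b 1) ω * ip ω.1 (dir A b (Real.sqrt (σ ^ 2 + en (S \ A) b))))
        ∂(rowLaw p σ) ≤ -J (en A b / (σ ^ 2 + en (S \ A) b)) := by
  rw [expected_ell_row hσ h0 h1 hAS]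
  set r := Real.sqrt (en A b / (σ ^ 2 + en (S \ A) b)) with hr
  have hi := integrable_binEntropy_Q r
  have hin : Integrable (fun w => -Real.binEntropy (Q (w * r))) (gaussianReal 0 1) := hi.neg
  have hJ : J (en A b / (σ ^ 2 + en (S \ A) b))
    = ∫ w, Real.binEntropy (Q (w * r)) ∂(gaussianReal 0 1) := rfl
  have hint : Integrable (fun w => Phi (w * r) * ell ε (w * r)
      + (1 - Phi (w * r)) * ell ε (-(w * r))) (gaussianReal 0 1) := by
    refine Integrable.of_bound (by fun_prop : Measurable _).aestronglyMeasurable (-Real.log ε)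
      (ae_of_all _ fun w => ?_)
    have e1 := abs_ell_le h0 h1 (w * r)
    have e2 := abs_ell_le h0 h1 (-(w * r))
    have e3 := Phi_pos (w * r)
    have e4 := Phi_lt_one (w * r)
    rw [Real.norm_eq_abs]
    rw [abs_le] at *
    constructor <;> nlinarith
  rw [hJ, ← integral_neg]
  constructor
  · have e : ∫ w, -Real.binEntropy (Q (w * r)) ∂(gaussianReal 0 1) + Real.log (1 - 2 * ε)
        = ∫ w, (-Real.binEntropy (Q (w * r)) + Real.log (1 - 2 * ε)) ∂(gaussianReal 0 1) := by
      rw [integral_add hin (integrable_const _)]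
      simp
    rw [e]
    exact integral_mono (hin.add (integrable_const _)) hint
      fun w => (expected_ell_bounds h0 h1 _).1
  · exact integral_mono hint hin fun w => (expected_ell_bounds h0 h1 _).2

/-! ### Dependence on the direction, and the mean-one likelihood ratio -/

lemma integral_sq_gaussianReal (v : NNReal) : ∫ x, x ^ 2 ∂(gaussianReal 0 v) = v := by
  have h := variance_fun_id_gaussianReal (μ := 0) (v := v)
  rw [variance_eq_integral (by fun_prop), integral_id_gaussianReal] at h
  simpa using h

lemma memLp_ip {p : ℕ} (θ : Fin p → ℝ) : MemLp (fun x => ip x θ) 2 (stdRow p) := by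
  have h : MemLp id 2 ((stdRow p).map fun x => ip x θ) := by
    rw [map_ip]
    exact memLp_id_gaussianReal' 2 (by simp)
  exact (memLp_map_measure_iff (g := id) (f := fun x => ip x θ)
    measurable_id.aestronglyMeasurable (measurable_ip θ).aemeasurable).1 h

lemma integral_ip_sq {p : ℕ} (θ : Fin p → ℝ) : ∫ x, ip x θ ^ 2 ∂(stdRow p) = ∑ j, θ j ^ 2 := by
  have h := integral_map (μ := stdRow p) (φ := fun x => ip x θ) (f := fun y => y ^ 2)
    (by fun_prop) (by fun_prop : Measurable _).aestronglyMeasurable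
  rw [← h, map_ip, integral_sq_gaussianReal,
    Real.coe_toNNReal _ (Finset.sum_nonneg fun _ _ => sq_nonneg _)]

/-- Nonnegativity of the variance of `|ip x θ|`, whose second moment is the squared norm of `θ`. -/
lemma integral_abs_ip_le {p : ℕ} (θ : Fin p → ℝ) :
    ∫ x, |ip x θ| ∂(stdRow p) ≤ Real.sqrt (∑ j, θ j ^ 2) := by
  have h := variance_nonneg (fun x => |ip x θ|) (stdRow p)
  have hL : MemLp (fun x => |ip x θ|) 2 (stdRow p) := (memLp_ip θ).abs
  rw [variance_eq_sub hL] at h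
  refine Real.le_sqrt_of_sq_le ?_
  have e : ∫ x, ((fun x => |ip x θ|) ^ 2) x ∂(stdRow p) = ∑ j, θ j ^ 2 := by
    rw [← integral_ip_sq]
    simp
  rw [e] at h
  linarith

lemma ip_sub {p : ℕ} (x θ θ' : Fin p → ℝ) : ip x θ - ip x θ' = ip x (θ - θ') := by
  unfold ip
  rw [← Finset.sum_sub_distrib]
  simp [mul_sub]

lemma abs_resp {p : ℕ} (β : Fin p → ℝ) (ω : (Fin p → ℝ) × ℝ) : |resp β ω| = 1 := by
  unfold resp
  rcases sgn_eq (ip ω.1 β + ω.2) with h | h <;> rw [h] <;> simp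

/-- The expected smoothed log-likelihood is a Lipschitz function of the direction. -/
lemma abs_integral_ell_sub_le {p : ℕ} {σ ε : ℝ} (h0 : 0 < ε) (h1 : ε < 1 / 2)
    (β θ θ' : Fin p → ℝ) :
    |∫ ω, ell ε (resp β ω * ip ω.1 θ) ∂(rowLaw p σ) - ∫ ω, ell ε (resp β ω * ip ω.1 θ') ∂(rowLaw p σ)|
      ≤ Real.sqrt (∑ j, (θ j - θ' j) ^ 2) / ε := by
  rw [← integral_sub (integrable_ell_comp h0 h1 (by fun_prop))
    (integrable_ell_comp h0 h1 (by fun_prop))]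
  have hi : Integrable (fun ω : (Fin p → ℝ) × ℝ => |ip ω.1 (θ - θ')|) (rowLaw p σ) :=
    ((memLp_ip (θ - θ')).integrable (by norm_num)).abs.comp_fst (ν := noiseLaw σ)
  calc _ ≤ ∫ ω, |ell ε (resp β ω * ip ω.1 θ) - ell ε (resp β ω * ip ω.1 θ')| ∂(rowLaw p σ) :=
        abs_integral_le_integral_abs
    _ ≤ ∫ ω, |ip ω.1 (θ - θ')| / ε ∂(rowLaw p σ) := by
        refine integral_mono ((integrable_ell_comp h0 h1 (by fun_prop)).sub
          (integrable_ell_comp h0 h1 (by fun_prop))).abs (hi.div_const ε) fun ω => ?_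
        refine (abs_ell_sub_le h0 h1 _ _).trans_eq ?_
        rw [← mul_sub, abs_mul, abs_resp, one_mul, ip_sub]
    _ = (∫ x, |ip x (θ - θ')| ∂(stdRow p)) / ε := by
        rw [integral_div, integral_prod _ hi]
        simp
    _ ≤ _ := div_le_div_of_nonneg_right (integral_abs_ip_le _) h0.le

/-- Likelihood ratio between a candidate signal `b` on `A ∪ B` and its part on `A`, for a response
that does not involve the coordinates in `B`. -/
lemma integral_exp_ell_ratio {p : ℕ} {σ ε : ℝ} (hσ : 0 < σ) (h0 : 0 < ε) (h1 : ε < 1 / 2)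
    {S s : Finset (Fin p)} (b' b : Fin p → ℝ) :
    ∫ ω, Real.exp (ell ε (resp (dir S b' 1) ω * ip ω.1 (dir s b σ))
        - ell ε (resp (dir S b' 1) ω
            * ip ω.1 (dir (s ∩ S) b (Real.sqrt (σ ^ 2 + en (s \ (s ∩ S)) b))))) ∂(rowLaw p σ) = 1 := by
  set B := s \ (s ∩ S) with hB
  have hBS : Disjoint B S := by
    rw [hB, Finset.sdiff_inter_self_left]
    exact Finset.sdiff_disjoint
  have hd := en_nonneg B b
  set d := en B b with hdd
  set τ := Real.sqrt (σ ^ 2 + d) with hτ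
  have hτ0 : 0 < τ := sqrt_add_pos hσ hd
  have h2 : 0 < 1 - 2 * ε := by linarith
  rw [integral_prod_symm]
  swap
  · refine Integrable.of_bound (by fun_prop : Measurable _).aestronglyMeasurable
      (Real.exp (-Real.log ε)) (ae_of_all _ fun ω => ?_)
    rw [Real.norm_of_nonneg (Real.exp_pos _).le]
    refine Real.exp_le_exp.2 ?_
    linarith [ell_nonpos h0 h1 (resp (dir S b' 1) ω * ip ω.1 (dir s b σ)),
      log_le_ell h0 h1 (resp (dir S b' 1) ω * ip ω.1 (dir (s ∩ S) b τ))]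
  have key : ∀ z, ∫ x, Real.exp (ell ε (resp (dir S b' 1) (x, z) * ip x (dir s b σ))
        - ell ε (resp (dir S b' 1) (x, z) * ip x (dir (s ∩ S) b τ))) ∂(stdRow p) = 1 := by
    intro z
    -- `F` collects all that depends on the coordinates in `S`: the response and the projection on
    -- `s ∩ S`. Since `B` is disjoint from `S`, the projection on `B` is independent of it.
    set F : (S → ℝ) → ℝ × ℝ := fun y =>
      (sgn (∑ j, y j * b' j + z), ∑ j : S, y j * (if (j : Fin p) ∈ s then b j else 0)) with hF
    have hFm : Measurable F := by
      refine Measurable.prodMk (sgn_measurable.comp (by fun_prop)) (by fun_prop)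
    have hF1 : ∀ x : Fin p → ℝ, F (fun j => x j) = (resp (dir S b' 1) (x, z),
        ip x (dir (s ∩ S) b 1)) := by
      intro x
      simp only [hF, resp]
      rw [ip_dir_eq_sum, ip_dir_eq_sum]
      simp only [div_one]
      rw [Finset.sum_coe_sort S fun j => x j * b' j,
        Finset.sum_coe_sort S fun j => x j * (if j ∈ s then b j else 0)]
      congr 1
      rw [Finset.inter_comm, ← Finset.sum_ite_mem]
      refine Finset.sum_congr rfl fun j _ => ?_
      split_ifs <;> simp
    have hmap := map_ip_prod B S hBS b F hFm
    set f : ℝ × (ℝ × ℝ) → ℝ := fun y =>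
      Real.exp (ell ε (y.2.1 * ((y.2.2 + y.1) / σ)) - ell ε (y.2.1 * (y.2.2 / τ))) with hf
    have hfm : Measurable f := by fun_prop
    have hfb : ∀ y, ‖f y‖ ≤ Real.exp (-Real.log ε) := by
      intro y
      rw [Real.norm_of_nonneg (Real.exp_pos _).le]
      refine Real.exp_le_exp.2 ?_
      linarith [ell_nonpos h0 h1 (y.2.1 * ((y.2.2 + y.1) / σ)),
        log_le_ell h0 h1 (y.2.1 * (y.2.2 / τ))]
    have e1 : ∀ x, Real.exp (ell ε (resp (dir S b' 1) (x, z) * ip x (dir s b σ))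
        - ell ε (resp (dir S b' 1) (x, z) * ip x (dir (s ∩ S) b τ)))
        = f (ip x (dir B b 1), F fun j => x j) := by
      intro x
      rw [hF1]
      simp only [hf]
      rw [ip_dir s, ip_dir (s ∩ S) b x τ, ip_dir_add Finset.inter_subset_left]
    have hFx : Measurable fun x : Fin p → ℝ => F fun j => x j := hFm.comp (by fun_prop)
    simp_rw [e1]
    have e2 := integral_map (μ := stdRow p)
      (φ := fun x => (ip x (dir B b 1), F fun j => x j)) (f := f)
      ((measurable_ip _).prodMk hFx).aemeasurable hfm.aestronglyMeasurable
    have hprob : IsProbabilityMeasure ((stdRow p).map fun x => F fun j => x j) :=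
      Measure.isProbabilityMeasure_map hFx.aemeasurable
    rw [← e2, hmap, integral_prod_symm _ (Integrable.of_bound hfm.aestronglyMeasurable _
      (ae_of_all _ hfb)), integral_map hFx.aemeasurable]
    · have e3 : ∀ x : Fin p → ℝ, ∫ v, f (v, F fun j => x j) ∂(gaussianReal 0 d.toNNReal) = 1 := by
        intro x
        rw [hF1]
        set u := ip x (dir (s ∩ S) b 1)
        have hy : ∀ y : ℝ, y = 1 ∨ y = -1 →
            ∫ v, Phi (y * ((u + v) / σ)) ∂(gaussianReal 0 d.toNNReal) = Phi (y * (u / τ)) := by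
          rintro y (rfl | rfl)
          · simp only [one_mul]
            exact integral_Phi_add hσ hd u
          · simp only [neg_one_mul, Phi_neg]
            rw [integral_sub (integrable_const _) (integrable_Phi_comp (by fun_prop)),
              integral_Phi_add hσ hd u]
            simp [hτ]
        have := hy _ (sgn_eq (ip (x, z).1 (dir S b' 1) + (x, z).2))
        -- The smoothing is affine in `Phi`, so averaging the numerator over the projection on `B`
        -- reproduces the denominator exactly.
        simp only [hf, resp, Real.exp_sub, exp_ell h0 h1]
        have hpos := h0.trans_le (smooth_bounds h0 h1
          (sgn (ip (x, z).1 (dir S b' 1) + (x, z).2) * (u / τ))).1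
        rw [integral_div, integral_add ((integrable_Phi_comp (by fun_prop)).const_mul _)
          (integrable_const _), integral_const_mul, this]
        simp only [integral_const, probReal_univ, smul_eq_mul, one_mul]
        exact div_self hpos.ne'
      exact (integral_congr_ae (ae_of_all _ e3)).trans (by simp)
    · exact (hfm.stronglyMeasurable.integral_prod_left'
        (μ := gaussianReal 0 d.toNNReal)).aestronglyMeasurable
  exact (integral_congr_ae (ae_of_all _ key)).trans (by simp)

/-! ### Concentration of sums over the rows -/

/-- The joint law of the measurement matrix and the noise. -/
abbrev obsLaw (n p : ℕ) (σ : ℝ) : Measure ((Fin n → Fin p → ℝ) × (Fin n → ℝ)) :=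
  (Measure.pi fun _ : Fin n => stdRow p).prod (Measure.pi fun _ : Fin n => noiseLaw σ)

/-- The sum of a row statistic over all rows. -/
def rowSum {n p : ℕ} (f : (Fin p → ℝ) × ℝ → ℝ) (ω : (Fin n → Fin p → ℝ) × (Fin n → ℝ)) : ℝ :=
  ∑ i, f (ω.1 i, ω.2 i)

lemma rowSum_measurable {n p : ℕ} {f : (Fin p → ℝ) × ℝ → ℝ} (hf : Measurable f) :
    Measurable (rowSum (n := n) f) := by
  unfold rowSum
  exact Finset.measurable_sum _ fun i _ => hf.comp (by fun_prop)

lemma iIndepFun_rows {n p : ℕ} {σ : ℝ} {f : (Fin p → ℝ) × ℝ → ℝ} (hf : Measurable f) :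
    iIndepFun (fun (i : Fin n) (ω : Fin n → (Fin p → ℝ) × ℝ) => f (ω i))
      (Measure.pi fun _ : Fin n => rowLaw p σ) :=
  iIndepFun_pi fun _ => hf.aemeasurable

/-- The model keeps matrix and noise as two separate families, whereas independence is used for the
pairs (row, noise); this transports one law to the other. -/
lemma measurePreserving_rows (n p : ℕ) (σ : ℝ) :
    MeasurePreserving (MeasurableEquiv.arrowProdEquivProdArrow (Fin p → ℝ) ℝ (Fin n))
      (Measure.pi fun _ : Fin n => rowLaw p σ) (obsLaw n p σ) :=
  measurePreserving_arrowProdEquivProdArrow _ _ _ _ _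

lemma obsLaw_real_rowSum {n p : ℕ} {σ : ℝ} {f : (Fin p → ℝ) × ℝ → ℝ} (hf : Measurable f)
    {T : Set ℝ} (hT : MeasurableSet T) :
    (obsLaw n p σ).real {ω | rowSum f ω ∈ T}
      = (Measure.pi fun _ : Fin n => rowLaw p σ).real {ω | ∑ i, f (ω i) ∈ T} := by
  have h : MeasurableSet {ω : (Fin n → Fin p → ℝ) × (Fin n → ℝ) | rowSum f ω ∈ T} :=
    rowSum_measurable hf hT
  rw [← (measurePreserving_rows n p σ).map_eq,
    map_measureReal_apply (MeasurableEquiv.measurable _) h]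
  rfl

/-- Hoeffding's inequality. The variance proxy `n * B ^ 2` is relaxed to `N * B ^ 2` for a real `N ≥
n`, since in the converse only an upper bound on the number of measurements is available. -/
lemma obsLaw_rowSum_ge_le {n p : ℕ} {σ : ℝ} {f : (Fin p → ℝ) × ℝ → ℝ} (hf : Measurable f)
    {B N t : ℝ} (hB : ∀ ω, |f ω| ≤ B) (hN : n ≤ N) (ht : 0 ≤ t) :
    (obsLaw n p σ).real {ω | n * ∫ ω, f ω ∂(rowLaw p σ) + t ≤ rowSum f ω}
      ≤ Real.exp (-t ^ 2 / (2 * (N * B ^ 2))) := by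
  set m := ∫ ω, f ω ∂(rowLaw p σ) with hm
  set ν := Measure.pi fun _ : Fin n => rowLaw p σ with hν
  have hB0 : 0 ≤ B := (abs_nonneg _).trans (hB (0, 0))
  have h1 := obsLaw_real_rowSum (n := n) (σ := σ) hf (T := Ici (n * m + t)) measurableSet_Ici
  have h2 : {ω : Fin n → (Fin p → ℝ) × ℝ | ∑ i, f (ω i) ∈ Ici (n * m + t)}
      = {ω | t ≤ ∑ i, (f (ω i) - m)} := by
    ext ω
    simp only [mem_ofPred_eq, mem_Ici, Finset.sum_sub_distrib, Finset.sum_const, Finset.card_univ,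
      Fintype.card_fin, nsmul_eq_mul]
    constructor <;> intro h <;> linarith
  have hsub : ∀ i ∈ (Finset.univ : Finset (Fin n)),
      HasSubgaussianMGF (fun ω : Fin n → (Fin p → ℝ) × ℝ => f (ω i) - m)
        ((‖B - -B‖₊ / 2) ^ 2) ν := by
    intro i _
    have h := hasSubgaussianMGF_of_mem_Icc (μ := ν) (X := fun ω => f (ω i)) (a := -B) (b := B)
      (hf.comp (measurable_pi_apply i)).aemeasurable (ae_of_all _ fun ω => abs_le.1 (hB _))
    have e : ∫ ω, f (ω i) ∂ν = m := by
      have := (measurePreserving_eval (fun _ : Fin n => rowLaw p σ) i)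
      rw [hm, ← this.map_eq, integral_map (measurable_pi_apply i).aemeasurable hf.aestronglyMeasurable]
    rwa [e] at h
  have hs := HasSubgaussianMGF.sum_of_iIndepFun
    (iIndepFun_rows (σ := σ) (hf.sub_const m)) hsub
  have hc : ((∑ _i : Fin n, (‖B - -B‖₊ / 2) ^ 2 : NNReal) : ℝ) ≤ ((N * B ^ 2).toNNReal : ℝ) := by
    have hN0 : 0 ≤ N := (Nat.cast_nonneg n).trans hN
    rw [Real.coe_toNNReal _ (by positivity)]
    push_cast
    rw [Finset.sum_const, Finset.card_univ, Fintype.card_fin, nsmul_eq_mul, Real.norm_eq_abs,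
      show B - -B = 2 * B by ring, abs_of_nonneg (by positivity), mul_div_cancel_left₀ _ two_ne_zero]
    gcongr
  have hs' : HasSubgaussianMGF (fun ω : Fin n → (Fin p → ℝ) × ℝ => ∑ i, (f (ω i) - m))
      (N * B ^ 2).toNNReal ν := by
    refine ⟨hs.integrable_exp_mul, fun u => (hs.mgf_le u).trans (Real.exp_le_exp.2 ?_)⟩
    gcongr
  have h3 := hs'.measure_ge_le ht
  have hN0 : 0 ≤ N := (Nat.cast_nonneg n).trans hN
  rw [Real.coe_toNNReal _ (by positivity)] at h3
  rw [← h2, ← h1] at h3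
  exact h3

lemma obsLaw_rowSum_le_le {n p : ℕ} {σ : ℝ} {f : (Fin p → ℝ) × ℝ → ℝ} (hf : Measurable f)
    {B N t : ℝ} (hB : ∀ ω, |f ω| ≤ B) (hN : n ≤ N) (ht : 0 ≤ t) :
    (obsLaw n p σ).real {ω | rowSum f ω ≤ n * ∫ ω, f ω ∂(rowLaw p σ) - t}
      ≤ Real.exp (-t ^ 2 / (2 * (N * B ^ 2))) := by
  have h := obsLaw_rowSum_ge_le (n := n) (σ := σ) hf.neg (B := B) (fun ω => by simpa using hB ω)
    hN ht
  refine le_trans (le_of_eq ?_) h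
  congr 1
  ext ω
  have e : rowSum (-f) ω = -rowSum f ω := by simp [rowSum]
  simp only [mem_ofPred_eq, e, Pi.neg_apply, integral_neg]
  constructor <;> intro h <;> linarith

/-- Chernoff's bound at exponent `1`: the exponential of the sum is a product of independent factors
of mean one. -/
lemma obsLaw_rowSum_ge_le_exp {n p : ℕ} {σ : ℝ} {f : (Fin p → ℝ) × ℝ → ℝ} (hf : Measurable f)
    {B : ℝ} (hB : ∀ ω, |f ω| ≤ B) (h : ∫ ω, Real.exp (f ω) ∂(rowLaw p σ) = 1) (t : ℝ) :
    (obsLaw n p σ).real {ω | t ≤ rowSum f ω} ≤ Real.exp (-t) := by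
  set ν := Measure.pi fun _ : Fin n => rowLaw p σ with hν
  have h1 := obsLaw_real_rowSum (n := n) (σ := σ) hf (T := Ici t) measurableSet_Ici
  have hmgf := (iIndepFun_rows (n := n) (σ := σ) hf).mgf_sum (t := 1)
    (fun i => hf.comp (measurable_pi_apply i)) Finset.univ
  have h2 : ∀ i : Fin n, mgf (fun ω : Fin n → (Fin p → ℝ) × ℝ => f (ω i)) ν 1 = 1 := by
    intro i
    have := (measurePreserving_eval (fun _ : Fin n => rowLaw p σ) i)
    rw [← this.map_eq, integral_map (measurable_pi_apply i).aemeasurable (by fun_prop : Measurable _).aestronglyMeasurable]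
      at h
    simpa [mgf] using h
  rw [Finset.prod_congr rfl fun i _ => h2 i, Finset.prod_const_one] at hmgf
  have hb : Integrable (fun ω => Real.exp (1 * (∑ i, fun ω : Fin n → (Fin p → ℝ) × ℝ => f (ω i)) ω))
      ν := by
    refine Integrable.of_bound (C := Real.exp (∑ _i : Fin n, B)) ?_ (ae_of_all _ fun ω => ?_)
    · refine (Real.measurable_exp.comp (Measurable.const_mul ?_ 1)).aestronglyMeasurable
      rw [show (∑ i, fun ω : Fin n → (Fin p → ℝ) × ℝ => f (ω i)) = fun ω => ∑ i, f (ω i) by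
        ext ω; simp]
      refine Finset.measurable_sum _ fun i _ => hf.comp (measurable_pi_apply i)
    · rw [Real.norm_of_nonneg (Real.exp_pos _).le, Finset.sum_apply, one_mul]
      exact Real.exp_le_exp.2 (Finset.sum_le_sum fun i _ => (le_abs_self _).trans (hB _))
  have h3 := measure_ge_le_exp_mul_mgf (μ := ν) t zero_le_one hb
  rw [hmgf] at h3
  simp only [Finset.sum_apply, neg_mul, one_mul, mul_one] at h3
  exact h1.trans_le h3

/-! ### Deviations of the coefficients, and conditioning on a factor -/

/-- The law of the coefficients. -/
abbrev coefLaw (p k : ℕ) (c : ℝ) : Measure (Fin p → ℝ) :=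
  Measure.pi fun _ : Fin p => gaussianReal 0 (c / k).toNNReal

/-- The standard deviation of the coefficients. -/
def sd (k : ℕ) (c : ℝ) : ℝ := Real.sqrt (c / k)

lemma sd_pos {k : ℕ} {c : ℝ} (hc : 0 < c) (hk : 0 < k) : 0 < sd k c :=
  Real.sqrt_pos.2 (by positivity)

lemma sd_sq {k : ℕ} {c : ℝ} (hc : 0 < c) : sd k c ^ 2 = c / k :=
  Real.sq_sqrt (by positivity)

lemma measurePreserving_div_sd {k : ℕ} {c : ℝ} (hc : 0 < c) (hk : 0 < k) :
    MeasurePreserving (fun x : ℝ => x / sd k c) (gaussianReal 0 (c / k).toNNReal)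
      (gaussianReal 0 1) := by
  refine ⟨by fun_prop, ?_⟩
  rw [gaussianReal_map_div_const, zero_div]
  congr 1
  ext
  have : 0 < c / k := by positivity
  simp [sd_sq hc, Real.coe_toNNReal _ this.le, this.ne']

/-- Chebyshev's inequality for the normalised coefficients. -/
lemma coefLaw_deviation {p k : ℕ} {c δ : ℝ} (hc : 0 < c) (hk : 0 < k) (hδ : 0 < δ) {f : ℝ → ℝ}
    (hf : MemLp f 2 (gaussianReal 0 1)) {A : Finset (Fin p)} (hA : A.Nonempty) :
    (coefLaw p k c).real {b | δ * A.card ≤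
        |∑ j ∈ A, f (b j / sd k c) - A.card * ∫ w, f w ∂(gaussianReal 0 1)|}
      ≤ Var[f; gaussianReal 0 1] / (A.card * δ ^ 2) := by
  have hA0 : 0 < (A.card : ℝ) := by exact_mod_cast hA.card_pos
  have hmp := measurePreserving_div_sd hc hk
  set m := ∫ w, f w ∂(gaussianReal 0 1) with hm
  set X : Fin p → ℝ → ℝ := fun j y => if j ∈ A then f (y / sd k c) else 0 with hX
  have hfs : MemLp (fun y => f (y / sd k c)) 2 (gaussianReal 0 (c / k).toNNReal) :=
    hf.comp_measurePreserving hmp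
  have hXL : ∀ j, MemLp (X j) 2 (gaussianReal 0 (c / k).toNNReal) := by
    intro j
    by_cases hj : j ∈ A
    · simpa [hX, hj] using hfs
    · simp [hX, hj]
  have hXLp : ∀ j, MemLp (fun b : Fin p → ℝ => X j (b j)) 2 (coefLaw p k c) := fun j =>
    (hXL j).comp_measurePreserving (measurePreserving_eval
      (fun _ : Fin p => gaussianReal 0 (c / k).toNNReal) j)
  have hsum : (∑ j, fun b : Fin p → ℝ => X j (b j)) = fun b => ∑ j ∈ A, f (b j / sd k c) := by
    ext b
    simp [hX, Finset.sum_ite_mem]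
  have hvar := variance_sum_pi (μ := fun _ : Fin p => gaussianReal 0 (c / k).toNNReal) hXL
  have hvarf : Var[fun y => f (y / sd k c); gaussianReal 0 (c / k).toNNReal]
      = Var[f; gaussianReal 0 1] := by
    have := variance_map (μ := gaussianReal 0 (c / k).toNNReal) (X := f)
      (Y := fun y => y / sd k c) (by rw [hmp.map_eq]; exact hf.aemeasurable) (by fun_prop)
    rw [hmp.map_eq] at this
    exact this.symm
  have hvar2 : Var[fun b => ∑ j ∈ A, f (b j / sd k c); coefLaw p k c]
      = A.card * Var[f; gaussianReal 0 1] := by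
    rw [← hsum, hvar]
    have : ∀ j, Var[X j; gaussianReal 0 (c / k).toNNReal]
        = if j ∈ A then Var[f; gaussianReal 0 1] else 0 := by
      intro j
      by_cases hj : j ∈ A
      · simpa [hX, hj] using hvarf
      · have : X j = fun _ => 0 := by ext y; simp [hX, hj]
        rw [this, if_neg hj]
        exact variance_zero _
    simp_rw [this]
    rw [Finset.sum_ite_mem, Finset.univ_inter, Finset.sum_const, nsmul_eq_mul]
  have hmean : ∫ b, ∑ j ∈ A, f (b j / sd k c) ∂(coefLaw p k c) = A.card * m := by
    have e1 : ∀ j ∈ A, ∫ b, f (b j / sd k c) ∂(coefLaw p k c) = m := by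
      intro j hj
      have h1 := (measurePreserving_eval (fun _ : Fin p => gaussianReal 0 (c / k).toNNReal) j)
      have h2 := hmp.comp h1
      rw [hm, ← h2.map_eq, integral_map h2.aemeasurable
        (by rw [h2.map_eq]; exact hf.aestronglyMeasurable)]
      rfl
    rw [integral_finsetSum]
    · rw [Finset.sum_congr rfl e1, Finset.sum_const, nsmul_eq_mul]
    · intro j hj
      have := (hXLp j).integrable (by norm_num)
      simpa [hX, hj] using this
  have hL : MemLp (fun b : Fin p → ℝ => ∑ j ∈ A, f (b j / sd k c)) 2 (coefLaw p k c) := by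
    rw [← hsum]
    exact memLp_finsetSum' _ fun j _ => hXLp j
  have h := meas_ge_le_variance_div_sq hL (c := δ * A.card) (by positivity)
  rw [hmean, hvar2] at h
  have h2 := ENNReal.toReal_le_of_le_ofReal (div_nonneg (mul_nonneg hA0.le (variance_nonneg _ _))
    (sq_nonneg _)) h
  refine h2.trans_eq ?_
  field_simp

lemma measure_prod_le {α β : Type*} [MeasurableSpace α] [MeasurableSpace β] {μ : Measure α}
    {ν : Measure β} [IsFiniteMeasure μ] [IsProbabilityMeasure ν] {E : Set (α × β)}
    {B : Set α} {ε : ℝ} (hE : MeasurableSet E) (hB : MeasurableSet B) (hε : 0 ≤ ε)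
    (hμ : μ univ ≤ 1) (h : ∀ a ∉ B, ν.real {b | (a, b) ∈ E} ≤ ε) :
    (μ.prod ν).real E ≤ μ.real B + ε := by
  have h1 : (μ.prod ν) E ≤ μ B + ENNReal.ofReal ε := by
    rw [Measure.prod_apply hE]
    calc ∫⁻ a, ν (Prod.mk a ⁻¹' E) ∂μ ≤ ∫⁻ a, (B.indicator 1 a + ENNReal.ofReal ε) ∂μ := by
          refine lintegral_mono fun a => ?_
          by_cases ha : a ∈ B
          · rw [indicator_of_mem ha]
            exact prob_le_one.trans (by simp)
          · rw [indicator_of_notMem ha, zero_add]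
            have := h a ha
            rw [measureReal_def] at this
            exact (ENNReal.le_ofReal_iff_toReal_le (measure_ne_top _ _) hε).2 this
      _ = μ B + ENNReal.ofReal ε * μ univ := by
          rw [lintegral_add_right _ measurable_const, lintegral_indicator_one hB, lintegral_const]
      _ ≤ μ B + ENNReal.ofReal ε := by
          gcongr
          exact mul_le_of_le_one_right' hμ
  refine (ENNReal.toReal_mono (by finiteness) h1).trans_eq ?_
  rw [ENNReal.toReal_add (measure_ne_top _ _) ENNReal.ofReal_ne_top, ENNReal.toReal_ofReal hε]
  rfl

/-! ### The decoder and its conditional error probability -/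

/-- The log-likelihood ratio between a candidate signal `b` on `s` and its restriction to `A`,
with the remaining part averaged out. -/
def stat {p : ℕ} (ε σ : ℝ) (s A : Finset (Fin p)) (b : Fin p → ℝ) (x : Fin p → ℝ) (y : ℝ) : ℝ :=
  ell ε (y * ip x (dir s b σ)) - ell ε (y * ip x (dir A b (Real.sqrt (σ ^ 2 + en (s \ A) b))))

lemma abs_stat_le {p : ℕ} {ε : ℝ} (h0 : 0 < ε) (h1 : ε < 1 / 2) (σ : ℝ) (s A : Finset (Fin p))
    (b x : Fin p → ℝ) (y : ℝ) : |stat ε σ s A b x y| ≤ -Real.log ε := by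
  unfold stat
  have e1 := ell_nonpos h0 h1 (y * ip x (dir s b σ))
  have e2 := ell_nonpos h0 h1 (y * ip x (dir A b (Real.sqrt (σ ^ 2 + en (s \ A) b))))
  have e3 := log_le_ell h0 h1 (y * ip x (dir s b σ))
  have e4 := log_le_ell h0 h1 (y * ip x (dir A b (Real.sqrt (σ ^ 2 + en (s \ A) b))))
  rw [abs_le]
  constructor <;> linarith

lemma stat_measurable {p : ℕ} (ε σ : ℝ) (s A : Finset (Fin p)) (b : Fin p → ℝ) :
    Measurable fun ω : (Fin p → ℝ) × ℝ => stat ε σ s A b ω.1 ω.2 := by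
  unfold stat
  fun_prop

/-- The total log-likelihood ratio. -/
def score {n p : ℕ} (ε σ : ℝ) (s A : Finset (Fin p)) (b : Fin p → ℝ)
    (o : (Fin n → Fin p → ℝ) × (Fin n → ℝ)) : ℝ :=
  ∑ i, stat ε σ s A b (o.1 i) (o.2 i)

lemma score_measurable {n p : ℕ} (ε σ : ℝ) (s A : Finset (Fin p)) (b : Fin p → ℝ) :
    Measurable (score (n := n) ε σ s A b) := by
  unfold score
  exact Finset.measurable_sum _ fun i _ => (stat_measurable ε σ s A b).comp
    (f := fun o : (Fin n → Fin p → ℝ) × (Fin n → ℝ) => (o.1 i, o.2 i)) (by fun_prop)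

/-- The matrix together with the responses to the signal `β`. -/
def observe {n p : ℕ} (β : Fin p → ℝ) (ω : (Fin n → Fin p → ℝ) × (Fin n → ℝ)) :
    (Fin n → Fin p → ℝ) × (Fin n → ℝ) :=
  (ω.1, fun i => resp β (ω.1 i, ω.2 i))

lemma score_observe {n p : ℕ} (ε σ : ℝ) (s A : Finset (Fin p)) (b β : Fin p → ℝ)
    (ω : (Fin n → Fin p → ℝ) × (Fin n → ℝ)) :
    score ε σ s A b (observe β ω) = rowSum (fun r => stat ε σ s A b r.1 (resp β r)) ω := rfl

lemma stat_resp_measurable {p : ℕ} (ε σ : ℝ) (s A : Finset (Fin p)) (b β : Fin p → ℝ) :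
    Measurable fun r : (Fin p → ℝ) × ℝ => stat ε σ s A b r.1 (resp β r) :=
  (stat_measurable ε σ s A b).comp (f := fun r : (Fin p → ℝ) × ℝ => (r.1, resp β r)) (by fun_prop)

/-- The vectors supported on `s` with entries in `G`. -/
def candidates {p : ℕ} (G : Finset ℝ) (s : Finset (Fin p)) : Finset (Fin p → ℝ) :=
  Fintype.piFinset fun j => if j ∈ s then G else {0}

lemma card_candidates {p : ℕ} (G : Finset ℝ) (s : Finset (Fin p)) :
    (candidates G s).card = G.card ^ s.card := by
  unfold candidates
  rw [Fintype.card_piFinset]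
  have : ∀ j, (if j ∈ s then G else {0}).card = if j ∈ s then G.card else 1 := by
    intro j; split_ifs <;> simp
  simp_rw [this]
  rw [Finset.prod_ite_mem]
  simp

/-- A support passes if some candidate signal on it explains the observations better than all its
restrictions that drop more than `d` indices. -/
def Passes {n p : ℕ} (ε σ : ℝ) (G : Finset ℝ) (d : ℕ) (γ : ℕ → ℝ) (s : Finset (Fin p))
    (o : (Fin n → Fin p → ℝ) × (Fin n → ℝ)) : Prop :=
  ∃ b ∈ candidates G s, ∀ A ∈ s.powerset, d < (s \ A).card → γ (s \ A).card ≤ score ε σ s A b o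

lemma passes_measurable {n p : ℕ} (ε σ : ℝ) (G : Finset ℝ) (d : ℕ) (γ : ℕ → ℝ)
    (s : Finset (Fin p)) : Measurable fun o => Passes (n := n) ε σ G d γ s o := by
  have : {o | Passes (n := n) ε σ G d γ s o} = ⋃ b ∈ candidates G s, ⋂ A ∈ s.powerset,
      {o | d < (s \ A).card → γ (s \ A).card ≤ score ε σ s A b o} := by
    ext o
    simp only [Passes, mem_iUnion, mem_iInter, mem_ofPred_eq, exists_prop]
  rw [← measurableSet_setOfPred, this]
  refine Finset.measurableSet_biUnion _ fun b _ => Finset.measurableSet_biInter _ fun A _ => ?_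
  by_cases h : d < (s \ A).card
  · simp only [h, true_imp_iff]
    exact measurableSet_le measurable_const (score_measurable _ _ _ _ _)
  · simp [h]

open Classical in
/-- A selection of a set of cardinality `k` having a property. -/
def pick {p : ℕ} (k : ℕ) (P : Finset (Fin p) → Prop) : Finset (Fin p) :=
  if h : ∃ s, s.card = k ∧ P s then h.choose else ∅

lemma pick_spec {p k : ℕ} {P : Finset (Fin p) → Prop} {S : Finset (Fin p)} (h : S.card = k)
    (hS : P S) : (pick k P).card = k ∧ P (pick k P) := by
  have h' : ∃ s, s.card = k ∧ P s := ⟨S, h, hS⟩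
  rw [pick, dif_pos h']
  exact h'.choose_spec

/-- The decoder that outputs a passing support. -/
def decoder (n p k : ℕ) (ε σ : ℝ) (G : Finset ℝ) (d : ℕ) (γ : ℕ → ℝ) : Decoder p n :=
  fun o => pick k fun s => Passes ε σ G d γ s o

/-- The selection is a function on the finite space of predicates on supports, so the arbitrary
choice it makes cannot harm measurability. -/
lemma decoder_measurable (n p k : ℕ) (ε σ : ℝ) (G : Finset ℝ) (d : ℕ) (γ : ℕ → ℝ) :
    Measurable (decoder n p k ε σ G d γ) := by
  have h : Measurable (pick (p := p) k) := measurable_of_finite _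
  exact h.comp (measurable_pi_lambda _ fun s => passes_measurable ε σ G d γ s)

lemma sum_powerset_pow_card_le {p k : ℕ} (hp : 0 < p) :
    ∑ F ∈ (Finset.univ : Finset (Fin p)).powerset, ((k : ℝ) / p) ^ F.card ≤ Real.exp k := by
  have h := Finset.sum_pow_mul_eq_add_pow ((k : ℝ) / p) 1 (Finset.univ : Finset (Fin p))
  simp only [one_pow, mul_one, Finset.card_univ, Fintype.card_fin] at h
  rw [h]
  have hp' : (0 : ℝ) < p := by exact_mod_cast hp
  calc ((k : ℝ) / p + 1) ^ p ≤ Real.exp (k / p) ^ p := by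
        gcongr
        exact Real.add_one_le_exp _
    _ = Real.exp k := by
        rw [← Real.exp_nat_mul]
        congr 1
        field_simp

/-- A set is determined by its parts inside and outside `S`: at most `2 ^ k` choices inside, and the
weighted sum over all outside parts is at most `(1 + k / p) ^ p ≤ e ^ k`. Hence, with weight `(k /
p) ^ l`, the union bound over wrong supports costs only `C ^ k`. -/
lemma sum_pow_card_sdiff_le {p k : ℕ} (hp : 0 < p) (S : Finset (Fin p)) (hS : S.card = k) :
    ∑ s ∈ Finset.powersetCard k (Finset.univ : Finset (Fin p)), ((k : ℝ) / p) ^ (s \ S).card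
      ≤ 2 ^ k * Real.exp k := by
  have hinj : Set.InjOn (fun s : Finset (Fin p) => (s ∩ S, s \ S))
      (Finset.powersetCard k (Finset.univ : Finset (Fin p))) := by
    intro s _ t _ h
    rw [Prod.mk.injEq] at h
    rw [← Finset.sdiff_union_inter s S, ← Finset.sdiff_union_inter t S, h.1, h.2]
  have h1 := Finset.sum_image (f := fun q : Finset (Fin p) × Finset (Fin p) =>
    ((k : ℝ) / p) ^ q.2.card) hinj
  rw [← h1]
  calc _ ≤ ∑ q ∈ S.powerset ×ˢ (Finset.univ : Finset (Fin p)).powerset,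
        ((k : ℝ) / p) ^ q.2.card := by
        refine Finset.sum_le_sum_of_subset_of_nonneg ?_ fun _ _ _ => by positivity
        intro q hq
        obtain ⟨s, _, rfl⟩ := Finset.mem_image.1 hq
        simp [Finset.inter_subset_right]
    _ = 2 ^ k * ∑ F ∈ (Finset.univ : Finset (Fin p)).powerset, ((k : ℝ) / p) ^ F.card := by
        rw [Finset.sum_product]
        simp [hS]
    _ ≤ _ := by
        gcongr
        exact sum_powerset_pow_card_le hp

/-- Error probability of the decoder given the support and the coefficients. -/
lemma decoder_error_bound {n p k d : ℕ} {ε σ K t : ℝ} (hσ : 0 < σ) (h0 : 0 < ε) (h1 : ε < 1 / 2)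
    (hk : 0 < k) (hp : 0 < p) (ht : 0 ≤ t) (G : Finset ℝ) {S : Finset (Fin p)} (hS : S.card = k)
    (b b' : Fin p → ℝ) (hb' : b' ∈ candidates G S)
    (hmean : ∀ A ⊆ S, d < (S \ A).card → (S \ A).card * Real.log ((p : ℝ) / k) + K + n * t
      ≤ n * ∫ r, stat ε σ S A b' r.1 (resp (dir S b 1) r) ∂(rowLaw p σ)) :
    (obsLaw n p σ).real {ω |
      d < (S \ decoder n p k ε σ G d (fun l => l * Real.log ((p : ℝ) / k) + K)
        (observe (dir S b 1) ω)).card ∨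
      d < (decoder n p k ε σ G d (fun l => l * Real.log ((p : ℝ) / k) + K)
        (observe (dir S b 1) ω) \ S).card}
      ≤ 2 ^ k * Real.exp (-(n * t) ^ 2 / (2 * (n * Real.log ε ^ 2)))
        + (2 * Real.exp 1 * G.card) ^ k * Real.exp (-K) := by
  set γ : ℕ → ℝ := fun l => l * Real.log ((p : ℝ) / k) + K with hγ
  set β := dir S b 1 with hβ
  have hk' : (0 : ℝ) < k := by exact_mod_cast hk
  have hp' : (0 : ℝ) < p := by exact_mod_cast hp
  set E1 : Finset (Fin p) → Set ((Fin n → Fin p → ℝ) × (Fin n → ℝ)) := fun A =>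
    {ω | d < (S \ A).card ∧ score ε σ S A b' (observe β ω) ≤ γ (S \ A).card} with hE1
  set E2 : Finset (Fin p) → (Fin p → ℝ) → Set ((Fin n → Fin p → ℝ) × (Fin n → ℝ)) := fun s c =>
    {ω | γ (s \ S).card ≤ score ε σ s (s ∩ S) c (observe β ω)} with hE2
  -- An error means that `S` is rejected, or that an accepted `s ≠ S` is output. In the latter case
  -- `s` has `k` elements as well, so both kinds of error have the same size, and the test of `s`
  -- against its restriction `s ∩ S` was among those passed.
  have hsub : {ω | d < (S \ decoder n p k ε σ G d γ (observe β ω)).card ∨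
      d < (decoder n p k ε σ G d γ (observe β ω) \ S).card}
      ⊆ (⋃ A ∈ S.powerset, E1 A) ∪
        ⋃ s ∈ Finset.powersetCard k (Finset.univ : Finset (Fin p)), ⋃ c ∈ candidates G s, E2 s c := by
    intro ω hω
    by_cases hpass : Passes ε σ G d γ S (observe β ω)
    · right
      have hspec := pick_spec (P := fun s => Passes ε σ G d γ s (observe β ω)) hS hpass
      change (decoder n p k ε σ G d γ (observe β ω)).card = k ∧
        Passes ε σ G d γ (decoder n p k ε σ G d γ (observe β ω)) (observe β ω) at hspec
      set s := decoder n p k ε σ G d γ (observe β ω)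
      have hcard : (S \ s).card = (s \ S).card :=
        Finset.card_sdiff_comm (hS.trans hspec.1.symm)
      have hd : d < (s \ S).card := by
        rcases hω with h | h
        · exact hcard ▸ h
        · exact h
      obtain ⟨c, hc, hpc⟩ := hspec.2
      have := hpc (s ∩ S) (Finset.mem_powerset.2 Finset.inter_subset_left)
      rw [Finset.sdiff_inter_self_left] at this
      simp only [mem_iUnion]
      exact ⟨s, Finset.mem_powersetCard.2 ⟨Finset.subset_univ _, hspec.1⟩, c, hc, this hd⟩
    · left
      unfold Passes at hpass
      push Not at hpass
      obtain ⟨A, hA, hd, hlt⟩ := hpass b' hb'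
      simp only [mem_iUnion]
      exact ⟨A, hA, hd, hlt.le⟩
  have hB1 : ∀ A ∈ S.powerset, (obsLaw n p σ).real (E1 A)
      ≤ Real.exp (-(n * t) ^ 2 / (2 * (n * Real.log ε ^ 2))) := by
    intro A hA
    by_cases hd : d < (S \ A).card
    · have h2 := obsLaw_rowSum_le_le (n := n) (σ := σ) (stat_resp_measurable ε σ S A b' β)
        (B := -Real.log ε) (N := n) (t := n * t) (fun ω => abs_stat_le h0 h1 σ S A b' _ _) le_rfl
        (by positivity)
      rw [neg_sq] at h2
      refine le_trans (measureReal_mono ?_ (measure_ne_top _ _)) h2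
      intro ω hω
      have h3 := hω.2
      rw [score_observe] at h3
      have h4 := hmean A (Finset.mem_powerset.1 hA) hd
      change rowSum _ ω ≤ _
      refine h3.trans ?_
      simp only [hγ]
      linarith
    · have : E1 A = ∅ := by
        ext ω; simp [hE1, hd]
      rw [this]
      simpa using (Real.exp_pos _).le
  have hB2 : ∀ s c, (obsLaw n p σ).real (E2 s c)
      ≤ ((k : ℝ) / p) ^ (s \ S).card * Real.exp (-K) := by
    intro s c
    have h2 := obsLaw_rowSum_ge_le_exp (n := n) (σ := σ)
      (stat_resp_measurable ε σ s (s ∩ S) c β)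
      (B := -Real.log ε) (fun ω => abs_stat_le h0 h1 σ s (s ∩ S) c _ _)
      (integral_exp_ell_ratio hσ h0 h1 b c) (γ (s \ S).card)
    refine h2.trans_eq ?_
    simp only [hγ]
    -- The threshold was chosen so that its exponential is `(p / k) ^ l * e ^ K`.
    rw [neg_add, Real.exp_add, ← mul_neg, Real.exp_nat_mul, ← Real.log_inv, inv_div,
      Real.exp_log (by positivity)]
  refine (measureReal_mono hsub (measure_ne_top _ _)).trans
    ((measureReal_union_le _ _).trans (add_le_add ?_ ?_))
  · refine (measureReal_biUnion_finset_le _ _).trans ((Finset.sum_le_sum hB1).trans_eq ?_)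
    rw [Finset.sum_const, Finset.card_powerset, hS, nsmul_eq_mul]
    push_cast
    rfl
  · calc _ ≤ ∑ s ∈ Finset.powersetCard k (Finset.univ : Finset (Fin p)),
          ∑ c ∈ candidates G s, ((k : ℝ) / p) ^ (s \ S).card * Real.exp (-K) := by
          refine (measureReal_biUnion_finset_le _ _).trans (Finset.sum_le_sum fun s _ => ?_)
          exact (measureReal_biUnion_finset_le _ _).trans (Finset.sum_le_sum fun c _ => hB2 s c)
      _ = ∑ s ∈ Finset.powersetCard k (Finset.univ : Finset (Fin p)),
          ((k : ℝ) / p) ^ (s \ S).card * ((G.card : ℝ) ^ k * Real.exp (-K)) := by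
          refine Finset.sum_congr rfl fun s hs => ?_
          rw [Finset.sum_const, card_candidates, (Finset.mem_powersetCard.1 hs).2, nsmul_eq_mul]
          push_cast
          ring
      _ ≤ (2 ^ k * Real.exp k) * ((G.card : ℝ) ^ k * Real.exp (-K)) := by
          rw [← Finset.sum_mul]
          gcongr
          exact sum_pow_card_sdiff_le hp S hS
      _ = _ := by
          have : Real.exp (k : ℝ) = Real.exp 1 ^ k := by rw [← Real.exp_nat_mul, mul_one]
          rw [this, mul_pow, mul_pow]
          ring

/-! ### Expected log-likelihood ratios with approximate coefficients or energies -/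

lemma inv_sqrt_sub_sq_le {v d d' : ℝ} (hv : 0 < v) (hd : 0 ≤ d) (hd' : 0 ≤ d') :
    (1 / Real.sqrt (v + d') - 1 / Real.sqrt (v + d)) ^ 2 ≤ (d - d') ^ 2 / (4 * v ^ 3) := by
  have e : Real.sqrt (v + d) ^ 2 = v + d := Real.sq_sqrt (by positivity)
  have e' : Real.sqrt (v + d') ^ 2 = v + d' := Real.sq_sqrt (by positivity)
  have ev : Real.sqrt v ^ 2 = v := Real.sq_sqrt hv.le
  have h : Real.sqrt v ≤ Real.sqrt (v + d) := Real.sqrt_le_sqrt (by linarith)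
  have h' : Real.sqrt v ≤ Real.sqrt (v + d') := Real.sqrt_le_sqrt (by linarith)
  have h0 : 0 < Real.sqrt v := Real.sqrt_pos.2 hv
  set x := Real.sqrt (v + d)
  set y := Real.sqrt (v + d')
  have hx : 0 < x := h0.trans_le h
  have hy : 0 < y := h0.trans_le h'
  have e2 : 1 / y - 1 / x = (d - d') / (x * y * (x + y)) := by
    have : d - d' = (x + y) * (x - y) := by linarith [e, e', sq_sub_sq x y]
    rw [this]
    field_simp
  rw [e2, div_pow]
  refine div_le_div_of_nonneg_left (sq_nonneg _) (by positivity) ?_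
  calc 4 * v ^ 3 = v * v * (4 * v) := by ring
    _ ≤ x ^ 2 * y ^ 2 * (x + y) ^ 2 := by
        have h1 : v ≤ x ^ 2 := by linarith
        have h2 : v ≤ y ^ 2 := by linarith
        have h3 : 4 * v ≤ (x + y) ^ 2 := by nlinarith
        gcongr
    _ = (x * y * (x + y)) ^ 2 := by ring

/-- The change of entries and the change of scale are separated by `(u + v) ^ 2 ≤ 2 * u ^ 2 + 2 * v
^ 2`. -/
lemma sum_dir_sub_sq_le {p : ℕ} (A : Finset (Fin p)) (b b' : Fin p → ℝ) (s s' : ℝ) :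
    ∑ j, (dir A b' s' j - dir A b s j) ^ 2
      ≤ 2 * (en A (b' - b) / s' ^ 2) + 2 * (en A b * (1 / s' - 1 / s) ^ 2) := by
  have e : ∀ j, (dir A b' s' j - dir A b s j) ^ 2
      = if j ∈ A then (b' j / s' - b j / s) ^ 2 else 0 := by
    intro j
    unfold dir
    split_ifs <;> simp
  simp_rw [e]
  rw [Finset.sum_ite_mem, Finset.univ_inter, en, en, Finset.sum_div, Finset.sum_mul,
    Finset.mul_sum, Finset.mul_sum, ← Finset.sum_add_distrib]
  refine Finset.sum_le_sum fun j _ => ?_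
  have e2 : b' j / s' - b j / s = (b' - b) j / s' + b j * (1 / s' - 1 / s) := by
    rw [Pi.sub_apply]; ring
  rw [e2, ← div_pow, ← mul_pow]
  nlinarith [sq_nonneg ((b' - b) j / s' - b j * (1 / s' - 1 / s))]

lemma en_mono {p : ℕ} {A S : Finset (Fin p)} (h : A ⊆ S) (b : Fin p → ℝ) : en A b ≤ en S b :=
  Finset.sum_le_sum_of_subset_of_nonneg h fun _ _ _ => sq_nonneg _

/-- Cauchy–Schwarz for `b' ^ 2 - b ^ 2 = (b' - b) * (b' + b)`, with `b' + b = (b' - b) + 2 * b` in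
the second factor. -/
lemma en_sub_sq_le {p : ℕ} (A : Finset (Fin p)) (b b' : Fin p → ℝ) :
    (en A b - en A b') ^ 2 ≤ en A (b' - b) * (8 * en A b + 2 * en A (b' - b)) := by
  have h := Finset.sum_mul_sq_le_sq_mul_sq A (b' - b) fun j => b' j + b j
  have e : ∑ j ∈ A, (b' - b) j * (b' j + b j) = -(en A b - en A b') := by
    unfold en
    rw [← Finset.sum_sub_distrib, ← Finset.sum_neg_distrib]
    refine Finset.sum_congr rfl fun j _ => ?_
    rw [Pi.sub_apply]; ring
  rw [e, neg_sq] at h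
  refine h.trans (mul_le_mul_of_nonneg_left ?_ (en_nonneg _ _))
  unfold en
  rw [Finset.mul_sum, Finset.mul_sum, ← Finset.sum_add_distrib]
  refine Finset.sum_le_sum fun j _ => ?_
  rw [Pi.sub_apply]
  nlinarith [sq_nonneg (b' j - 3 * b j)]

/-- Lower bound on the expected log-likelihood ratio, computed with an approximation `b'` of the
coefficients `b`. -/
lemma expected_stat_ge {p : ℕ} {σ ε v E : ℝ} (hσ : 0 < σ) (hv : 0 < v) (hvσ : v ≤ σ ^ 2)
    (h0 : 0 < ε) (h1 : ε < 1 / 2) {A S : Finset (Fin p)} (hAS : A ⊆ S) (b b' : Fin p → ℝ)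
    (hE : en S b ≤ E) (hΔ : en S (b' - b) ≤ 1) :
    J (en A b / (σ ^ 2 + en (S \ A) b)) - J (en S b / σ ^ 2) + Real.log (1 - 2 * ε)
        - 2 * (Real.sqrt ((2 / v + E * (8 * E + 2) / (2 * v ^ 3)) * en S (b' - b)) / ε)
      ≤ ∫ r, stat ε σ S A b' r.1 (resp (dir S b 1) r) ∂(rowLaw p σ) := by
  have hE0 : 0 ≤ E := (en_nonneg _ _).trans hE
  set Δ := en S (b' - b) with hΔd
  have hΔ0 : 0 ≤ Δ := en_nonneg _ _
  set C := 2 / v + E * (8 * E + 2) / (2 * v ^ 3) with hC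
  have hσ2 : 0 < σ ^ 2 := by positivity
  have d1 : ∑ j, (dir S b' σ j - dir S b σ j) ^ 2 ≤ C * Δ := by
    refine (sum_dir_sub_sq_le S b b' σ σ).trans ?_
    have : 0 ≤ E * (8 * E + 2) / (2 * v ^ 3) * Δ := by positivity
    have h2 : Δ / σ ^ 2 ≤ Δ / v := by gcongr
    rw [hC, add_mul, div_mul_eq_mul_div]
    rw [sub_self]
    have e : 2 * Δ / v = 2 * (Δ / v) := by ring
    rw [e]
    nlinarith
  set d := en (S \ A) b with hd
  set d' := en (S \ A) b' with hd'
  have hdn : 0 ≤ d := en_nonneg _ _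
  have hdn' : 0 ≤ d' := en_nonneg _ _
  have d2 : ∑ j, (dir A b' (Real.sqrt (σ ^ 2 + d')) j - dir A b (Real.sqrt (σ ^ 2 + d)) j) ^ 2
      ≤ C * Δ := by
    refine (sum_dir_sub_sq_le A b b' _ _).trans ?_
    have h2 : en A (b' - b) / Real.sqrt (σ ^ 2 + d') ^ 2 ≤ Δ / v := by
      rw [Real.sq_sqrt (by positivity)]
      exact div_le_div₀ hΔ0 (en_mono hAS _) hv (by linarith)
    have h3 := inv_sqrt_sub_sq_le hσ2 hdn hdn'
    have h4 : (d - d') ^ 2 ≤ Δ * (8 * E + 2) := by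
      refine (en_sub_sq_le (S \ A) b b').trans ?_
      have a1 := en_mono Finset.sdiff_subset (A := S \ A) (S := S) (b' - b)
      have a2 := en_mono Finset.sdiff_subset (A := S \ A) (S := S) b
      have a3 := en_nonneg (S \ A) (b' - b)
      have a4 := en_nonneg (S \ A) b
      exact mul_le_mul a1 (by linarith) (by linarith) hΔ0
    have h5 : (d - d') ^ 2 / (4 * (σ ^ 2) ^ 3) ≤ Δ * (8 * E + 2) / (4 * v ^ 3) := by
      gcongr
    have h6 : en A b * (1 / Real.sqrt (σ ^ 2 + d') - 1 / Real.sqrt (σ ^ 2 + d)) ^ 2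
        ≤ E * (Δ * (8 * E + 2) / (4 * v ^ 3)) :=
      mul_le_mul ((en_mono hAS b).trans hE) (h3.trans h5) (sq_nonneg _) hE0
    calc _ ≤ 2 * (Δ / v) + 2 * (E * (Δ * (8 * E + 2) / (4 * v ^ 3))) := by gcongr
      _ = C * Δ := by rw [hC]; field_simp; ring
  have m1 := abs_integral_ell_sub_le (σ := σ) h0 h1 (dir S b 1) (dir S b' σ) (dir S b σ)
  have m2 := abs_integral_ell_sub_le (σ := σ) h0 h1 (dir S b 1)
    (dir A b' (Real.sqrt (σ ^ 2 + d'))) (dir A b (Real.sqrt (σ ^ 2 + d)))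
  have s1 : Real.sqrt (∑ j, (dir S b' σ j - dir S b σ j) ^ 2) / ε ≤ Real.sqrt (C * Δ) / ε := by
    gcongr
  have s2 : Real.sqrt (∑ j, (dir A b' (Real.sqrt (σ ^ 2 + d')) j
      - dir A b (Real.sqrt (σ ^ 2 + d)) j) ^ 2) / ε ≤ Real.sqrt (C * Δ) / ε := by
    gcongr
  have b1 := (expected_ell_bounds_row hσ h0 h1 (Finset.Subset.refl S) b).1
  have e0 : en (S \ S) b = 0 := by simp [en]
  rw [e0, add_zero, Real.sqrt_sq hσ.le] at b1
  have b2 := (expected_ell_bounds_row hσ h0 h1 hAS b).2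
  unfold stat
  rw [integral_sub (integrable_ell_comp h0 h1 (by fun_prop))
    (integrable_ell_comp h0 h1 (by fun_prop))]
  have m1' := (abs_le.1 m1).1
  have m2' := (abs_le.1 m2).2
  linarith

/-- Upper bound on the expected log-likelihood ratio, computed with a nominal value `d₀` of the
energy of the unknown part. -/
lemma expected_ratio_le {p : ℕ} {σ ε v E d₀ : ℝ} (hσ : 0 < σ) (hv : 0 < v) (hvσ : v ≤ σ ^ 2)
    (h0 : 0 < ε) (h1 : ε < 1 / 2) {A S : Finset (Fin p)} (hAS : A ⊆ S) (b : Fin p → ℝ)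
    (hE : en S b ≤ E) (hd₀ : 0 ≤ d₀) :
    ∫ r, (ell ε (resp (dir S b 1) r * ip r.1 (dir S b σ))
        - ell ε (resp (dir S b 1) r * ip r.1 (dir A b (Real.sqrt (σ ^ 2 + d₀))))) ∂(rowLaw p σ)
      ≤ J (en A b / (σ ^ 2 + en (S \ A) b)) - J (en S b / σ ^ 2) - Real.log (1 - 2 * ε)
        + Real.sqrt (E / (2 * v ^ 3) * (en (S \ A) b - d₀) ^ 2) / ε := by
  have hE0 : 0 ≤ E := (en_nonneg _ _).trans hE
  have hσ2 : 0 < σ ^ 2 := by positivity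
  set d := en (S \ A) b with hd
  have hdn : 0 ≤ d := en_nonneg _ _
  have d2 : ∑ j, (dir A b (Real.sqrt (σ ^ 2 + d₀)) j - dir A b (Real.sqrt (σ ^ 2 + d)) j) ^ 2
      ≤ E / (2 * v ^ 3) * (d - d₀) ^ 2 := by
    refine (sum_dir_sub_sq_le A b b _ _).trans ?_
    have e : en A (b - b) = 0 := by simp [en]
    rw [e, zero_div, mul_zero, zero_add]
    have h3 := inv_sqrt_sub_sq_le hσ2 hdn hd₀
    have h5 : (d - d₀) ^ 2 / (4 * (σ ^ 2) ^ 3) ≤ (d - d₀) ^ 2 / (4 * v ^ 3) := by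
      gcongr
    have h6 : en A b * (1 / Real.sqrt (σ ^ 2 + d₀) - 1 / Real.sqrt (σ ^ 2 + d)) ^ 2
        ≤ E * ((d - d₀) ^ 2 / (4 * v ^ 3)) :=
      mul_le_mul ((en_mono hAS b).trans hE) (h3.trans h5) (sq_nonneg _) hE0
    calc _ ≤ 2 * (E * ((d - d₀) ^ 2 / (4 * v ^ 3))) := by gcongr
      _ = _ := by ring
  have m2 := abs_integral_ell_sub_le (σ := σ) h0 h1 (dir S b 1)
    (dir A b (Real.sqrt (σ ^ 2 + d₀))) (dir A b (Real.sqrt (σ ^ 2 + d)))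
  have s2 : Real.sqrt (∑ j, (dir A b (Real.sqrt (σ ^ 2 + d₀)) j
      - dir A b (Real.sqrt (σ ^ 2 + d)) j) ^ 2) / ε
      ≤ Real.sqrt (E / (2 * v ^ 3) * (d - d₀) ^ 2) / ε := by
    gcongr
  have b1 := (expected_ell_bounds_row hσ h0 h1 (Finset.Subset.refl S) b).2
  have e0 : en (S \ S) b = 0 := by simp [en]
  rw [e0, add_zero, Real.sqrt_sq hσ.le] at b1
  have b2 := (expected_ell_bounds_row hσ h0 h1 hAS b).1
  rw [integral_sub (integrable_ell_comp h0 h1 (by fun_prop))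
    (integrable_ell_comp h0 h1 (by fun_prop))]
  have m2' := (abs_le.1 m2).1
  linarith

/-! ### Typical coefficients for achievability -/

lemma exists_quantizer {κ : ℝ} (hκ : 0 < κ) :
    ∃ (φ : ℝ → ℝ) (G : Finset ℝ), Measurable φ ∧ (∀ w, φ w ∈ G) ∧
      MemLp (fun w => (w - φ w) ^ 2) 2 (gaussianReal 0 1) ∧
      ∫ w, (w - φ w) ^ 2 ∂(gaussianReal 0 1) ≤ κ := by
  have hid : MemLp (fun w : ℝ => w) 2 (gaussianReal 0 1) := memLp_id_gaussianReal' 2 (by simp)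
  -- Simple functions are dense in `L²`, and the range of one is a finite alphabet. The alphabet
  -- depends on `κ` only, so the candidates on a support number at most `C ^ k`.
  obtain ⟨φ, hφ, hφL⟩ := hid.exists_simpleFunc_eLpNorm_sub_lt (by simp)
    (ε := ENNReal.ofReal (Real.sqrt κ)) (by simpa using hκ)
  refine ⟨φ, φ.range, φ.measurable, fun w => φ.mem_range_self w, ?_, ?_⟩
  · obtain ⟨M, hM⟩ := φ.exists_forall_norm_le
    have hw2 : MemLp (fun w : ℝ => w ^ 2) 2 (gaussianReal 0 1) := by
      rw [memLp_two_iff_integrable_sq (by fun_prop)]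
      simpa only [← pow_mul] using integrable_pow_std (2 * 2)
    refine MemLp.mono' ((hw2.const_mul 2).add (memLp_const (2 * M ^ 2)))
      (by have := φ.measurable; fun_prop) (ae_of_all _ fun w => ?_)
    rw [Real.norm_of_nonneg (sq_nonneg _), Pi.add_apply]
    have h1 := hM w
    rw [Real.norm_eq_abs] at h1
    have h2 : φ w ^ 2 ≤ M ^ 2 := by
      rw [← sq_abs]
      gcongr
    nlinarith [sq_nonneg (w + φ w)]
  · have hL : MemLp (fun w => w - φ w) 2 (gaussianReal 0 1) := hid.sub hφL
    have e := hL.eLpNorm_eq_integral_rpow_norm (by simp) (by simp)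
    have hφ' : eLpNorm (fun w => w - φ w) 2 (gaussianReal 0 1) < ENNReal.ofReal (Real.sqrt κ) := hφ
    rw [e, ENNReal.ofReal_lt_ofReal_iff (Real.sqrt_pos.2 hκ)] at hφ'
    have e2 : ∫ w, ‖w - φ w‖ ^ (2 : ENNReal).toReal ∂(gaussianReal 0 1)
        = ∫ w, (w - φ w) ^ 2 ∂(gaussianReal 0 1) := by
      simp
    rw [e2] at hφ'
    have e3 : ((2 : ENNReal).toReal)⁻¹ = 1 / 2 := by simp
    rw [e3, ← Real.sqrt_eq_rpow] at hφ'
    exact ((Real.sqrt_lt_sqrt_iff (integral_nonneg fun w => sq_nonneg _)).1 hφ').le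

lemma memLp_sq_std : MemLp (fun w : ℝ => w ^ 2) 2 (gaussianReal 0 1) := by
  rw [memLp_two_iff_integrable_sq (by fun_prop)]
  simpa only [← pow_mul] using integrable_pow_std (2 * 2)

lemma memLp_hinge (q : ℝ) : MemLp (fun w : ℝ => max (q - w ^ 2) 0) 2 (gaussianReal 0 1) := by
  refine MemLp.mono' ((memLp_const |q|).add memLp_sq_std) (by fun_prop) (ae_of_all _ fun w => ?_)
  rw [Real.norm_of_nonneg (le_max_right _ _), Pi.add_apply]
  refine max_le ?_ (by positivity)
  linarith [le_abs_self q, sq_nonneg w]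

/-- Simultaneous deviation bound for finitely many functions of the coefficients. -/
lemma exists_deviation_set {ι : Type*} {p k : ℕ} {c δ : ℝ} (hc : 0 < c) (hk : 0 < k) (hδ : 0 < δ)
    (I : Finset ι) (f : ι → ℝ → ℝ) (hf : ∀ i ∈ I, Measurable (f i))
    (hL : ∀ i ∈ I, MemLp (f i) 2 (gaussianReal 0 1)) {A : Finset (Fin p)} (hA : 0 < A.card) :
    ∃ B : Set (Fin p → ℝ), MeasurableSet B ∧
      (coefLaw p k c).real B ≤ (∑ i ∈ I, Var[f i; gaussianReal 0 1]) / δ ^ 2 / A.card ∧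
      ∀ b ∉ B, ∀ i ∈ I,
        |∑ j ∈ A, f i (b j / sd k c) - A.card * ∫ w, f i w ∂(gaussianReal 0 1)| < δ * A.card := by
  refine ⟨⋃ i ∈ I, {b | δ * A.card ≤
    |∑ j ∈ A, f i (b j / sd k c) - A.card * ∫ w, f i w ∂(gaussianReal 0 1)|}, ?_, ?_, ?_⟩
  · refine Finset.measurableSet_biUnion _ fun i hi => measurableSet_le measurable_const ?_
    refine Measurable.abs (Measurable.sub_const (Finset.measurable_sum _ fun j _ => ?_) _)
    exact (hf i hi).comp (by fun_prop)
  · refine (measureReal_biUnion_finset_le _ _).trans ?_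
    rw [Finset.sum_div, Finset.sum_div]
    refine Finset.sum_le_sum fun i hi => ?_
    refine (coefLaw_deviation hc hk hδ (hL i hi) (Finset.card_pos.1 hA)).trans_eq ?_
    rw [div_div, mul_comm]
  · intro b hb i hi
    simp only [mem_iUnion, mem_ofPred_eq, not_exists, not_le] at hb
    exact hb i hi

/-- A finite grid on which `g` can be evaluated up to a small error. -/
lemma exists_g_grid {δ : ℝ} (hδ : 0 < δ) :
    ∃ m : ℕ, ∀ α, 0 ≤ α → α ≤ 1 → ∃ i < m, ((i : ℝ) / m) < 1 ∧ ((i : ℝ) / m) ≤ α ∧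
      g α ≤ g (i / m) + δ := by
  have h := isCompact_Icc.uniformContinuousOn_of_continuous
    (g_continuousOn.mono (Icc_subset_Iic_self (a := (0 : ℝ))))
  obtain ⟨κ, hκ, H⟩ := Metric.uniformContinuousOn_iff.1 h δ hδ
  obtain ⟨m, hm⟩ := exists_nat_gt (1 / κ)
  have hm0 : (0 : ℝ) < m := lt_trans (by positivity) hm
  -- Ceiling minus one rather than the floor: the grid point stays below `1` even for `α = 1`, as
  -- `exists_dual` requires. Truncated subtraction gives `0` at `α = 0`.
  refine ⟨m, fun α h0 h1 => ⟨⌈α * m⌉₊ - 1, ?_, ?_, ?_, ?_⟩⟩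
  · have : ⌈α * m⌉₊ ≤ m := Nat.ceil_le.2 (mul_le_of_le_one_left hm0.le h1)
    have : 0 < m := by exact_mod_cast hm0
    omega
  all_goals
    have hle : ⌈α * m⌉₊ ≤ m := Nat.ceil_le.2 (mul_le_of_le_one_left hm0.le h1)
    have hmn : 0 < m := by exact_mod_cast hm0
    have h2 : ((⌈α * m⌉₊ - 1 : ℕ) : ℝ) ≤ α * m := by
      rcases Nat.eq_zero_or_pos ⌈α * m⌉₊ with h | h
      · rw [h]; simp; positivity
      · rw [Nat.cast_sub h]
        have := Nat.ceil_lt_add_one (mul_nonneg h0 hm0.le)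
        push_cast; linarith
  · rw [div_lt_one hm0]
    exact_mod_cast (by omega : ⌈α * m⌉₊ - 1 < m)
  · rwa [div_le_iff₀ hm0]
  · have h3 : α * m ≤ ((⌈α * m⌉₊ - 1 : ℕ) : ℝ) + 1 := by
      have := Nat.le_ceil (α * m)
      have h4 : ((⌈α * m⌉₊ : ℕ) : ℝ) ≤ ((⌈α * m⌉₊ - 1 : ℕ) : ℝ) + 1 := by
        exact_mod_cast (by omega : ⌈α * m⌉₊ ≤ ⌈α * m⌉₊ - 1 + 1)
      linarith
    set i := ⌈α * m⌉₊ - 1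
    have h5 : (i : ℝ) / m ≤ α := by rwa [div_le_iff₀ hm0]
    have h6 : α - i / m < κ := by
      have : α ≤ i / m + 1 / m := by
        rw [← add_div, le_div_iff₀ hm0]; exact h3
      have : 1 / (m : ℝ) < κ := by
        rw [div_lt_iff₀ hm0]
        rw [div_lt_iff₀ hκ] at hm
        linarith
      linarith
    have := H α ⟨h0, h1⟩ (i / m) ⟨by positivity, h5.trans h1⟩
      (by rw [Real.dist_eq, abs_of_nonneg (by linarith)]; exact h6)
    rw [Real.dist_eq] at this
    linarith [(abs_lt.1 this).2]

lemma en_eq_sum_normalized {p k : ℕ} {c : ℝ} (hc : 0 < c) (hk : 0 < k) (A : Finset (Fin p))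
    (b : Fin p → ℝ) : en A b = c / k * ∑ j ∈ A, (b j / sd k c) ^ 2 := by
  unfold en
  have h := sd_sq (k := k) hc
  have h0 := (sd_pos hc hk).ne'
  rw [Finset.mul_sum]
  refine Finset.sum_congr rfl fun j _ => ?_
  rw [← h]
  field_simp

/-- Weak duality for the least energy of a subset. The left side depends on `A` through its
cardinality only, which avoids a union bound over subsets. -/
lemma mul_card_sub_hinge_le {ι : Type*} [DecidableEq ι] {A S : Finset ι} (hAS : A ⊆ S) (w : ι → ℝ) (q : ℝ) :
    q * A.card - ∑ j ∈ S, max (q - w j ^ 2) 0 ≤ ∑ j ∈ A, w j ^ 2 := by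
  have h1 : ∑ j ∈ A, max (q - w j ^ 2) 0 ≤ ∑ j ∈ S, max (q - w j ^ 2) 0 :=
    Finset.sum_le_sum_of_subset_of_nonneg hAS fun _ _ _ => le_max_right _ _
  have h2 : ∑ j ∈ A, (q - w j ^ 2) ≤ ∑ j ∈ A, max (q - w j ^ 2) 0 :=
    Finset.sum_le_sum fun _ _ => le_max_left _ _
  rw [Finset.sum_sub_distrib, Finset.sum_const, nsmul_eq_mul] at h2
  linarith

/-- With high probability the coefficients have the expected energy, are well approximated by
their quantization, and every large set of coefficients carries at least the energy predicted
by `g`. -/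
lemma exists_typical_coefficients {c κ : ℝ} (hc : 0 < c) (hκ : 0 < κ) :
    ∃ (φ : ℝ → ℝ) (G : Finset ℝ) (V : ℝ), (∀ w, φ w ∈ G) ∧ ∀ (p k : ℕ) (S : Finset (Fin p)),
      0 < k → S.card = k → ∃ B : Set (Fin p → ℝ), MeasurableSet B ∧
        (coefLaw p k c).real B ≤ V / k ∧ ∀ b ∉ B, |en S b - c| ≤ κ ∧
          ∑ j ∈ S, (sd k c * φ (b j / sd k c) - b j) ^ 2 ≤ κ ∧
          ∀ A ⊆ S, c * g (A.card / k) - κ ≤ en A b := by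
  obtain ⟨φ, G, hφm, hφG, hφL, hφκ⟩ := exists_quantizer (κ := κ / (2 * c)) (by positivity)
  obtain ⟨m, hm⟩ := exists_g_grid (δ := κ / (2 * c)) (by positivity)
  have hdual : ∀ i : ℕ, ∃ q, 0 ≤ q ∧ ((i : ℝ) / m < 1 →
      q * (i / m) - ∫ w, max (q - w ^ 2) 0 ∂(gaussianReal 0 1) = g (i / m)) := by
    intro i
    by_cases h : (i : ℝ) / m < 1
    · obtain ⟨q, hq, h'⟩ := exists_dual (by positivity) h
      exact ⟨q, hq, fun _ => h'⟩
    · exact ⟨0, le_rfl, fun h' => absurd h' h⟩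
  choose q hq0 hq using hdual
  -- Finitely many statistics suffice: the energy, the quantization error, and one hinge function
  -- for each grid value of the fraction.
  set f : Option (Option ℕ) → ℝ → ℝ := fun o => match o with
    | none => fun w => w ^ 2
    | some none => fun w => (w - φ w) ^ 2
    | some (some i) => fun w => max (q i - w ^ 2) 0 with hf
  set I : Finset (Option (Option ℕ)) :=
    Finset.insertNone (Finset.insertNone (Finset.range m)) with hI
  have hfm : ∀ o ∈ I, Measurable (f o) := by
    rintro (_ | _ | i) _ <;> simp only [hf] <;> fun_prop
  have hfL : ∀ o ∈ I, MemLp (f o) 2 (gaussianReal 0 1) := by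
    rintro (_ | _ | i) _
    · exact memLp_sq_std
    · exact hφL
    · exact memLp_hinge _
  refine ⟨φ, G, (∑ o ∈ I, Var[f o; gaussianReal 0 1]) / (κ / (2 * c)) ^ 2, hφG, ?_⟩
  intro p k S hk hS
  obtain ⟨B, hBm, hB, hdev⟩ := exists_deviation_set (p := p) (k := k) (δ := κ / (2 * c)) hc hk
    (by positivity) I f hfm hfL (A := S) (by omega)
  rw [hS] at hB
  refine ⟨B, hBm, hB, fun b hb => ?_⟩
  have hk' : (0 : ℝ) < k := by exact_mod_cast hk
  have hs := sd_pos hc hk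
  have hscale : ∀ x y : ℝ, x ≤ y * k → c / k * x ≤ c * y := by
    intro x y h
    calc c / k * x ≤ c / k * (y * k) := by gcongr
      _ = c * y := by field_simp
  have hc2 : c * (κ / (2 * c)) = κ / 2 := by field_simp
  refine ⟨?_, ?_, fun A hA => ?_⟩
  · have h := hdev b hb none (by simp [hI])
    simp only [hf, hS, integral_sq_std, mul_one] at h
    rw [en_eq_sum_normalized hc hk]
    have e : c / k * ∑ j ∈ S, (b j / sd k c) ^ 2 - c
        = c / k * (∑ j ∈ S, (b j / sd k c) ^ 2 - k) := by field_simp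
    rw [e, abs_mul, abs_of_pos (by positivity : 0 < c / (k : ℝ))]
    exact (hscale _ _ h.le).trans (by rw [hc2]; linarith)
  · have h := hdev b hb (some none) (by simp [hI])
    simp only [hf, hS] at h
    have h2 := (abs_lt.1 h).2
    have e : ∑ j ∈ S, (sd k c * φ (b j / sd k c) - b j) ^ 2
        = c / k * ∑ j ∈ S, (b j / sd k c - φ (b j / sd k c)) ^ 2 := by
      rw [Finset.mul_sum, ← sd_sq hc]
      refine Finset.sum_congr rfl fun j _ => ?_
      field_simp
      ring
    rw [e]
    refine (hscale _ (κ / (2 * c) + κ / (2 * c)) ?_).trans_eq (by rw [mul_add, hc2]; ring)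
    have h3 := mul_le_mul_of_nonneg_left hφκ hk'.le
    linarith
  · have hα1 : (A.card : ℝ) / k ≤ 1 := by
      rw [div_le_one hk']
      exact_mod_cast hS ▸ Finset.card_le_card hA
    obtain ⟨i, him, hi1, hiα, hgi⟩ := hm ((A.card : ℝ) / k) (by positivity) hα1
    have h := hdev b hb (some (some i)) (by simp [hI, him])
    simp only [hf, hS] at h
    have h2 := (abs_lt.1 h).2
    have h3 := mul_card_sub_hinge_le hA (fun j => b j / sd k c) (q i)
    have h4 := hq i hi1
    have h5 : q i * (i / m) ≤ q i * (A.card / k) := mul_le_mul_of_nonneg_left hiα (hq0 i)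
    rw [en_eq_sum_normalized hc hk]
    have h6 : k * (g (i / m) - κ / (2 * c)) ≤ ∑ j ∈ A, (b j / sd k c) ^ 2 := by
      refine le_trans ?_ h3
      have h7 : k * (q i * (i / m)) ≤ q i * A.card := by
        calc k * (q i * (i / m)) ≤ k * (q i * (A.card / k)) := by gcongr
          _ = q i * A.card := by field_simp
      rw [← h4]
      linarith
    calc c * g (A.card / k) - κ ≤ c * (g (i / m) + κ / (2 * c)) - κ := by gcongr
      _ = c / k * (k * (g (i / m) - κ / (2 * c))) := by field_simp; ring
      _ ≤ _ := by gcongr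

/-! ### Achievability: conditioning on the support and choice of the parameters -/

lemma beta_eq_dir {p n : ℕ} (ω : Sample p n) : beta ω = dir (supp ω) ω.2.1 1 := by
  ext j
  simp [beta, dir]

lemma observe_eq {p n : ℕ} (ω : Sample p n) :
    (mat ω, obs ω) = observe (dir (supp ω) ω.2.1 1) ω.2.2 := by
  rw [← beta_eq_dir]
  rfl

lemma obs_measurable {p n : ℕ} : Measurable (obs : Sample p n → Fin n → ℝ) := by
  refine measurable_pi_lambda _ fun i => sgn_measurable.comp (Measurable.add ?_ ?_)
  · refine Finset.measurable_sum _ fun j _ => Measurable.mul ?_ ?_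
    · unfold mat; fun_prop
    · refine Measurable.ite ?_ (by fun_prop) measurable_const
      exact (measurableSet_mem_finset j).preimage measurable_fst
  · unfold noise; fun_prop

lemma measurableSet_of_decoder {p n : ℕ} {D : Decoder p n} (hD : Measurable D)
    (R : Finset (Fin p) → Finset (Fin p) → Prop) :
    MeasurableSet {ω : Sample p n | R (supp ω) (D (mat ω, obs ω))} := by
  have h : Measurable fun ω : Sample p n => (supp ω, D (mat ω, obs ω)) := by
    refine Measurable.prodMk measurable_fst (hD.comp (Measurable.prodMk ?_ obs_measurable))
    unfold mat; fun_prop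
  exact h (Set.toFinite {q : Finset (Fin p) × Finset (Fin p) | R q.1 q.2}).measurableSet

lemma setOf_card_eq {p k : ℕ} : {S : Finset (Fin p) | S.card = k}
    = ↑(Finset.powersetCard k (Finset.univ : Finset (Fin p))) := by
  ext S; simp

lemma isProbabilityMeasure_uniform {p k : ℕ} (hkp : k ≤ p) :
    IsProbabilityMeasure (uniformOn {S : Finset (Fin p) | S.card = k}) := by
  refine isProbabilityMeasure_uniformOn (Set.toFinite _) ?_
  rw [setOf_card_eq]
  simp only [Finset.coe_nonempty]
  exact Finset.powersetCard_nonempty.2 (by simpa using hkp)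

lemma errProb_le {p n k d : ℕ} {c σ ε : ℝ} (hkp : k ≤ p) (hε : 0 ≤ ε) {D : Decoder p n}
    (hD : Measurable D) (h : ∀ S : Finset (Fin p), S.card = k →
      ((coefLaw p k c).prod (obsLaw n p σ)).real {q |
        d < (S \ D (observe (dir S q.1 1) q.2)).card ∨
        d < (D (observe (dir S q.1 1) q.2) \ S).card} ≤ ε) :
    errProb p n k c σ d D ≤ ε := by
  have hu := isProbabilityMeasure_uniform hkp
  have hB : (uniformOn {S : Finset (Fin p) | S.card = k}).real {S | S.card ≠ k} = 0 := by
    rw [measureReal_def, (uniformOn_eq_zero_iff (Set.toFinite _)).2, ENNReal.toReal_zero]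
    ext S
    simp
  have := measure_prod_le (μ := uniformOn {S : Finset (Fin p) | S.card = k})
    (ν := (coefLaw p k c).prod (obsLaw n p σ))
    (measurableSet_of_decoder (n := n) hD fun S T => d < (S \ T).card ∨ d < (T \ S).card)
    (B := {S | S.card ≠ k}) (Set.toFinite _).measurableSet hε prob_le_one (fun S hS => by
      have hS' : S.card = k := by simpa using hS
      refine le_trans (le_of_eq ?_) (h S hS')
      congr 1
      ext q
      simp only [mem_ofPred_eq, observe_eq]
      rfl)
  rw [hB, zero_add] at this
  exact this

lemma exists_smoothing {δ : ℝ} (hδ : 0 < δ) :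
    ∃ ε, 0 < ε ∧ ε < 1 / 2 ∧ -δ ≤ Real.log (1 - 2 * ε) ∧ Real.log (1 - 2 * ε) ≤ 0 := by
  have h1 : Real.exp (-δ) < 1 := Real.exp_lt_one_iff.2 (by linarith)
  have h2 := Real.exp_pos (-δ)
  refine ⟨(1 - Real.exp (-δ)) / 2, by linarith, by linarith, ?_⟩
  have e : 1 - 2 * ((1 - Real.exp (-δ)) / 2) = Real.exp (-δ) := by ring
  rw [e, Real.log_exp]
  exact ⟨le_rfl, by linarith⟩

lemma log_two_le_one : Real.log 2 ≤ 1 := by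
  have := Real.log_two_lt_d9
  linarith

/-- Here `r` is the leading part of the threshold, `m` its surcharge for the union bound, and `n *
δ` the margin for Hoeffding's inequality. Of the slack `η`, one half absorbs the two losses `n * δ`
and the other half absorbs `m`. -/
lemma rate_le {n r η Ψ ψ δ m : ℝ} (hη : 0 < η) (hn : 0 ≤ n) (ho : r * (1 + η) ≤ n * Ψ)
    (hΨ : ψ ≤ Ψ) (hδ : 2 * δ * (1 + η) = η / 2 * ψ) (hm : m ≤ η / 2 * r) :
    r + m + n * δ ≤ n * (Ψ - δ) := by
  have h3 : n * (2 * δ) * (1 + η) ≤ η / 2 * (n * Ψ) := by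
    calc n * (2 * δ) * (1 + η) = η / 2 * (n * ψ) := by rw [mul_assoc, hδ]; ring
      _ ≤ η / 2 * (n * Ψ) := by gcongr
  have h4 : (1 + η / 2) * (r * (1 + η)) ≤ (1 + η / 2) * (n * Ψ) := by gcongr
  have h5 : (r + m) * (1 + η) ≤ (n * (Ψ - 2 * δ)) * (1 + η) := by
    have : m * (1 + η) ≤ η / 2 * r * (1 + η) := by gcongr
    linarith
  have h6 := le_of_mul_le_mul_right h5 (by positivity)
  linarith

/-- A decoder with small error probability, above the threshold. -/
lemma exists_decoder {c αs η s₁ s₂ : ℝ} (hc : 0 < c) (hαs : αs ∈ Ioo (0 : ℝ) 1) (hη : 0 < η)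
    (hs₁ : 0 < s₁) :
    ∃ L₀ V : ℝ, ∀ (p n k : ℕ) (σ : ℝ), 0 < k → k ≤ p → 0 < σ → s₁ ≤ σ ^ 2 → σ ^ 2 ≤ s₂ →
      L₀ ≤ Real.log ((p : ℝ) / k) → achThreshold αs c σ k p * (1 + η) ≤ n →
      ∃ D : Decoder p n, Measurable D ∧
        errProb p n k c σ ⌊αs * k⌋₊ D ≤ V / k + 2 * Real.exp (-k) := by
  obtain ⟨ψ, hψ, hψle⟩ := exists_Psi_lower_bound (s₂ := s₂) hc hαs.1 hαs.2.le hs₁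
  -- The value required by `rate_le`. The loss `δ` in the mean is shared in thirds by the energies,
  -- the smoothing and the quantization.
  set δ := η * ψ / (4 * (1 + η)) with hδ
  have hδ0 : 0 < δ := by positivity
  obtain ⟨κ₁, hκ₁, hinfo⟩ := exists_information_modulus hc hs₁ (δ := δ / 3) (by positivity)
  obtain ⟨ε, hε0, hε1, hεl, -⟩ := exists_smoothing (δ := δ / 3) (by positivity)
  set C := 2 / s₁ + (c + 1) * (8 * (c + 1) + 2) / (2 * s₁ ^ 3) with hC
  have hC0 : 0 < C := by positivity
  -- `C` is the constant of `expected_stat_ge` for energies up to `c + 1`; the last term makes the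
  -- quantization loss `2 * √(C * κ) / ε` at most `δ / 3`.
  set κ := min (min κ₁ 1) ((ε * δ / 6) ^ 2 / C) with hκ
  have hκ0 : 0 < κ := by positivity
  have hκ1 : κ ≤ κ₁ := (min_le_left _ _).trans (min_le_left _ _)
  have hκ2 : κ ≤ 1 := (min_le_left _ _).trans (min_le_right _ _)
  have hκ3 : C * κ ≤ (ε * δ / 6) ^ 2 := by
    calc C * κ ≤ C * ((ε * δ / 6) ^ 2 / C) := by gcongr; exact min_le_right _ _
      _ = _ := by field_simp
  obtain ⟨φ, G, V, hφG, htyp⟩ := exists_typical_coefficients hc hκ0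
  have hG : 0 < (G.card : ℝ) := by exact_mod_cast Finset.card_pos.2 ⟨_, hφG 0⟩
  set M := Real.log (2 * Real.exp 1 * G.card) + 1 with hM
  -- The first bound makes the surcharge `k * M` small against `η * αs * k * L`. The second, with `n
  -- ≥ k * L`, makes the Hoeffding exponent at least `2 * k`, enough for the `2 ^ k` subsets.
  refine ⟨max (max 0 (2 * M / (η * αs))) (4 * Real.log ε ^ 2 / δ ^ 2), V, ?_⟩
  intro p n k σ hk hkp hσ hσ1 hσ2 hL hn
  have hk' : (0 : ℝ) < k := by exact_mod_cast hk
  have hp : 0 < p := hk.trans_le hkp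
  set L := Real.log ((p : ℝ) / k) with hLd
  have hL0 : 0 ≤ L := (le_max_left _ _).trans ((le_max_left _ _).trans hL)
  have hLM : M ≤ η / 2 * αs * L := by
    have := ((le_max_right _ _).trans (le_max_left _ _)).trans hL
    have hα : 0 < αs := hαs.1
    rw [div_le_iff₀ (by positivity)] at this
    linarith
  have hLε : 4 * Real.log ε ^ 2 ≤ L * δ ^ 2 := by
    have := (le_max_right _ _).trans hL
    rwa [div_le_iff₀ (by positivity)] at this
  have hlogε : 0 < Real.log ε ^ 2 := by
    have : Real.log ε ≠ 0 := (Real.log_neg hε0 (by linarith)).ne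
    positivity
  have hobj : ∀ α ∈ Icc αs 1, α * k * L * (1 + η) ≤ n * Psi α c σ := by
    intro α hα
    have h1 := (isGreatest_achThreshold hc hσ hαs k p).2 (mem_image_of_mem _ hα)
    have h2 : achObjective c σ k p α * (1 + η) ≤ n := le_trans (by gcongr) hn
    have h3 := Psi_pos hc hσ (hαs.1.trans_le hα.1) hα.2
    unfold achObjective at h2
    rw [div_mul_eq_mul_div, div_le_iff₀ h3] at h2
    exact h2
  -- The requirement at `α = 1`, together with `Psi ≤ log 2 ≤ 1`.
  have hnk : k * L ≤ n := by
    have h1 := hobj 1 ⟨hαs.2.le, le_rfl⟩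
    have h2 : (n : ℝ) * Psi 1 c σ ≤ n * 1 := by
      gcongr
      exact Psi_le.trans log_two_le_one
    have h3 : 0 ≤ k * L * η := by positivity
    linarith
  set G' := G.image fun y => sd k c * y with hG'
  have hG'card : (G'.card : ℝ) ≤ G.card := by exact_mod_cast Finset.card_image_le
  set d := ⌊αs * k⌋₊ with hd
  have hV0 : 0 ≤ V / k := by
    obtain ⟨S, -, hS⟩ := Finset.exists_subset_card_eq
      (show k ≤ (Finset.univ : Finset (Fin p)).card by simpa using hkp)
    obtain ⟨B, -, hB, -⟩ := htyp p k S hk hS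
    exact measureReal_nonneg.trans hB
  refine ⟨decoder n p k ε σ G' d (fun l => l * L + k * M), decoder_measurable _ _ _ _ _ _ _ _,
    errProb_le hkp (by positivity) (decoder_measurable _ _ _ _ _ _ _ _) fun S hS => ?_⟩
  obtain ⟨B, hBm, hB, hgood⟩ := htyp p k S hk hS
  have hmeas : MeasurableSet {q : (Fin p → ℝ) × ((Fin n → Fin p → ℝ) × (Fin n → ℝ)) |
      d < (S \ decoder n p k ε σ G' d (fun l => l * L + k * M) (observe (dir S q.1 1) q.2)).card ∨
      d < (decoder n p k ε σ G' d (fun l => l * L + k * M)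
        (observe (dir S q.1 1) q.2) \ S).card} := by
    have h := measurableSet_of_decoder (decoder_measurable n p k ε σ G' d
      (fun l => l * L + k * M)) fun S T => d < (S \ T).card ∨ d < (T \ S).card
    have h2 := h.preimage (measurable_prodMk_left (x := S))
    simp only [observe_eq] at h2
    exact h2
  refine (measure_prod_le (ε := 2 * Real.exp (-k)) hmeas hBm (by positivity) prob_le_one
    fun b hb => ?_).trans (add_le_add hB le_rfl)
  obtain ⟨ht1, ht2, ht3⟩ := hgood b hb
  set b' : Fin p → ℝ := fun j => if j ∈ S then sd k c * φ (b j / sd k c) else 0 with hb'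
  have hb'G : b' ∈ candidates G' S := by
    unfold candidates
    rw [Fintype.mem_piFinset]
    intro j
    by_cases hj : j ∈ S
    · simp only [hb', hj, if_true, hG']
      exact Finset.mem_image_of_mem _ (hφG _)
    · simp [hb', hj]
  have hΔ : en S (b' - b) ≤ κ := by
    refine le_trans (le_of_eq ?_) ht2
    unfold en
    refine Finset.sum_congr rfl fun j hj => ?_
    simp [hb', hj]
  have hE : en S b ≤ c + 1 := by linarith [(abs_le.1 ht1).2]
  have hbound := decoder_error_bound (n := n) (d := d) (K := k * M) (t := δ) hσ hε0 hε1 hk hp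
    hδ0.le G' hS b b' hb'G (fun A hA hdA => ?_)
  · refine hbound.trans ?_
    have h1 : (2 : ℝ) ^ k * Real.exp (-(n * δ) ^ 2 / (2 * (n * Real.log ε ^ 2)))
        ≤ Real.exp (-k) := by
      have e2 : (2 : ℝ) ^ k ≤ Real.exp k := by
        have : Real.exp (k : ℝ) = Real.exp 1 ^ k := by rw [← Real.exp_nat_mul, mul_one]
        rw [this]
        gcongr
        linarith [Real.add_one_le_exp 1]
      have e3 : -(n * δ) ^ 2 / (2 * (n * Real.log ε ^ 2)) ≤ -(2 * k) := by
        have hn0 : (0 : ℝ) < n := by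
          refine lt_of_lt_of_le ?_ hnk
          have : 0 < L := by
            by_contra hneg
            have : L = 0 := le_antisymm (not_lt.1 hneg) hL0
            rw [this] at hLε
            linarith
          positivity
        rw [div_le_iff₀ (by positivity)]
        have h5 : n * (k * (4 * Real.log ε ^ 2)) ≤ n * (k * (L * δ ^ 2)) := by gcongr
        have h6 : n * δ ^ 2 * (k * L) ≤ n * δ ^ 2 * n := by gcongr
        nlinarith
      calc (2 : ℝ) ^ k * Real.exp (-(n * δ) ^ 2 / (2 * (n * Real.log ε ^ 2)))
          ≤ Real.exp k * Real.exp (-(2 * k)) := by gcongr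
        _ = Real.exp (-k) := by rw [← Real.exp_add]; congr 1; ring
    have h2 : (2 * Real.exp 1 * G'.card) ^ k * Real.exp (-(k * M)) ≤ Real.exp (-k) := by
      calc (2 * Real.exp 1 * G'.card) ^ k * Real.exp (-(k * M))
          ≤ (2 * Real.exp 1 * G.card) ^ k * Real.exp (-(k * M)) := by gcongr
        _ = Real.exp (k * (M - 1)) * Real.exp (-(k * M)) := by
            rw [hM, add_sub_cancel_right, Real.exp_nat_mul, Real.exp_log (by positivity)]
        _ = Real.exp (-k) := by rw [← Real.exp_add]; congr 1; ring
    linarith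
  -- Exceeding the floor `d` means exceeding `αs * k`, so the dropped fraction lies in `[αs, 1]`,
  -- where the assumption on `n` applies.
  · have hl : αs * k ≤ (S \ A).card := by
      have := Nat.lt_of_floor_lt hdA
      linarith
    have hlk : ((S \ A).card : ℝ) ≤ k := by
      exact_mod_cast hS ▸ Finset.card_le_card Finset.sdiff_subset
    set l := (S \ A).card with hl_def
    have hα : (l : ℝ) / k ∈ Icc αs 1 := ⟨by rwa [le_div_iff₀ hk'], by rwa [div_le_one hk']⟩
    have hi := (hinfo σ (l / k) (en S b) (en (S \ A) b) hσ1 hα.2 (en_nonneg _ _)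
      (en_mono Finset.sdiff_subset b) (ht1.trans hκ1)).1
      (by have := ht3 (S \ A) Finset.sdiff_subset; linarith)
    have hea : en S b - en (S \ A) b = en A b := by
      rw [← en_add_en_sdiff hA b]; ring
    rw [hea] at hi
    have hm := expected_stat_ge hσ hs₁ hσ1 hε0 hε1 hA b b' hE (hΔ.trans hκ2)
    have herr : 2 * (Real.sqrt (C * en S (b' - b)) / ε) ≤ δ / 3 := by
      have : Real.sqrt (C * en S (b' - b)) ≤ ε * δ / 6 := by
        refine Real.sqrt_le_iff.2 ⟨by positivity, le_trans ?_ hκ3⟩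
        gcongr
      calc 2 * (Real.sqrt (C * en S (b' - b)) / ε) ≤ 2 * ((ε * δ / 6) / ε) := by gcongr
        _ = δ / 3 := by field_simp; norm_num
    have hmean : Psi (l / k) c σ - δ
        ≤ ∫ r, stat ε σ S A b' r.1 (resp (dir S b 1) r) ∂(rowLaw p σ) := by linarith
    refine le_trans ?_ (mul_le_mul_of_nonneg_left hmean (Nat.cast_nonneg n))
    have ho := hobj _ hα
    have e1 : (l : ℝ) / k * k = l := by field_simp
    rw [e1] at ho
    have hΨ : ψ ≤ Psi (l / k) c σ := (hψle σ hσ hσ1 hσ2).trans (Psi_mono hc hσ hα.1 hα.2)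
    have h2δ : 2 * δ * (1 + η) = η / 2 * ψ := by
      rw [hδ]; field_simp; norm_num
    have hkM : k * M ≤ η / 2 * (l * L) := by
      calc k * M ≤ k * (η / 2 * αs * L) := by gcongr
        _ = η / 2 * (αs * k * L) := by ring
        _ ≤ η / 2 * (l * L) := by gcongr
    exact rate_le hη (Nat.cast_nonneg n) ho hΨ h2δ hkM

/-! ### Converse: counting supports -/

lemma card_small_le {p k d : ℕ} (hk : 0 < k) (hkp : k ≤ p) :
    (((Finset.univ : Finset (Fin p)).powerset.filter fun F => F.card ≤ d).card : ℝ)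
      ≤ Real.exp (d * Real.log ((p : ℝ) / k)) * Real.exp k := by
  have hk' : (0 : ℝ) < k := by exact_mod_cast hk
  have hp : 0 < p := hk.trans_le hkp
  have hp' : (0 : ℝ) < p := by exact_mod_cast hp
  have e : Real.exp (d * Real.log ((p : ℝ) / k)) = ((p : ℝ) / k) ^ d := by
    rw [Real.exp_nat_mul, Real.exp_log (by positivity)]
  rw [e]
  -- As `k / p ≤ 1`, each set counted has weight `(k / p) ^ F.card ≥ (k / p) ^ d`, and all the
  -- weights sum to at most `e ^ k`.
  have h1 : ∑ F ∈ (Finset.univ : Finset (Fin p)).powerset.filter (fun F => F.card ≤ d),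
      ((k : ℝ) / p) ^ d ≤ Real.exp k := by
    refine le_trans ?_ (sum_powerset_pow_card_le hp)
    refine le_trans (Finset.sum_le_sum fun F hF => ?_)
      (Finset.sum_le_sum_of_subset_of_nonneg (Finset.filter_subset _ _) fun _ _ _ => by positivity)
    refine pow_le_pow_of_le_one (by positivity) ?_ (Finset.mem_filter.1 hF).2
    rw [div_le_one hp']
    exact_mod_cast hkp
  rw [Finset.sum_const, nsmul_eq_mul] at h1
  calc (((Finset.univ : Finset (Fin p)).powerset.filter fun F => F.card ≤ d).card : ℝ)
      = ((p : ℝ) / k) ^ d * ((((Finset.univ : Finset (Fin p)).powerset.filter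
          fun F => F.card ≤ d).card : ℝ) * ((k : ℝ) / p) ^ d) := by
        rw [mul_left_comm, ← mul_pow, div_mul_div_comm, mul_comm (p : ℝ) k, div_self (by positivity),
          one_pow, mul_one]
    _ ≤ _ := by gcongr

/-- The number of supports close to a given set. -/
lemma card_close_le {p k d : ℕ} (hk : 0 < k) (hkp : k ≤ p) (hd : d ≤ k) (U : Finset (Fin p)) :
    (((Finset.powersetCard k (Finset.univ : Finset (Fin p))).filter
        fun S => (S \ U).card ≤ d ∧ (U \ S).card ≤ d).card : ℝ)
      ≤ (4 * Real.exp 1) ^ k * Real.exp (d * Real.log ((p : ℝ) / k)) := by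
  set F := (Finset.powersetCard k (Finset.univ : Finset (Fin p))).filter
    fun S => (S \ U).card ≤ d ∧ (U \ S).card ≤ d with hF
  -- If any support is close to `U`, then `U` has at most `k + d ≤ 2 * k` elements, hence at most `4
  -- ^ k` possible intersections with a support.
  rcases F.eq_empty_or_nonempty with h | ⟨S₀, hS₀⟩
  · rw [h]
    simp only [Finset.card_empty, Nat.cast_zero]
    positivity
  have hU : U.card ≤ 2 * k := by
    rw [hF, Finset.mem_filter, Finset.mem_powersetCard] at hS₀
    have h1 := Finset.card_sdiff_add_card_inter U S₀
    have h2 : (U ∩ S₀).card ≤ S₀.card := Finset.card_le_card Finset.inter_subset_right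
    omega
  have hcard : F.card ≤ (U.powerset ×ˢ
      ((Finset.univ : Finset (Fin p)).powerset.filter fun F => F.card ≤ d)).card := by
    refine Finset.card_le_card_of_injOn (fun S => (S ∩ U, S \ U)) ?_ ?_
    · intro S hS
      have hS' := Finset.mem_coe.1 hS
      rw [hF, Finset.mem_filter] at hS'
      simp only [Finset.coe_product, mem_prod, Finset.mem_coe, Finset.mem_powerset,
        Finset.mem_filter, Finset.subset_univ, true_and]
      exact ⟨Finset.inter_subset_right, hS'.2.1⟩
    · intro S _ S' _ h
      rw [Prod.mk.injEq] at h
      rw [← Finset.sdiff_union_inter S U, ← Finset.sdiff_union_inter S' U, h.1, h.2]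
  have h1 : (F.card : ℝ) ≤ 2 ^ U.card * (((Finset.univ : Finset (Fin p)).powerset.filter
      fun F => F.card ≤ d).card : ℝ) := by
    rw [Finset.card_product, Finset.card_powerset] at hcard
    exact_mod_cast hcard
  refine h1.trans ?_
  have h2 : (2 : ℝ) ^ U.card ≤ 4 ^ k := by
    calc (2 : ℝ) ^ U.card ≤ 2 ^ (2 * k) := pow_le_pow_right₀ (by norm_num) hU
      _ = 4 ^ k := by rw [pow_mul]; norm_num
  calc _ ≤ 4 ^ k * (Real.exp (d * Real.log ((p : ℝ) / k)) * Real.exp k) := by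
        gcongr
        exact card_small_le hk hkp
    _ = _ := by
        have : Real.exp (k : ℝ) = Real.exp 1 ^ k := by rw [← Real.exp_nat_mul, mul_one]
        rw [this, mul_pow]
        ring

/-- From `(N + 1 - m) ^ m / m!` with `N + 1 - m ≥ θ * p / 2` and `m! ≤ k ^ m`: hiding `m` indices in
a fixed proportion of all indices leaves about `m * log (p / k)` nats of uncertainty. -/
lemma choose_ge {p k N m : ℕ} {θ : ℝ} (hθ : 0 < θ) (hθ1 : θ ≤ 1) (hk : 0 < k)
    (hkp : k ≤ θ / 2 * p) (hm : m ≤ k) (hN : θ * p ≤ N) :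
    (θ / 2) ^ k * Real.exp (m * Real.log ((p : ℝ) / k)) ≤ N.choose m := by
  have hk' : (0 : ℝ) < k := by exact_mod_cast hk
  have hp' : (0 : ℝ) < p := by
    by_contra h
    have : (p : ℝ) = 0 := le_antisymm (not_lt.1 h) (Nat.cast_nonneg _)
    rw [this, mul_zero] at hkp
    linarith
  have hmN : m ≤ N := by
    have : (m : ℝ) ≤ N := by
      have : (m : ℝ) ≤ k := by exact_mod_cast hm
      nlinarith
    exact_mod_cast this
  have h := Nat.pow_le_choose m N (α := ℝ)
  refine le_trans ?_ h
  rw [Real.exp_nat_mul, Real.exp_log (by positivity)]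
  have h1 : (θ / 2) ^ k ≤ (θ / 2) ^ m := pow_le_pow_of_le_one (by positivity) (by linarith) hm
  have h2 : θ / 2 * p ≤ ((N + 1 - m : ℕ) : ℝ) := by
    rw [Nat.cast_sub (by omega)]
    push_cast
    have : (m : ℝ) ≤ k := by exact_mod_cast hm
    linarith
  have h3 : (m.factorial : ℝ) ≤ (k : ℝ) ^ m := by
    have : m.factorial ≤ m ^ m := Nat.factorial_le_pow m
    calc (m.factorial : ℝ) ≤ (m : ℝ) ^ m := by exact_mod_cast this
      _ ≤ (k : ℝ) ^ m := by gcongr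
  have h4 : (0 : ℝ) < m.factorial := by exact_mod_cast m.factorial_pos
  calc (θ / 2) ^ k * ((p : ℝ) / k) ^ m ≤ (θ / 2) ^ m * ((p : ℝ) / k) ^ m := by gcongr
    _ = (θ / 2 * p) ^ m / (k : ℝ) ^ m := by rw [← mul_pow, ← div_pow, mul_div_assoc]
    _ ≤ ((N + 1 - m : ℕ) : ℝ) ^ m / m.factorial := by gcongr

/-- The number of supports having a given part outside of `U`. -/
lemma choose_le_card_fiber {p k : ℕ} (U T : Finset (Fin p)) (hTU : Disjoint T U)
    (hT : T.card ≤ k) :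
    U.card.choose (k - T.card) ≤
      ((Finset.powersetCard k (Finset.univ : Finset (Fin p))).filter fun S => S \ U = T).card := by
  rw [← Finset.card_powersetCard]
  refine Finset.card_le_card_of_injOn (fun D => T ∪ D) ?_ ?_
  · intro D hD
    obtain ⟨hDU, hD⟩ := Finset.mem_powersetCard.1 (Finset.mem_coe.1 hD)
    simp only [Finset.coe_filter, mem_ofPred_eq, Finset.mem_powersetCard, Finset.subset_univ,
      true_and]
    constructor
    · rw [Finset.card_union_of_disjoint (hTU.mono_right hDU), hD]
      omega
    · rw [Finset.union_sdiff_distrib, Finset.sdiff_eq_empty_iff_subset.2 hDU, Finset.union_empty,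
        Finset.sdiff_eq_self_of_disjoint hTU]
  · intro D hD D' hD' h
    have h1 := (Finset.mem_powersetCard.1 (Finset.mem_coe.1 hD)).1
    have h2 := (Finset.mem_powersetCard.1 (Finset.mem_coe.1 hD')).1
    have e : ∀ X ⊆ U, (T ∪ X) ∩ U = X := by
      intro X hX
      rw [Finset.union_inter_distrib_right, Finset.disjoint_iff_inter_eq_empty.1 hTU,
        Finset.empty_union, Finset.inter_eq_left.2 hX]
    rw [← e D h1, ← e D' h2]
    simp only at h
    rw [h]

/-- A decoder whose observations depend on the support only through its part outside of `U`
succeeds for few supports. -/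
lemma sum_success_le {p k d : ℕ} {Y : Type*} [Fintype Y] {θ m₀ : ℝ} (hθ : 0 < θ) (hθ1 : θ ≤ 1)
    (hk : 0 < k) (hkp : k ≤ θ / 2 * p) (hd : d ≤ k) (U : Finset (Fin p)) (hU : θ * p ≤ U.card)
    (𝒮 : Finset (Finset (Fin p))) (h𝒮 : 𝒮 ⊆ Finset.powersetCard k Finset.univ)
    (hm₀ : ∀ S ∈ 𝒮, m₀ ≤ (S ∩ U).card) (D : Y → Finset (Fin p)) (q : Finset (Fin p) → Y → ℝ)
    (hq0 : ∀ T y, 0 ≤ q T y) (hq : ∀ T, ∑ y, q T y = 1) :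
    ∑ S ∈ 𝒮, ∑ y, (if (S \ D y).card ≤ d ∧ (D y \ S).card ≤ d then q (S \ U) y else 0)
      ≤ (8 * Real.exp 1 / θ) ^ k * Real.exp ((d - m₀) * Real.log ((p : ℝ) / k))
        * (Finset.powersetCard k (Finset.univ : Finset (Fin p))).card := by
  set L := Real.log ((p : ℝ) / k) with hL
  set ρ := (8 * Real.exp 1 / θ) ^ k * Real.exp ((d - m₀) * L) with hρ
  have hρ0 : 0 ≤ ρ := by positivity
  have hk' : (0 : ℝ) < k := by exact_mod_cast hk
  have hkp' : k ≤ p := by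
    have : (k : ℝ) ≤ p := by
      have : (0 : ℝ) ≤ p := Nat.cast_nonneg p
      nlinarith
    exact_mod_cast this
  have hL0 : 0 ≤ L := by
    refine Real.log_nonneg ?_
    rw [one_le_div hk']
    exact_mod_cast hkp'
  set 𝒜 := Finset.powersetCard k (Finset.univ : Finset (Fin p)) with h𝒜
  -- On the supports with a given `S \ U = T` the law of the observations is the same, so one output
  -- `D y` must serve the whole fiber. The supports it is close to are few by `card_close_le`, while
  -- the fiber is large by `choose_ge`.
  have key : ∀ T y, (((𝒮.filter fun S => S \ U = T).filter
      fun S => (S \ D y).card ≤ d ∧ (D y \ S).card ≤ d).card : ℝ)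
      ≤ ρ * (𝒜.filter fun S => S \ U = T).card := by
    intro T y
    rcases (𝒮.filter fun S => S \ U = T).eq_empty_or_nonempty with h | ⟨S₀, hS₀⟩
    · rw [h]
      simp only [Finset.filter_empty, Finset.card_empty, Nat.cast_zero]
      positivity
    · rw [Finset.mem_filter] at hS₀
      have hS₀k : S₀.card = k := (Finset.mem_powersetCard.1 (h𝒮 hS₀.1)).2
      have hTc : T.card + (S₀ ∩ U).card = k := by
        rw [← hS₀.2, Finset.card_sdiff_add_card_inter, hS₀k]
      have hTU : Disjoint T U := hS₀.2 ▸ Finset.sdiff_disjoint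
      have hm : m₀ ≤ ((k - T.card : ℕ) : ℝ) := by
        have : k - T.card = (S₀ ∩ U).card := by omega
        rw [this]
        exact hm₀ S₀ hS₀.1
      have h1 := choose_ge hθ hθ1 hk hkp (Nat.sub_le k T.card) hU
      have h2 : ((U.card.choose (k - T.card) : ℕ) : ℝ) ≤ (𝒜.filter fun S => S \ U = T).card := by
        exact_mod_cast choose_le_card_fiber U T hTU (by omega)
      have h3 : (((𝒮.filter fun S => S \ U = T).filter
          fun S => (S \ D y).card ≤ d ∧ (D y \ S).card ≤ d).card : ℝ)
          ≤ (4 * Real.exp 1) ^ k * Real.exp (d * L) := by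
        refine le_trans ?_ (card_close_le hk hkp' hd (D y))
        exact_mod_cast Finset.card_le_card (Finset.filter_subset_filter _
          ((Finset.filter_subset _ _).trans h𝒮))
      refine h3.trans ?_
      have h4 : (θ / 2) ^ k * Real.exp (m₀ * L) ≤ (𝒜.filter fun S => S \ U = T).card := by
        refine le_trans ?_ (h1.trans h2)
        gcongr
      calc (4 * Real.exp 1) ^ k * Real.exp (d * L) = ρ * ((θ / 2) ^ k * Real.exp (m₀ * L)) := by
            rw [hρ, mul_mul_mul_comm, ← mul_pow, ← Real.exp_add]
            congr 2
            · field_simp; norm_num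
            · ring
        _ ≤ _ := by gcongr
  calc ∑ S ∈ 𝒮, ∑ y, (if (S \ D y).card ≤ d ∧ (D y \ S).card ≤ d then q (S \ U) y else 0)
      = ∑ T : Finset (Fin p), ∑ S ∈ 𝒮.filter (fun S => S \ U = T), ∑ y,
          (if (S \ D y).card ≤ d ∧ (D y \ S).card ≤ d then q (S \ U) y else 0) :=
        (Finset.sum_fiberwise _ _ _).symm
    _ = ∑ T : Finset (Fin p), ∑ y, q T y * (((𝒮.filter fun S => S \ U = T).filter
          fun S => (S \ D y).card ≤ d ∧ (D y \ S).card ≤ d).card : ℝ) := by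
        refine Finset.sum_congr rfl fun T _ => ?_
        rw [Finset.sum_comm]
        refine Finset.sum_congr rfl fun y _ => ?_
        rw [← Finset.sum_filter, mul_comm, ← nsmul_eq_mul, ← Finset.sum_const]
        refine Finset.sum_congr rfl fun S hS => ?_
        rw [(Finset.mem_filter.1 (Finset.mem_filter.1 hS).1).2]
    _ ≤ ∑ T : Finset (Fin p), ∑ y, q T y * (ρ * (𝒜.filter fun S => S \ U = T).card) := by
        refine Finset.sum_le_sum fun T _ => Finset.sum_le_sum fun y _ => ?_
        exact mul_le_mul_of_nonneg_left (key T y) (hq0 T y)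
    _ = ρ * ∑ T : Finset (Fin p), ((𝒜.filter fun S => S \ U = T).card : ℝ) := by
        rw [Finset.mul_sum]
        refine Finset.sum_congr rfl fun T _ => ?_
        rw [← Finset.sum_mul, hq, one_mul]
    _ = ρ * 𝒜.card := by
        congr 1
        have := Finset.card_eq_sum_card_fiberwise (s := 𝒜) (t := Finset.univ)
          (f := fun S : Finset (Fin p) => S \ U) (fun _ _ => Finset.mem_coe.2 (Finset.mem_univ _))
        rw [this]
        push_cast
        rfl

/-! ### Converse: change of measure -/

/-- The sign encoded by a Boolean. -/
def boolSign (y : Bool) : ℝ := if y then 1 else -1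

lemma exists_boolSign (x : ℝ) : ∃ y, sgn x = boolSign y := by
  rcases sgn_eq x with h | h
  · exact ⟨true, by simp [h, boolSign]⟩
  · exact ⟨false, by simp [h, boolSign]⟩

lemma measure_sgn_eq_boolSign {σ : ℝ} (hσ : 0 < σ) (t : ℝ) (y : Bool) :
    (noiseLaw σ).real {z | sgn (t + z) = boolSign y} = Phi (boolSign y * t / σ) := by
  have h := toNNReal_sq_ne_zero hσ
  cases y
  · have := measure_sgn_eq_neg_one h t
    rw [sqrt_toNNReal_sq hσ] at this
    simpa [boolSign] using this
  · have := measure_sgn_eq_one h t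
    rw [sqrt_toNNReal_sq hσ] at this
    simpa [boolSign] using this

open Classical in
/-- The probability of an event that involves the noise through the signs only. -/
lemma noise_prob_le {n : ℕ} {σ : ℝ} (hσ : 0 < σ) (t : Fin n → ℝ) (P : (Fin n → ℝ) → Prop) :
    (Measure.pi fun _ : Fin n => noiseLaw σ).real {z | P fun i => sgn (t i + z i)}
      ≤ ∑ y : Fin n → Bool, if P (fun i => boolSign (y i)) then
          ∏ i, Phi (boolSign (y i) * t i / σ) else 0 := by
  have hsub : {z : Fin n → ℝ | P fun i => sgn (t i + z i)} ⊆
      ⋃ y ∈ (Finset.univ : Finset (Fin n → Bool)).filter (fun y => P fun i => boolSign (y i)),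
        Set.pi univ fun i => {z | sgn (t i + z) = boolSign (y i)} := by
    intro z hz
    choose y hy using fun i => exists_boolSign (t i + z i)
    simp only [mem_iUnion]
    refine ⟨y, ?_, fun i _ => hy i⟩
    simp only [Finset.mem_filter, Finset.mem_univ, true_and]
    have hz' : P fun i => sgn (t i + z i) := hz
    rwa [funext hy] at hz'
  refine (measureReal_mono hsub (measure_ne_top _ _)).trans
    ((measureReal_biUnion_finset_le _ _).trans_eq ?_)
  rw [Finset.sum_filter]
  refine Finset.sum_congr rfl fun y _ => ?_
  split_ifs
  · rw [measureReal_def, Measure.pi_pi, ENNReal.toReal_prod]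
    exact Finset.prod_congr rfl fun i _ => measure_sgn_eq_boolSign hσ (t i) (y i)
  · rfl

/-- The log-likelihood ratio of two directions. -/
def ratio {n p : ℕ} (ε : ℝ) (θ θ' : Fin p → ℝ) (o : (Fin n → Fin p → ℝ) × (Fin n → ℝ)) : ℝ :=
  ∑ i, (ell ε (o.2 i * ip (o.1 i) θ) - ell ε (o.2 i * ip (o.1 i) θ'))

/-- The smoothed likelihood of a pattern of signs. -/
def likelihood {n p : ℕ} (ε : ℝ) (θ : Fin p → ℝ) (X : Fin n → Fin p → ℝ) (y : Fin n → Bool) : ℝ :=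
  ∏ i, Real.exp (ell ε (boolSign (y i) * ip (X i) θ))

lemma likelihood_nonneg {n p : ℕ} (ε : ℝ) (θ : Fin p → ℝ) (X : Fin n → Fin p → ℝ)
    (y : Fin n → Bool) : 0 ≤ likelihood ε θ X y :=
  Finset.prod_nonneg fun _ _ => (Real.exp_pos _).le

lemma sum_likelihood {n p : ℕ} {ε : ℝ} (h0 : 0 < ε) (h1 : ε < 1 / 2) (θ : Fin p → ℝ)
    (X : Fin n → Fin p → ℝ) : ∑ y, likelihood ε θ X y = 1 := by
  unfold likelihood
  have h := Finset.prod_univ_sum (fun _ : Fin n => (Finset.univ : Finset Bool))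
    fun i y => Real.exp (ell ε (boolSign y * ip (X i) θ))
  rw [Fintype.piFinset_univ] at h
  rw [← h]
  refine Finset.prod_eq_one fun i _ => ?_
  simp only [Fintype.sum_bool, boolSign, exp_ell h0 h1]
  simp only [if_true, Bool.false_eq_true, if_false, one_mul, neg_one_mul, Phi_neg]
  ring

open Classical in
/-- Change of measure from the true law of the responses to a reference likelihood. -/
lemma noise_prob_ratio_le {n p : ℕ} {σ ε γ : ℝ} (hσ : 0 < σ) (h0 : 0 < ε) (h1 : ε < 1 / 2)
    (S : Finset (Fin p)) (b θ : Fin p → ℝ) (X : Fin n → Fin p → ℝ) (P : (Fin n → ℝ) → Prop) :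
    (Measure.pi fun _ : Fin n => noiseLaw σ).real {z |
        P (observe (dir S b 1) (X, z)).2 ∧
        ratio ε (dir S b σ) θ (observe (dir S b 1) (X, z)) ≤ γ}
      ≤ Real.exp (γ - n * Real.log (1 - 2 * ε)) * ∑ y : Fin n → Bool,
          if P (fun i => boolSign (y i)) then likelihood ε θ X y else 0 := by
  have h2 : 0 < 1 - 2 * ε := by linarith
  have h := noise_prob_le hσ (fun i => ip (X i) (dir S b 1))
    (fun y => P y ∧ ratio ε (dir S b σ) θ (X, y) ≤ γ)
  refine h.trans ?_
  rw [Finset.mul_sum]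
  refine Finset.sum_le_sum fun y _ => ?_
  by_cases hP : P fun i => boolSign (y i)
  · rw [if_pos hP]
    split_ifs with hr
    -- The unsmoothed probability exceeds the smoothed one by a factor of at most `1 / (1 - 2 * ε)`;
    -- this is the only cost of working with `ell`.
    · have e1 : ∀ i, Phi (boolSign (y i) * ip (X i) (dir S b 1) / σ)
          ≤ Real.exp (-Real.log (1 - 2 * ε)) *
            Real.exp (ell ε (boolSign (y i) * ip (X i) (dir S b σ))) := by
        intro i
        rw [exp_ell h0 h1, Real.exp_neg, Real.exp_log h2, ip_dir S b (X i) σ, mul_div_assoc,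
          ← div_eq_inv_mul, le_div_iff₀ h2]
        linarith
      calc ∏ i, Phi (boolSign (y i) * ip (X i) (dir S b 1) / σ)
          ≤ ∏ i, (Real.exp (-Real.log (1 - 2 * ε)) *
            Real.exp (ell ε (boolSign (y i) * ip (X i) (dir S b σ)))) :=
            Finset.prod_le_prod (fun i _ => (Phi_pos _).le) fun i _ => e1 i
        _ = Real.exp (-(n * Real.log (1 - 2 * ε)) +
            ratio ε (dir S b σ) θ (X, fun i => boolSign (y i))) * likelihood ε θ X y := by
            unfold likelihood ratio
            rw [Finset.prod_mul_distrib, Finset.prod_const, Finset.card_univ, Fintype.card_fin,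
              ← Real.exp_nat_mul, ← Real.exp_sum, ← Real.exp_sum, ← Real.exp_add, ← Real.exp_add,
              Finset.sum_sub_distrib]
            congr 1
            ring
        _ ≤ _ := by
            refine mul_le_mul_of_nonneg_right (Real.exp_le_exp.2 ?_) (likelihood_nonneg _ _ _ _)
            linarith [hr.2]
    · exact mul_nonneg (Real.exp_pos _).le (likelihood_nonneg _ _ _ _)
  · rw [if_neg hP, if_neg fun h => hP h.1, mul_zero]

lemma lintegral_uniformOn {α : Type*} [MeasurableSpace α] [MeasurableSingletonClass α]
    (F : Finset α) (f : α → ENNReal) :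
    ∫⁻ s, f s ∂(uniformOn (F : Set α)) = (F.card : ENNReal)⁻¹ * ∑ s ∈ F, f s := by
  rw [uniformOn, ProbabilityTheory.cond, lintegral_smul_measure, lintegral_finset]
  simp

/-- A bound on the probability of an event under a uniform choice of a support, by the sum over
all supports with the other variables fixed. -/
lemma uniform_prod_le {p k : ℕ} {α β γ : Type*} [MeasurableSpace α] [MeasurableSpace β]
    [MeasurableSpace γ] {μ : Measure α} {ν : Measure β} {ξ : Measure γ} [IsProbabilityMeasure μ]
    [IsProbabilityMeasure ν] [IsProbabilityMeasure ξ] (hkp : k ≤ p)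
    {E : Set (Finset (Fin p) × (α × (β × γ)))} (hE : MeasurableSet E) {r : ℝ} (hr : 0 ≤ r)
    (h : ∀ a b, ∑ S ∈ Finset.powersetCard k (Finset.univ : Finset (Fin p)),
      ξ.real {c | (S, a, b, c) ∈ E} ≤ r * (Finset.powersetCard k
        (Finset.univ : Finset (Fin p))).card) :
    ((uniformOn {S : Finset (Fin p) | S.card = k}).prod (μ.prod (ν.prod ξ))).real E ≤ r := by
  have := isProbabilityMeasure_uniform hkp
  refine ENNReal.toReal_le_of_le_ofReal hr ?_
  rw [Measure.prod_apply hE, setOf_card_eq, lintegral_uniformOn]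
  set 𝒜 := Finset.powersetCard k (Finset.univ : Finset (Fin p)) with h𝒜
  have hN : 0 < 𝒜.card := Finset.card_pos.2 (Finset.powersetCard_nonempty.2 (by simpa using hkp))
  have hES : ∀ S, MeasurableSet (Prod.mk S ⁻¹' E) := fun S => hE.preimage measurable_prodMk_left
  have e1 : ∀ S, (μ.prod (ν.prod ξ)) (Prod.mk S ⁻¹' E)
      = ∫⁻ a, ∫⁻ b, ξ {c | (S, a, b, c) ∈ E} ∂ν ∂μ := by
    intro S
    rw [Measure.prod_apply (hES S)]
    refine lintegral_congr fun a => ?_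
    rw [Measure.prod_apply ((hES S).preimage measurable_prodMk_left)]
    rfl
  simp_rw [e1]
  have hm1 : ∀ S, Measurable fun a => ∫⁻ b, ξ {c | (S, a, b, c) ∈ E} ∂ν := by
    intro S
    have : (fun a => ∫⁻ b, ξ {c | (S, a, b, c) ∈ E} ∂ν)
        = fun a => (ν.prod ξ) (Prod.mk a ⁻¹' (Prod.mk S ⁻¹' E)) := by
      ext a
      rw [Measure.prod_apply ((hES S).preimage measurable_prodMk_left)]
      rfl
    rw [this]
    exact measurable_measure_prodMk_left (hES S)
  have hm2 : ∀ S a, Measurable fun b => ξ {c | (S, a, b, c) ∈ E} := by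
    intro S a
    exact measurable_measure_prodMk_left ((hES S).preimage measurable_prodMk_left)
  rw [← lintegral_finsetSum _ fun S _ => hm1 S]
  have hpt : ∀ a, ∑ S ∈ 𝒜, ∫⁻ b, ξ {c | (S, a, b, c) ∈ E} ∂ν
      ≤ ENNReal.ofReal (r * 𝒜.card) := by
    intro a
    rw [← lintegral_finsetSum _ fun S _ => hm2 S a]
    refine (lintegral_mono fun b => ?_).trans_eq (by
      rw [lintegral_const, measure_univ, mul_one])
    have e2 : ∑ S ∈ 𝒜, ξ {c | (S, a, b, c) ∈ E}
        = ENNReal.ofReal (∑ S ∈ 𝒜, ξ.real {c | (S, a, b, c) ∈ E}) := by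
      rw [ENNReal.ofReal_sum_of_nonneg fun _ _ => measureReal_nonneg]
      exact Finset.sum_congr rfl fun S _ => (ofReal_measureReal (measure_ne_top _ _)).symm
    rw [e2]
    exact ENNReal.ofReal_le_ofReal (h a b)
  calc (𝒜.card : ENNReal)⁻¹ * ∫⁻ a, ∑ S ∈ 𝒜, ∫⁻ b, ξ {c | (S, a, b, c) ∈ E} ∂ν ∂μ
      ≤ (𝒜.card : ENNReal)⁻¹ * ENNReal.ofReal (r * 𝒜.card) := by
        gcongr
        refine (lintegral_mono hpt).trans_eq ?_
        rw [lintegral_const, measure_univ, mul_one]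
    _ = ENNReal.ofReal r := by
        rw [ENNReal.ofReal_mul hr, ENNReal.ofReal_natCast, mul_left_comm,
          ENNReal.inv_mul_cancel (by exact_mod_cast hN.ne') (by simp), mul_one]

/-! ### Converse: level sets of the coefficients -/

open Classical in
/-- The indices whose normalized coefficient lies in a given set. -/
def level {p : ℕ} (k : ℕ) (c : ℝ) (A : Set ℝ) (b : Fin p → ℝ) : Finset (Fin p) :=
  Finset.univ.filter fun j => b j / sd k c ∈ A

lemma sum_indicator_level {p k : ℕ} {c : ℝ} (A : Set ℝ) (S : Finset (Fin p)) (b : Fin p → ℝ)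
    (f : ℝ → ℝ) : ∑ j ∈ S, A.indicator f (b j / sd k c)
      = ∑ j ∈ S ∩ level k c A b, f (b j / sd k c) := by
  classical
  have e : S ∩ level k c A b = S.filter fun j => b j / sd k c ∈ A := by
    ext j
    simp [level]
  rw [e, Finset.sum_filter]
  exact Finset.sum_congr rfl fun j _ => by rw [Set.indicator_apply]

lemma variance_indicator_le {f : ℝ → ℝ} (hf : Measurable f) (hL : MemLp f 2 (gaussianReal 0 1))
    {A : Set ℝ} (hA : MeasurableSet A) :
    Var[A.indicator f; gaussianReal 0 1] ≤ ∫ w, f w ^ 2 ∂(gaussianReal 0 1) := by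
  refine (variance_le_expectation_sq (hf.indicator hA).aestronglyMeasurable).trans ?_
  refine integral_mono (hL.indicator hA).integrable_sq hL.integrable_sq fun w => ?_
  rw [Pi.pow_apply]
  by_cases hw : w ∈ A
  · rw [Set.indicator_of_mem hw]
  · rw [Set.indicator_of_notMem hw, zero_pow two_ne_zero]
    exact sq_nonneg _

/-- With high probability, the energy and the number of the coefficients that lie at a given level
are close to their means. -/
lemma exists_typical_levels {c δ : ℝ} (hc : 0 < c) (hδ : 0 < δ) :
    ∃ V : ℝ, ∀ (α : ℝ) (A : Set ℝ), MeasurableSet A → (gaussianReal 0 1).real A = α →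
      ∫ w in A, w ^ 2 ∂(gaussianReal 0 1) = g α → ∀ (p k : ℕ) (S : Finset (Fin p)), 0 < k →
      S.card = k → ∃ B : Set (Fin p → ℝ), MeasurableSet B ∧ (coefLaw p k c).real B ≤ V / k ∧
        ∀ b ∉ B, |en S b - c| ≤ c * δ ∧ |en (S ∩ level k c A b) b - c * g α| ≤ c * δ ∧
          (α - δ) * k ≤ (S ∩ level k c A b).card ∧ (α - δ) * p ≤ (level k c A b).card := by
  set M := ∫ w, (w ^ 2) ^ 2 ∂(gaussianReal 0 1) with hM
  -- The constant must not depend on `α`, which will vary with `p` through `σ`; the variances of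
  -- truncations are therefore bounded by the fourth moment and by `1`. The last summand accounts
  -- for the count over all `p ≥ k` indices.
  refine ⟨(2 * M + 1) / δ ^ 2 + 1 / δ ^ 2, fun α A hA hAα hAg p k S hk hS => ?_⟩
  have hk' : (0 : ℝ) < k := by exact_mod_cast hk
  have hkp : k ≤ p := by
    have := Finset.card_le_univ S
    rwa [hS, Fintype.card_fin] at this
  have hp' : (k : ℝ) ≤ p := by exact_mod_cast hkp
  have h1L : MemLp (fun _ : ℝ => (1 : ℝ)) 2 (gaussianReal 0 1) := memLp_const 1
  have hm2 : Measurable fun w : ℝ => w ^ 2 := by fun_prop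
  set f : Fin 3 → ℝ → ℝ := ![fun w => w ^ 2, A.indicator fun w => w ^ 2, A.indicator fun _ => 1]
    with hf
  have hfm : ∀ i ∈ (Finset.univ : Finset (Fin 3)), Measurable (f i) := by
    intro i _
    fin_cases i
    · exact hm2
    · exact hm2.indicator hA
    · exact measurable_const.indicator hA
  have hfL : ∀ i ∈ (Finset.univ : Finset (Fin 3)), MemLp (f i) 2 (gaussianReal 0 1) := by
    intro i _
    fin_cases i
    · exact memLp_sq_std
    · exact memLp_sq_std.indicator hA
    · exact h1L.indicator hA
  have hint1 : ∫ w, A.indicator (fun _ => (1 : ℝ)) w ∂(gaussianReal 0 1) = α := by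
    rw [integral_indicator hA, setIntegral_const, smul_eq_mul, mul_one, hAα]
  have hint2 : ∫ w, A.indicator (fun w => w ^ 2) w ∂(gaussianReal 0 1) = g α := by
    rw [integral_indicator hA, hAg]
  have hvar1 : Var[A.indicator fun _ => (1 : ℝ); gaussianReal 0 1] ≤ 1 := by
    simpa using variance_indicator_le measurable_const h1L hA
  obtain ⟨B₁, hB₁m, hB₁, hd₁⟩ := exists_deviation_set (p := p) (k := k) hc hk hδ
    (Finset.univ : Finset (Fin 3)) f hfm hfL (A := S) (by omega)
  obtain ⟨B₂, hB₂m, hB₂, hd₂⟩ := exists_deviation_set (p := p) (k := k) hc hk hδ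
    (Finset.univ : Finset Unit) (fun _ => A.indicator fun _ => (1 : ℝ))
    (fun _ _ => measurable_const.indicator hA) (fun _ _ => h1L.indicator hA)
    (A := Finset.univ) (by simp; omega)
  refine ⟨B₁ ∪ B₂, hB₁m.union hB₂m, ?_, fun b hb => ?_⟩
  · refine (measureReal_union_le _ _).trans ?_
    rw [add_div]
    refine add_le_add (hB₁.trans ?_) (hB₂.trans ?_)
    · rw [hS]
      gcongr
      rw [Fin.sum_univ_three]
      have v0 := variance_indicator_le hm2 memLp_sq_std MeasurableSet.univ
      have v1 := variance_indicator_le hm2 memLp_sq_std hA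
      rw [Set.indicator_univ] at v0
      simp only [hf, Matrix.cons_val_zero, Matrix.cons_val_one, Matrix.cons_val]
      linarith
    · rw [Finset.card_univ, Fintype.card_fin, Finset.univ_unique, Finset.sum_singleton]
      gcongr
  · rw [mem_union, not_or] at hb
    have a0 := hd₁ b hb.1 0 (Finset.mem_univ _)
    have a1 := hd₁ b hb.1 1 (Finset.mem_univ _)
    have a2 := hd₁ b hb.1 2 (Finset.mem_univ _)
    have a3 := hd₂ b hb.2 () (Finset.mem_univ _)
    simp only [hf, Matrix.cons_val_zero, Matrix.cons_val_one, Matrix.cons_val, hS, integral_sq_std,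
      hint1, hint2, sum_indicator_level, Finset.univ_inter, Finset.sum_const, nsmul_eq_mul,
      mul_one, Finset.card_univ, Fintype.card_fin] at a0 a1 a2 a3
    have hscale : ∀ x y : ℝ, |x - k * y| < δ * k → |c / k * x - c * y| ≤ c * δ := by
      intro x y h
      have e : c / k * x - c * y = c / k * (x - k * y) := by field_simp
      rw [e, abs_mul, abs_of_pos (by positivity)]
      calc c / k * |x - k * y| ≤ c / k * (δ * k) := by gcongr
        _ = c * δ := by field_simp
    refine ⟨?_, ?_, ?_, ?_⟩
    · rw [en_eq_sum_normalized hc hk]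
      simpa using hscale _ 1 (by simpa using a0)
    · rw [en_eq_sum_normalized hc hk]
      exact hscale _ _ a1
    · linarith [(abs_lt.1 a2).1]
    · linarith [(abs_lt.1 a3).1]

/-! ### Converse: bound on the success probability -/

lemma measurableSet_of_slices {ι α : Type*} [Countable ι] [MeasurableSpace ι]
    [MeasurableSingletonClass ι] [MeasurableSpace α] {E : Set (ι × α)}
    (h : ∀ i, MeasurableSet (Prod.mk i ⁻¹' E)) : MeasurableSet E := by
  have e : E = ⋃ i, {i} ×ˢ (Prod.mk i ⁻¹' E) := by
    ext ⟨i, a⟩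
    simp
  rw [e]
  exact MeasurableSet.iUnion fun i => (measurableSet_singleton i).prod (h i)

lemma measurable_ratio {α : Type*} [MeasurableSpace α] {n p : ℕ} {ε : ℝ} {θ θ' : α → Fin p → ℝ}
    (hθ : Measurable θ) (hθ' : Measurable θ') {o : α → (Fin n → Fin p → ℝ) × (Fin n → ℝ)}
    (ho : Measurable o) : Measurable fun a => ratio ε (θ a) (θ' a) (o a) := by
  unfold ratio ip
  fun_prop

lemma measurable_dir {p : ℕ} (S : Finset (Fin p)) (s : ℝ) :
    Measurable fun b : Fin p → ℝ => dir S b s := by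
  refine measurable_pi_lambda _ fun j => ?_
  unfold dir
  split_ifs <;> fun_prop

lemma measurable_dir_sdiff_level {p : ℕ} (k : ℕ) (c : ℝ) {A : Set ℝ} (hA : MeasurableSet A)
    (S : Finset (Fin p)) (s : ℝ) :
    Measurable fun b : Fin p → ℝ => dir (S \ level k c A b) b s := by
  refine measurable_pi_lambda _ fun j => ?_
  unfold dir
  refine Measurable.ite ?_ (by fun_prop) measurable_const
  have h : MeasurableSet {b : Fin p → ℝ | b j / sd k c ∉ A} :=
    hA.compl.preimage (by fun_prop : Measurable fun b : Fin p → ℝ => b j / sd k c)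
  by_cases hj : j ∈ S
  · simpa [level, hj] using h
  · simp [hj]

lemma measurable_observe {p n : ℕ} (S : Finset (Fin p)) :
    Measurable fun q : (Fin p → ℝ) × ((Fin n → Fin p → ℝ) × (Fin n → ℝ)) =>
      observe (dir S q.1 1) q.2 := by
  have h : Measurable fun q : (Fin p → ℝ) × ((Fin n → Fin p → ℝ) × (Fin n → ℝ)) =>
      (mat ((S, q) : Sample p n), obs ((S, q) : Sample p n)) := by
    refine Measurable.prodMk ?_ (obs_measurable.comp measurable_prodMk_left)
    unfold mat
    fun_prop
  simp only [observe_eq] at h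
  exact h

/-- Upper bound on the success probability of a decoder, in terms of typical sets of coefficients
and of a bound on the log-likelihood ratio. -/
lemma success_le {p n k d : ℕ} {c σ ε τ γ θ m₀ r₁ r₂ : ℝ} (hσ : 0 < σ) (h0 : 0 < ε)
    (h1 : ε < 1 / 2) (hθ : 0 < θ) (hθ1 : θ ≤ 1) (hk : 0 < k) (hkp : k ≤ θ / 2 * p) (hd : d ≤ k)
    {A : Set ℝ} (hA : MeasurableSet A) {B : Finset (Fin p) → Set (Fin p → ℝ)}
    (hBm : ∀ S, MeasurableSet (B S)) (hB : ∀ S, S.card = k → (coefLaw p k c).real (B S) ≤ r₁)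
    (hr₁ : 0 ≤ r₁) (hr₂ : 0 ≤ r₂)
    (hratio : ∀ S, S.card = k → ∀ b ∉ B S, (obsLaw n p σ).real {ω |
      γ < ratio ε (dir S b σ) (dir (S \ level k c A b) b τ) (observe (dir S b 1) ω)} ≤ r₂)
    (hcard : ∀ S, S.card = k → ∀ b ∉ B S,
      m₀ ≤ (S ∩ level k c A b).card ∧ θ * p ≤ (level k c A b).card)
    {D : Decoder p n} (hD : Measurable D) :
    (law p n k c σ).real {ω | (supp ω \ D (mat ω, obs ω)).card ≤ d ∧
        (D (mat ω, obs ω) \ supp ω).card ≤ d}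
      ≤ r₁ + r₂ + Real.exp (γ - n * Real.log (1 - 2 * ε)) *
        ((8 * Real.exp 1 / θ) ^ k * Real.exp ((d - m₀) * Real.log ((p : ℝ) / k))) := by
  classical
  have hkp' : k ≤ p := by
    have : (k : ℝ) ≤ p := by
      have : (0 : ℝ) ≤ p := Nat.cast_nonneg p
      nlinarith
    exact_mod_cast this
  have hu := isProbabilityMeasure_uniform hkp'
  set G : Set (Sample p n) := {ω | ω.2.1 ∉ B ω.1 ∧ ratio ε (dir ω.1 ω.2.1 σ)
    (dir (ω.1 \ level k c A ω.2.1) ω.2.1 τ) (observe (dir ω.1 ω.2.1 1) ω.2.2) ≤ γ} with hG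
  have hGs : ∀ S, MeasurableSet (Prod.mk S ⁻¹' G) := by
    intro S
    refine MeasurableSet.inter ((hBm S).compl.preimage measurable_fst)
      (measurableSet_le (measurable_ratio ?_ ?_ (measurable_observe S)) measurable_const)
    · exact (measurable_dir S σ).comp measurable_fst
    · exact (measurable_dir_sdiff_level k c hA S τ).comp measurable_fst
  have hGm : MeasurableSet G := measurableSet_of_slices hGs
  have hsm := measurableSet_of_decoder hD
    fun S T => (S \ T).card ≤ d ∧ (T \ S).card ≤ d
  set R : Set (Sample p n) := {ω | (supp ω \ D (mat ω, obs ω)).card ≤ d ∧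
    (D (mat ω, obs ω) \ supp ω).card ≤ d} with hR
  have : IsProbabilityMeasure (law p n k c σ) := by
    unfold law
    infer_instance
  have hsplit : (law p n k c σ).real R
      ≤ (law p n k c σ).real Gᶜ + (law p n k c σ).real (R ∩ G) := by
    refine (measureReal_mono (fun ω hω => ?_) (measure_ne_top _ _)).trans
      (measureReal_union_le _ _)
    by_cases h : ω ∈ G
    · exact Or.inr ⟨hω, h⟩
    · exact Or.inl h
  refine hsplit.trans (add_le_add ?_ ?_)
  · have hB0 : (uniformOn {S : Finset (Fin p) | S.card = k}).real {S | S.card ≠ k} = 0 := by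
      rw [measureReal_def, (uniformOn_eq_zero_iff (Set.toFinite _)).2, ENNReal.toReal_zero]
      ext S
      simp
    have h := measure_prod_le (μ := uniformOn {S : Finset (Fin p) | S.card = k})
      (ν := (coefLaw p k c).prod (obsLaw n p σ)) hGm.compl (B := {S | S.card ≠ k})
      (Set.toFinite _).measurableSet (add_nonneg hr₁ hr₂) prob_le_one (fun S hS => by
        have hS' : S.card = k := by simpa using hS
        refine (measure_prod_le (hGs S).compl (hBm S) hr₂ prob_le_one fun b hb => ?_).trans
          (add_le_add (hB S hS') le_rfl)
        refine le_trans (le_of_eq ?_) (hratio S hS' b hb)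
        congr 1
        ext ω
        simp [hG, hb])
    rw [hB0, zero_add] at h
    exact h
  · refine uniform_prod_le hkp' (hsm.inter hGm) (by positivity) fun b X => ?_
    -- With coefficients and matrix fixed, `U` is the same set for every support. The reference
    -- likelihood, with direction `dir (S \ U) b τ`, then depends on `S` only through `S \ U`.
    set U := level k c A b with hU
    set 𝒮 := (Finset.powersetCard k (Finset.univ : Finset (Fin p))).filter fun S => b ∉ B S
      with h𝒮
    have hle : ∀ S ∈ Finset.powersetCard k (Finset.univ : Finset (Fin p)),
        (Measure.pi fun _ : Fin n => noiseLaw σ).real {z | (S, b, X, z) ∈ R ∩ G}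
        ≤ if b ∉ B S then Real.exp (γ - n * Real.log (1 - 2 * ε)) * ∑ y : Fin n → Bool,
          (if (S \ D (X, fun i => boolSign (y i))).card ≤ d ∧
            (D (X, fun i => boolSign (y i)) \ S).card ≤ d
          then likelihood ε (dir (S \ U) b τ) X y else 0) else 0 := by
      intro S _
      by_cases hb : b ∉ B S
      · rw [if_pos hb]
        have h := noise_prob_ratio_le (γ := γ) hσ h0 h1 S b (dir (S \ U) b τ) X fun y =>
          (S \ D (X, y)).card ≤ d ∧ (D (X, y) \ S).card ≤ d
        refine le_trans (measureReal_mono (fun z hz => ?_) (measure_ne_top _ _))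
          (h.trans_eq ?_)
        · obtain ⟨hz1, -, hz2⟩ := hz
          refine ⟨?_, hz2⟩
          simp only [hR, mem_ofPred_eq, observe_eq] at hz1
          exact hz1
        · congr!
      · rw [if_neg hb]
        refine le_of_eq ?_
        have : {z | (S, b, X, z) ∈ R ∩ G} = ∅ := by
          ext z
          simp only [mem_inter_iff, mem_empty_iff_false, iff_false]
          exact fun h => hb h.2.1
        rw [this, measureReal_empty]
    refine (Finset.sum_le_sum hle).trans ?_
    rw [← Finset.sum_filter, ← Finset.mul_sum, mul_assoc]
    refine mul_le_mul_of_nonneg_left ?_ (Real.exp_pos _).le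
    -- The lower bound on the size of `U` is known only when the coefficients are typical for at
    -- least one support.
    rcases 𝒮.eq_empty_or_nonempty with he | ⟨S₀, hS₀⟩
    · rw [← h𝒮, he, Finset.sum_empty]
      positivity
    · have hmem : ∀ S ∈ 𝒮, S.card = k ∧ b ∉ B S := fun S hS =>
        ⟨(Finset.mem_powersetCard.1 (Finset.mem_filter.1 hS).1).2, (Finset.mem_filter.1 hS).2⟩
      exact sum_success_le hθ hθ1 hk hkp hd U (hcard S₀ (hmem S₀ hS₀).1 b (hmem S₀ hS₀).2).2 𝒮
        (Finset.filter_subset _ _) (fun S hS => (hcard S (hmem S hS).1 b (hmem S hS).2).1)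
        (fun y : Fin n → Bool => D (X, fun i => boolSign (y i)))
        (fun T => likelihood ε (dir T b τ) X) (fun T y => likelihood_nonneg _ _ _ _)
        (fun T => sum_likelihood h0 h1 _ _)

/-- The log-likelihood ratio is unlikely to exceed a bound on its mean by a large amount. -/
lemma ratio_gt_le {n p : ℕ} {σ ε N t m : ℝ} (h0 : 0 < ε) (h1 : ε < 1 / 2)
    (β θ θ' : Fin p → ℝ) (hN : n ≤ N) (ht : 0 ≤ t)
    (hm : ∫ r, (ell ε (resp β r * ip r.1 θ) - ell ε (resp β r * ip r.1 θ')) ∂(rowLaw p σ) ≤ m) :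
    (obsLaw n p σ).real {ω | n * m + t < ratio ε θ θ' (observe β ω)}
      ≤ Real.exp (-t ^ 2 / (2 * (N * Real.log ε ^ 2))) := by
  have h := obsLaw_rowSum_ge_le (n := n) (σ := σ) (B := -Real.log ε) (N := N) (t := t)
    (f := fun r : (Fin p → ℝ) × ℝ => ell ε (resp β r * ip r.1 θ) - ell ε (resp β r * ip r.1 θ'))
    (by fun_prop) (fun r => by
      rw [abs_le]
      have a1 := ell_nonpos h0 h1 (resp β r * ip r.1 θ)
      have a2 := ell_nonpos h0 h1 (resp β r * ip r.1 θ')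
      have a3 := log_le_ell h0 h1 (resp β r * ip r.1 θ)
      have a4 := log_le_ell h0 h1 (resp β r * ip r.1 θ')
      constructor <;> linarith) hN ht
  rw [neg_sq] at h
  refine le_trans (measureReal_mono (fun ω hω => ?_) (measure_ne_top _ _)) h
  refine le_trans ?_ (le_of_lt (show n * m + t < ratio ε θ θ' (observe β ω) from hω))
  gcongr

lemma errProb_eq_one_sub {p n k d : ℕ} {c σ : ℝ} (hkp : k ≤ p) {D : Decoder p n}
    (hD : Measurable D) :
    errProb p n k c σ d D = 1 - (law p n k c σ).real
      {ω | (supp ω \ D (mat ω, obs ω)).card ≤ d ∧ (D (mat ω, obs ω) \ supp ω).card ≤ d} := by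
  have hu := isProbabilityMeasure_uniform hkp
  have : IsProbabilityMeasure (law p n k c σ) := by
    unfold law
    infer_instance
  have h := measurableSet_of_decoder hD fun S T => (S \ T).card ≤ d ∧ (T \ S).card ≤ d
  rw [← probReal_compl_eq_one_sub h]
  unfold errProb
  congr 1
  ext ω
  simp only [mem_ofPred_eq, mem_compl_iff]
  omega

/-- Near a maximizer of the converse objective, the objective is not degenerate. -/
lemma exists_maximizer {c αs σ ψ : ℝ} {k p : ℕ} (hc : 0 < c) (hσ : 0 < σ)
    (hαs : αs ∈ Ioo (0 : ℝ) 1) (hψ : ψ ≤ Psi αs c σ) (hψ0 : 0 < ψ)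
    (hr : 0 < k * Real.log ((p : ℝ) / k)) :
    ∃ α ∈ Icc αs 1, (1 - αs) * ψ ≤ α - αs ∧ ψ ≤ Psi α c σ ∧
      convThreshold αs c σ k p = (α - αs) / Psi α c σ * (k * Real.log ((p : ℝ) / k)) := by
  obtain ⟨⟨α, hα, hαe⟩, hmax⟩ := isGreatest_convThreshold hc hσ hαs k p
  have hΨ : ψ ≤ Psi α c σ := hψ.trans (Psi_mono hc hσ hα.1 hα.2)
  have hΨ0 := hψ0.trans_le hΨ
  have hΨ1 := Psi_pos hc hσ one_pos le_rfl
  have e : ∀ x, convObjective αs c σ k p x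
      = (x - αs) / Psi x c σ * (k * Real.log ((p : ℝ) / k)) := by
    intro x
    unfold convObjective
    ring
  -- Comparison with the endpoint `α = 1`: together with `Psi ≤ 1` there, it keeps the maximizer
  -- away from `αs`, so that the relative slack `η` is worth a fixed fraction of `k * log (p / k)`.
  have h1 := hmax (mem_image_of_mem _ (⟨hαs.2.le, le_rfl⟩ : (1 : ℝ) ∈ Icc αs 1))
  rw [← hαe, e, e] at h1
  have h2 := le_of_mul_le_mul_right h1 hr
  refine ⟨α, hα, ?_, hΨ, by rw [← hαe, e]⟩
  have h3 : 1 - αs ≤ (1 - αs) / Psi 1 c σ := by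
    rw [le_div_iff₀ hΨ1]
    have : Psi 1 c σ ≤ 1 := Psi_le.trans log_two_le_one
    nlinarith [hαs.2]
  have h4 := h3.trans h2
  rw [le_div_iff₀ hΨ0] at h4
  refine le_trans ?_ h4
  gcongr
  linarith [hαs.2]

/-- Below the threshold, every decoder has a large error probability. -/
lemma exists_errProb_lower_bound {c αs η s₁ s₂ : ℝ} (hc : 0 < c) (hαs : αs ∈ Ioo (0 : ℝ) 1)
    (hη : 0 < η) (hη1 : η ≤ 1) (hs₁ : 0 < s₁) :
    ∃ L₀ V : ℝ, ∀ (p n k : ℕ) (σ : ℝ), 0 < k → k ≤ p → 0 < σ → s₁ ≤ σ ^ 2 → σ ^ 2 ≤ s₂ →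
      L₀ ≤ Real.log ((p : ℝ) / k) → n ≤ convThreshold αs c σ k p * (1 - η) →
      ∀ D : Decoder p n, Measurable D →
        1 - (V / k + 2 * Real.exp (-k)) ≤ errProb p n k c σ ⌊αs * k⌋₊ D := by
  obtain ⟨hα0, hα1⟩ := hαs
  obtain ⟨ψ, hψ, hψle⟩ := exists_Psi_lower_bound (s₂ := s₂) hc hα0 hα1.le hs₁
  -- With `r = k * log (p / k)`, the slack `η * (α - αs) * r` is at least `8 * a * r`; every error
  -- term below is measured in units of `a * r`. Since `n ≤ r / ψ`, the next choice gives `n * δ ≤ a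
  -- * r / 2`.
  set a := η * ((1 - αs) * ψ) / 8 with ha
  have ha0 : 0 < a := by
    have : 0 < 1 - αs := by linarith
    positivity
  set δ := a * ψ / 2 with hδ
  have hδ0 : 0 < δ := by positivity
  obtain ⟨κ₁, hκ₁, hinfo⟩ := exists_information_modulus hc hs₁ (δ := δ / 3) (by positivity)
  obtain ⟨ε, hε0, hε1, hεl, -⟩ := exists_smoothing (δ := δ / 3) (by positivity)
  set C := (c + 1) / (2 * s₁ ^ 3) with hC
  have hC0 : 0 < C := by positivity
  set κ := min (min (c * a) (c * (αs / 2))) (min (min κ₁ 1) ((ε * δ / 3) ^ 2 / C)) with hκ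
  have hκ0 : 0 < κ := by positivity
  have hκa : κ / c ≤ a := by
    rw [div_le_iff₀ hc, mul_comm]
    exact (min_le_left _ _).trans (min_le_left _ _)
  have hκs : κ / c ≤ αs / 2 := by
    rw [div_le_iff₀ hc, mul_comm]
    exact (min_le_left _ _).trans (min_le_right _ _)
  have hκ1 : κ ≤ κ₁ := (min_le_right _ _).trans ((min_le_left _ _).trans (min_le_left _ _))
  have hκ2 : κ ≤ 1 := (min_le_right _ _).trans ((min_le_left _ _).trans (min_le_right _ _))
  have hκ3 : C * κ ^ 2 ≤ (ε * δ / 3) ^ 2 := by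
    calc C * κ ^ 2 ≤ C * κ := by
          gcongr
          nlinarith
      _ ≤ C * ((ε * δ / 3) ^ 2 / C) := by
          gcongr
          exact (min_le_right _ _).trans (min_le_right _ _)
      _ = _ := by field_simp
  have hcκ : c * (κ / c) = κ := by field_simp
  obtain ⟨V, htyp⟩ := exists_typical_levels hc (div_pos hκ0 hc)
  set θ := αs / 2 with hθ
  have hθ0 : 0 < θ := by positivity
  set M := Real.log (8 * Real.exp 1 / θ) + 1 with hM
  -- In order: positivity of `L`, the bound `k ≤ θ / 2 * p` for the counting, `k * M ≤ a * r` for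
  -- the factors `C ^ k`, and a Hoeffding exponent of at least `k`.
  refine ⟨max (max 1 (Real.log (2 / θ))) (max (M / a) (2 * Real.log ε ^ 2 / (a ^ 2 * ψ))), V, ?_⟩
  intro p n k σ hk hkp hσ hσ1 hσ2 hL hn D hD
  have hk' : (0 : ℝ) < k := by exact_mod_cast hk
  have hp' : (0 : ℝ) < p := by exact_mod_cast hk.trans_le hkp
  set L := Real.log ((p : ℝ) / k) with hLd
  have hL1 : 1 ≤ L := ((le_max_left _ _).trans (le_max_left _ _)).trans hL
  have hkθ : k ≤ θ / 2 * p := by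
    have h := ((le_max_right _ _).trans (le_max_left _ _)).trans hL
    rw [Real.log_le_log_iff (by positivity) (by positivity), div_le_div_iff₀ hθ0 hk'] at h
    linarith
  have hLM : M ≤ a * L := by
    have := ((le_max_left _ _).trans (le_max_right _ _)).trans hL
    rw [div_le_iff₀ ha0] at this
    linarith
  have hLε : 2 * Real.log ε ^ 2 ≤ L * (a ^ 2 * ψ) := by
    have := ((le_max_right _ _).trans (le_max_right _ _)).trans hL
    rwa [div_le_iff₀ (by positivity)] at this
  have hlogε : 0 < Real.log ε ^ 2 := by
    have : Real.log ε ≠ 0 := (Real.log_neg hε0 (by linarith)).ne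
    positivity
  set r := k * L with hr
  have hr0 : 0 < r := by positivity
  obtain ⟨α, hα, hΔ, hΨ, hthr⟩ := exists_maximizer hc hσ ⟨hα0, hα1⟩ (hψle σ hσ hσ1 hσ2) hψ hr0
  have hΨ0 := hψ.trans_le hΨ
  rw [hthr] at hn
  have hnΨ : n * Psi α c σ ≤ (α - αs) * (1 - η) * r := by
    calc n * Psi α c σ ≤ (α - αs) / Psi α c σ * r * (1 - η) * Psi α c σ := by gcongr
      _ = _ := by field_simp
  have hnN : (n : ℝ) ≤ r / ψ := by
    rw [le_div_iff₀ hψ]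
    have h1 : (α - αs) * (1 - η) ≤ 1 :=
      mul_le_one₀ (by linarith [hα.2]) (by linarith) (by linarith)
    have h2 : (n : ℝ) * ψ ≤ n * Psi α c σ := by gcongr
    calc n * ψ ≤ (α - αs) * (1 - η) * r := h2.trans hnΨ
      _ ≤ 1 * r := by gcongr
      _ = r := one_mul r
  have hnδ : n * δ ≤ a / 2 * r := by
    calc n * δ ≤ r / ψ * δ := by gcongr
      _ = a / 2 * r := by rw [hδ]; field_simp
  obtain ⟨A, hA, hAα, hAg⟩ := exists_small_set (hα0.le.trans hα.1) hα.2
  set U := fun b : Fin p → ℝ => level k c A b with hU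
  have hB : ∀ S : Finset (Fin p), ∃ B : Set (Fin p → ℝ), MeasurableSet B ∧ (S.card = k →
      (coefLaw p k c).real B ≤ V / k ∧ ∀ b ∉ B, |en S b - c| ≤ κ ∧
        |en (S ∩ U b) b - c * g α| ≤ κ ∧
        (α - κ / c) * k ≤ (S ∩ U b).card ∧ (α - κ / c) * p ≤ (U b).card) := by
    intro S
    by_cases hS : S.card = k
    · obtain ⟨B, h1, h2, h3⟩ := htyp α A hA hAα hAg p k S hk hS
      rw [hcκ] at h3
      exact ⟨B, h1, fun _ => ⟨h2, h3⟩⟩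
    · exact ⟨∅, MeasurableSet.empty, fun h => absurd h hS⟩
  choose B hBm hBS using hB
  have hV0 : 0 ≤ V / k := by
    obtain ⟨S, -, hS⟩ := Finset.exists_subset_card_eq
      (show k ≤ (Finset.univ : Finset (Fin p)).card by simpa using hkp)
    exact measureReal_nonneg.trans (hBS S hS).1
  set d₀ := c * g α with hd₀
  have hd₀0 : 0 ≤ d₀ := mul_nonneg hc.le (g_nonneg α)
  set d := ⌊αs * k⌋₊ with hd
  have hdk : (d : ℝ) ≤ αs * k := Nat.floor_le (by positivity)
  have hdk' : d ≤ k := by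
    have : (d : ℝ) ≤ k := hdk.trans (mul_le_of_le_one_left hk'.le hα1.le)
    exact_mod_cast this
  have hmean : ∀ S : Finset (Fin p), S.card = k → ∀ b ∉ B S,
      ∫ q, (ell ε (resp (dir S b 1) q * ip q.1 (dir S b σ))
        - ell ε (resp (dir S b 1) q * ip q.1 (dir (S \ U b) b (Real.sqrt (σ ^ 2 + d₀)))))
          ∂(rowLaw p σ) ≤ Psi α c σ + δ := by
    intro S hS b hb
    obtain ⟨h1, h2, -, -⟩ := (hBS S hS).2 b hb
    have hE : en S b ≤ c + 1 := by linarith [(abs_le.1 h1).2]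
    have h := expected_ratio_le hσ hs₁ hσ1 hε0 hε1 (Finset.sdiff_subset (s := S) (t := U b)) b hE
      hd₀0
    have e : S \ (S \ U b) = S ∩ U b := by
      ext j
      simp
    rw [e] at h
    have hi := (hinfo σ α (en S b) (en (S ∩ U b) b) hσ1 hα.2 (en_nonneg _ _)
      (en_mono Finset.inter_subset_left b) (h1.trans hκ1)).2
      (by linarith [(abs_le.1 h2).2])
    have hea : en S b - en (S ∩ U b) b = en (S \ U b) b := by
      rw [← en_add_en_sdiff (Finset.inter_subset_left (s₁ := S) (s₂ := U b)) b,
        Finset.sdiff_inter_self_left]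
      ring
    rw [hea] at hi
    have herr : Real.sqrt (C * (en (S ∩ U b) b - d₀) ^ 2) / ε ≤ δ / 3 := by
      rw [div_le_iff₀ hε0]
      refine Real.sqrt_le_iff.2 ⟨by positivity, ?_⟩
      calc C * (en (S ∩ U b) b - d₀) ^ 2 ≤ C * κ ^ 2 := by
            rw [← sq_abs]
            gcongr
        _ ≤ (ε * δ / 3) ^ 2 := hκ3
        _ = (δ / 3 * ε) ^ 2 := by ring
    linarith
  have hexp : Real.exp (-(a * r) ^ 2 / (2 * (r / ψ * Real.log ε ^ 2))) ≤ Real.exp (-k) := by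
    rw [Real.exp_le_exp, div_le_iff₀ (by positivity)]
    have h5 : k * (2 * Real.log ε ^ 2) ≤ k * (L * (a ^ 2 * ψ)) := by gcongr
    have h6 : k * (2 * (r / ψ * Real.log ε ^ 2)) ≤ (a * r) ^ 2 := by
      calc k * (2 * (r / ψ * Real.log ε ^ 2)) = r / ψ * (k * (2 * Real.log ε ^ 2)) := by ring
        _ ≤ r / ψ * (k * (L * (a ^ 2 * ψ))) := by gcongr
        _ = (a * r) ^ 2 := by rw [hr]; field_simp
    linarith
  have hs := success_le (n := n) (σ := σ) (τ := Real.sqrt (σ ^ 2 + d₀)) (m₀ := (α - κ / c) * k)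
    (γ := n * (Psi α c σ + δ) + a * r) hσ hε0 hε1 hθ0 (by linarith) hk hkθ hdk' hA hBm
    (fun S hS => (hBS S hS).1) hV0 (Real.exp_pos (-(k : ℝ))).le
    (fun S hS b hb => (ratio_gt_le hε0 hε1 _ _ _ hnN (by positivity) (hmean S hS b hb)).trans hexp)
    (fun S hS b hb => by
      obtain ⟨-, -, h3, h4⟩ := (hBS S hS).2 b hb
      refine ⟨h3, le_trans ?_ h4⟩
      gcongr
      linarith [hα.1]) hD
  -- The leading terms add up to at most `-η * (α - αs) * r ≤ -8 * a * r`. The errors from the mean,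
  -- the deviation, the smoothing, the constants and the level-set count total less than `4 * a *
  -- r`.
  have hlast : Real.exp (n * (Psi α c σ + δ) + a * r - n * Real.log (1 - 2 * ε)) *
      ((8 * Real.exp 1 / θ) ^ k * Real.exp ((d - (α - κ / c) * k) * L)) ≤ Real.exp (-k) := by
    have e : (8 * Real.exp 1 / θ) ^ k = Real.exp (k * (M - 1)) := by
      rw [hM, add_sub_cancel_right, Real.exp_nat_mul, Real.exp_log (by positivity)]
    rw [e, ← Real.exp_add, ← Real.exp_add, Real.exp_le_exp]
    have h1 : n * (-Real.log (1 - 2 * ε)) ≤ n * (δ / 3) := by gcongr; linarith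
    have h2 : k * M ≤ a * r := by
      calc k * M ≤ k * (a * L) := by gcongr
        _ = a * r := by rw [hr]; ring
    have h3 : (d - (α - κ / c) * k) * L ≤ (αs - α + a) * r := by
      calc (d - (α - κ / c) * k) * L ≤ (αs * k - (α - a) * k) * L := by gcongr
        _ = (αs - α + a) * r := by rw [hr]; ring
    have h4 : 8 * a * r ≤ (α - αs) * η * r := by
      have : 8 * a ≤ (α - αs) * η := by
        calc 8 * a = (1 - αs) * ψ * η := by rw [ha]; ring
          _ ≤ (α - αs) * η := by gcongr
      gcongr
    have h5 : 0 < a * r := by positivity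
    linarith
  rw [errProb_eq_one_sub hkp hD]
  linarith

/-! ### Limits and the final assembly -/

lemma tendsto_log_div {k : ℕ → ℕ} (hk : Tendsto k atTop atTop)
    (hkp : (fun p => (k p : ℝ)) =o[atTop] (fun p => (p : ℝ))) :
    Tendsto (fun p : ℕ => Real.log ((p : ℝ) / k p)) atTop atTop := by
  refine Real.tendsto_log_atTop.comp ?_
  have h1 : Tendsto (fun p : ℕ => (k p : ℝ) / p) atTop (𝓝[>] 0) := by
    refine tendsto_nhdsWithin_iff.2 ⟨hkp.tendsto_div_nhds_zero, ?_⟩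
    filter_upwards [hk.eventually_gt_atTop 0, eventually_gt_atTop 0] with p h1 h2
    have h1' : (0 : ℝ) < k p := by exact_mod_cast h1
    have h2' : (0 : ℝ) < p := by exact_mod_cast h2
    exact div_pos h1' h2'
  refine h1.inv_tendsto_nhdsGT_zero.congr fun p => ?_
  simp [inv_div]

lemma tendsto_bound {k : ℕ → ℕ} (hk : Tendsto k atTop atTop) (V : ℝ) :
    Tendsto (fun p => V / (k p : ℝ) + 2 * Real.exp (-(k p : ℝ))) atTop (𝓝 0) := by
  have h : Tendsto (fun p => (k p : ℝ)) atTop atTop := tendsto_natCast_atTop_atTop.comp hk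
  have h1 := h.const_div_atTop V
  have h2 := (Real.tendsto_exp_neg_atTop_nhds_zero.comp h).const_mul 2
  simpa using h1.add h2

lemma eventually_le {k : ℕ → ℕ}
    (hkp : (fun p => (k p : ℝ)) =o[atTop] (fun p => (p : ℝ))) : ∀ᶠ p in atTop, k p ≤ p := by
  filter_upwards [hkp.bound one_pos] with p hp
  simpa using hp

lemma exists_noise_bounds {σ : ℕ → ℝ} (h : (fun p => σ p ^ 2) =Θ[atTop] (fun _ => (1 : ℝ))) :
    ∃ s₁ s₂ : ℝ, 0 < s₁ ∧ ∀ᶠ p in atTop, s₁ ≤ σ p ^ 2 ∧ σ p ^ 2 ≤ s₂ := by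
  obtain ⟨C, -, hC⟩ := h.1.exists_pos
  obtain ⟨c, hc, hc'⟩ := h.2.exists_pos
  refine ⟨1 / c, C, by positivity, ?_⟩
  filter_upwards [hC.bound, hc'.bound] with p h1 h2
  simp only [norm_one, mul_one, norm_pow, Real.norm_eq_abs, sq_abs] at h1 h2
  exact ⟨by rwa [div_le_iff₀' hc], h1⟩

end OneBit

end
theorem corollary5 (k : ℕ → ℕ) (σ : ℕ → ℝ) (c αs : ℝ)
    (hk : Tendsto k atTop atTop)
    (hkp : (fun p => (k p : ℝ)) =o[atTop] (fun p => (p : ℝ)))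
    (hσ : ∀ p, 0 < σ p)
    (hσΘ : (fun p => σ p ^ 2) =Θ[atTop] (fun _ => (1 : ℝ)))
    (hc : 0 < c) (hαs : αs ∈ Ioo (0 : ℝ) 1) :
    (∀ p,
      (∀ α ∈ Icc αs 1, 0 < OneBit.Psi α c (σ p)) ∧
      IsGreatest (OneBit.achObjective c (σ p) (k p) p '' Icc αs 1)
        (OneBit.achThreshold αs c (σ p) (k p) p) ∧
      IsGreatest (OneBit.convObjective αs c (σ p) (k p) p '' Icc αs 1)
        (OneBit.convThreshold αs c (σ p) (k p) p)) ∧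
    (∀ (n : ℕ → ℕ) (η : ℝ), 0 < η →
      (∀ᶠ p in atTop, OneBit.achThreshold αs c (σ p) (k p) p * (1 + η) ≤ n p) →
      ∃ D : ∀ p, OneBit.Decoder p (n p), (∀ p, Measurable (D p)) ∧
        Tendsto (fun p => OneBit.errProb p (n p) (k p) c (σ p) ⌊αs * k p⌋₊ (D p))
          atTop (𝓝 0)) ∧
    (∀ (n : ℕ → ℕ) (η : ℝ), 0 < η →
      (∀ᶠ p in atTop, (n p : ℝ) ≤ OneBit.convThreshold αs c (σ p) (k p) p * (1 - η)) →
      ∀ D : ∀ p, OneBit.Decoder p (n p), (∀ p, Measurable (D p)) →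
        Tendsto (fun p => OneBit.errProb p (n p) (k p) c (σ p) ⌊αs * k p⌋₊ (D p))
          atTop (𝓝 1)) := by
  obtain ⟨s₁, s₂, hs₁, hs⟩ := OneBit.exists_noise_bounds hσΘ
  refine ⟨fun p => ⟨fun α hα => OneBit.Psi_pos hc (hσ p) (hαs.1.trans_le hα.1) hα.2,
    OneBit.isGreatest_achThreshold hc (hσ p) hαs _ _,
    OneBit.isGreatest_convThreshold hc (hσ p) hαs _ _⟩, fun n η hη hn => ?_,
    fun n η hη hn D hD => ?_⟩
  · obtain ⟨L₀, V, H⟩ := OneBit.exists_decoder (s₂ := s₂) hc hαs hη hs₁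
    classical
    -- The bound holds for large `p` only; the constant decoder `∅` fills the remaining values.
    have hex : ∀ p, ∃ D : OneBit.Decoder p (n p), Measurable D ∧
        ((∃ D' : OneBit.Decoder p (n p), Measurable D' ∧
          OneBit.errProb p (n p) (k p) c (σ p) ⌊αs * k p⌋₊ D'
            ≤ V / k p + 2 * Real.exp (-(k p : ℝ))) →
        OneBit.errProb p (n p) (k p) c (σ p) ⌊αs * k p⌋₊ D
          ≤ V / k p + 2 * Real.exp (-(k p : ℝ))) := by
      intro p
      by_cases h : ∃ D' : OneBit.Decoder p (n p), Measurable D' ∧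
          OneBit.errProb p (n p) (k p) c (σ p) ⌊αs * k p⌋₊ D'
            ≤ V / k p + 2 * Real.exp (-(k p : ℝ))
      · obtain ⟨D, hD, hD'⟩ := h
        exact ⟨D, hD, fun _ => hD'⟩
      · exact ⟨fun _ => ∅, measurable_const, fun h' => absurd h' h⟩
    choose D hDm hD using hex
    refine ⟨D, hDm, squeeze_zero' (Eventually.of_forall fun p => measureReal_nonneg) ?_
      (OneBit.tendsto_bound hk V)⟩
    filter_upwards [hs, hn, hk.eventually_gt_atTop 0, OneBit.eventually_le hkp,
      (OneBit.tendsto_log_div hk hkp).eventually_ge_atTop L₀] with p h1 h2 h3 h4 h5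
    exact hD p (H p (n p) (k p) (σ p) h3 h4 (hσ p) h1.1 h1.2 h5 h2)
  -- The finite bound needs a slack of at most `1`. Replacing `η` by `min η 1` only weakens the
  -- assumption on `n`, because the threshold is nonnegative: the objective vanishes at `αs`.
  · have hη' : 0 < min η 1 := lt_min hη one_pos
    obtain ⟨L₀, V, H⟩ := OneBit.exists_errProb_lower_bound (s₂ := s₂) hc hαs hη'
      (min_le_right _ _) hs₁
    have hlim := (OneBit.tendsto_bound hk V).const_sub 1
    rw [sub_zero] at hlim
    refine tendsto_of_tendsto_of_tendsto_of_le_of_le' hlim tendsto_const_nhds ?_ ?_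
    · filter_upwards [hs, hn, hk.eventually_gt_atTop 0, OneBit.eventually_le hkp,
        (OneBit.tendsto_log_div hk hkp).eventually_ge_atTop (max L₀ 0)] with p h1 h2 h3 h4 h5
      refine H p (n p) (k p) (σ p) h3 h4 (hσ p) h1.1 h1.2 ((le_max_left _ _).trans h5)
        (h2.trans ?_) (D p) (hD p)
      refine mul_le_mul_of_nonneg_left (by linarith [min_le_left η 1]) ?_
      refine le_trans (le_of_eq ?_) ((OneBit.isGreatest_convThreshold hc (hσ p) hαs _ _).2
        (mem_image_of_mem _ (left_mem_Icc.2 hαs.2.le)))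
      simp [OneBit.convObjective]
    · filter_upwards [OneBit.eventually_le hkp] with p h4
      have := OneBit.isProbabilityMeasure_uniform h4
      have : IsProbabilityMeasure (OneBit.law p (n p) (k p) c (σ p)) := by
        unfold OneBit.law
        infer_instance
      exact measureReal_le_one
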